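/- Let $\mathfrak H$ be an infinite-dimensional separable complex Hilbert space and $X_1=\{\varphi\in\mathfrak H:\|\varphi\|\le 1\}$. For $n\in\mathbb N=\{0,1,2,\dots\}$ let $\vee^n\mathfrak H=S_n\mathfrak H^{\otimes n}$ be the symmetric subspace of the Hilbert tensor power, and let $\mathscr L^1(\vee^n\mathfrak H)$ be the Banach space of trace-class operators on it, with the trace norm; it is the dual of the space $\mathscr L^\infty(\vee^n\mathfrak H)$ of compact operators under $(T,A)\mapsto \mathrm{Tr}[TA]$, which gives its weak-$*$ topology. A normal state on $\vee^n\mathfrak H$ is a non-negative $\varrho_n\in\mathscr L^1(\vee^n\mathfrak H)$ with $\mathrm{Tr}\,\varrho_n=1$; for $k\le n$ its reduced density matrix is the unique non-negative $\varrho_n^{(k)}\in\mathscr L^1(\vee^k\mathfrak H)$ such that $\mathrm{Tr}[\varrho_n\,(A\otimes 1^{(n-k)})]=\mathrm{Tr}[\varrho_n^{(k)}A]$ for all bounded operators $A$ on $\vee^k\mathfrak H$. A symmetric hierarchy is a sequence $(\gamma^{(k)})_{k\in\mathbb N}\in\prod_k\mathscr L^1(\vee^k\mathfrak H)$ for which there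 are a sequence $(\varrho_n)_{n\in\mathbb N}$ of normal states on $\vee^n\mathfrak H$ and a subsequence $(\varrho_{n_i})_i$ such that, for every $k$, $\varrho_{n_i}^{(k)}\to\gamma^{(k)}$ weakly-$*$ as $i\to\infty$. Let $\mathscr H(\mathfrak H)$ be the set of symmetric hierarchies. Let $\mathscr M(\mathfrak H)$ be the set of Borel probability measures $\mu$ on $X_1$ that are $U(1)$-invariant, i.e. invariant under $\varphi\mapsto e^{i\theta}\varphi$ for all $\theta\in\mathbb R$. The weak (resp. strong) narrow topology on $\mathscr M(\mathfrak H)$ is the coarsest one for which $\mu\mapsto\int f\,d\mu$ is continuous for every bounded $f:X_1\to\mathbb R$ that is continuous for the weak (resp. norm) topology of $\mathfrak H$ on $X_1$. Then for every $\mu\in\mathscr M(\mathfrak H)$ and $k\in\mathbb N$ the map $\varphi\mapsto|\varphi^{\otimes k}\rangle\langle\varphi^{\otimes k}|$ is Bochner integrable in $\mathscr L^1(\vee^k\mathfrak H)$ with respect to $\mu$, and $$\Phi:\mathscr M(\mathfrak H)\to\mathscr H(\mathfrak H),\qquad \Phi(\mu)=\Big(\int_{X_1}|\varphi^{\otimes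 k}\rangle\langle\varphi^{\otimes k}|\,d\mu(\varphi)\Big)_{k\in\mathbb N},$$ is a well-defined bijection. Moreover $\Phi$ is a homeomorphism in each of the two cases: 1. $\mathscr M(\mathfrak H)$ has the weak narrow topology, and $\mathscr H(\mathfrak H)$ has the topology induced by the product over $k$ of the weak-$*$ topologies of $\mathscr L^1(\vee^k\mathfrak H)$; 2. $\mathscr M(\mathfrak H)$ has the strong narrow topology, and $\mathscr H(\mathfrak H)$ has the topology induced by the product over $k$ of the trace-norm topologies of $\mathscr L^1(\vee^k\mathfrak H)$. -/

import Mathlib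

open MeasureTheory Filter Topology
open scoped ENNReal InnerProductSpace

namespace SymHier

section TraceClass

variable (K : Type*) [NormedAddCommGroup K] [InnerProductSpace ℂ K]

variable {K} in
/-- The trace norm `‖T‖₁ = Tr |T| ∈ [0, ∞]` of a bounded operator on a Hilbert space, as the supremum
of `∑ i, |⟨e i, T (f i)⟩|` over all pairs of finite orthonormal systems. -/
noncomputable def traceNorm (T : K →L[ℂ] K) : ℝ≥0∞ :=
  ⨆ (n : ℕ) (e : Fin n → K) (f : Fin n → K) (_ : Orthonormal ℂ e) (_ : Orthonormal ℂ f),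
    ∑ i, ‖⟪e i, T (f i)⟫_ℂ‖ₑ

variable {K}

lemma le_traceNorm (T : K →L[ℂ] K) {n : ℕ} {e f : Fin n → K} (he : Orthonormal ℂ e)
    (hf : Orthonormal ℂ f) : ∑ i, ‖⟪e i, T (f i)⟫_ℂ‖ₑ ≤ traceNorm T :=
  le_iSup_of_le n <| le_iSup_of_le e <| le_iSup_of_le f <| le_iSup_of_le he <|
    le_iSup_of_le hf le_rfl

lemma traceNorm_le {T : K →L[ℂ] K} {C : ℝ≥0∞}
    (h : ∀ (n : ℕ) (e f : Fin n → K), Orthonormal ℂ e → Orthonormal ℂ f →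
      ∑ i, ‖⟪e i, T (f i)⟫_ℂ‖ₑ ≤ C) : traceNorm T ≤ C :=
  iSup_le fun n => iSup_le fun e => iSup_le fun f => iSup_le fun he => iSup_le fun hf =>
    h n e f he hf

lemma traceNorm_zero : traceNorm (0 : K →L[ℂ] K) = 0 :=
  le_antisymm (traceNorm_le fun n e f _ _ => by simp) bot_le

lemma traceNorm_add_le (S T : K →L[ℂ] K) : traceNorm (S + T) ≤ traceNorm S + traceNorm T := by
  refine traceNorm_le fun n e f he hf => ?_
  calc ∑ i, ‖⟪e i, (S + T) (f i)⟫_ℂ‖ₑ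
      ≤ ∑ i, (‖⟪e i, S (f i)⟫_ℂ‖ₑ + ‖⟪e i, T (f i)⟫_ℂ‖ₑ) := by
        refine Finset.sum_le_sum fun i _ => ?_
        rw [_root_.add_apply, inner_add_right]
        exact enorm_add_le _ _
    _ ≤ _ := by
        rw [Finset.sum_add_distrib]
        exact add_le_add (le_traceNorm S he hf) (le_traceNorm T he hf)

lemma traceNorm_smul_le (c : ℂ) (T : K →L[ℂ] K) : traceNorm (c • T) ≤ ‖c‖ₑ * traceNorm T := by
  refine traceNorm_le fun n e f he hf => ?_
  calc ∑ i, ‖⟪e i, (c • T) (f i)⟫_ℂ‖ₑ = ‖c‖ₑ * ∑ i, ‖⟪e i, T (f i)⟫_ℂ‖ₑ := by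
        rw [Finset.mul_sum]
        refine Finset.sum_congr rfl fun i _ => ?_
        rw [_root_.smul_apply, inner_smul_right, enorm_mul]
    _ ≤ _ := by gcongr; exact le_traceNorm T he hf

lemma traceNorm_smul (c : ℂ) (T : K →L[ℂ] K) : traceNorm (c • T) = ‖c‖ₑ * traceNorm T := by
  refine le_antisymm (traceNorm_smul_le c T) ?_
  rcases eq_or_ne c 0 with rfl | hc
  · simp
  · have h := traceNorm_smul_le c⁻¹ (c • T)
    rw [inv_smul_smul₀ hc, enorm_inv hc] at h
    have hc' : ‖c‖ₑ ≠ 0 := by simpa using hc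
    calc ‖c‖ₑ * traceNorm T ≤ ‖c‖ₑ * (‖c‖ₑ⁻¹ * traceNorm (c • T)) := by gcongr
      _ = traceNorm (c • T) := by
        rw [← mul_assoc, ENNReal.mul_inv_cancel hc' (by simp), one_mul]

lemma enorm_inner_le_traceNorm (T : K →L[ℂ] K) {e f : K} (he : ‖e‖ = 1) (hf : ‖f‖ = 1) :
    ‖⟪e, T f⟫_ℂ‖ₑ ≤ traceNorm T := by
  have h := le_traceNorm T (n := 1) (e := fun _ => e) (f := fun _ => f)
    ⟨fun _ => he, fun i j hij => (hij (Subsingleton.elim _ _)).elim⟩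
    ⟨fun _ => hf, fun i j hij => (hij (Subsingleton.elim _ _)).elim⟩
  simpa using h

/-- The operator norm is bounded by the trace norm. -/
lemma enorm_le_traceNorm (T : K →L[ℂ] K) : ‖T‖ₑ ≤ traceNorm T := by
  by_cases htop : traceNorm T = ⊤
  · simp [htop]
  rw [← ENNReal.ofReal_toReal htop, ← ofReal_norm]
  refine ENNReal.ofReal_le_ofReal (T.opNorm_le_bound ENNReal.toReal_nonneg fun x => ?_)
  rcases eq_or_ne x 0 with rfl | hx
  · simp
  rcases eq_or_ne (T x) 0 with hTx | hTx
  · rw [hTx, norm_zero]; positivity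
  have hx' : (‖x‖ : ℂ) ≠ 0 := by simpa using hx
  have hT' : (‖T x‖ : ℂ) ≠ 0 := by simpa using hTx
  have h := enorm_inner_le_traceNorm T (e := ((‖T x‖ : ℂ)⁻¹) • T x) (f := ((‖x‖ : ℂ)⁻¹) • x)
    (by simp [norm_smul, hTx]) (by simp [norm_smul, hx])
  have h2 := ENNReal.toReal_mono htop h
  rw [toReal_enorm] at h2
  have h3 : ‖⟪((‖T x‖ : ℂ)⁻¹) • T x, T (((‖x‖ : ℂ)⁻¹) • x)⟫_ℂ‖ = ‖T x‖ / ‖x‖ := by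
    rw [map_smul, inner_smul_left, inner_smul_right, inner_self_eq_norm_sq_to_K]
    have h0 : ‖T x‖ ≠ 0 := by simpa using hTx
    simp only [norm_mul, map_inv₀, norm_inv, norm_pow, RCLike.norm_conj, Complex.norm_real,
      norm_norm, Complex.coe_algebraMap]
    field_simp
  rw [h3, div_le_iff₀ (norm_pos_iff.2 hx)] at h2
  exact h2

/-- The rank-one operator `|x⟩⟨y|` has finite trace norm. -/
lemma traceNorm_rankOne_le (x y : K) :
    traceNorm (InnerProductSpace.rankOne ℂ x y) ≤ ‖x‖ₑ * ‖y‖ₑ := by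
  refine traceNorm_le fun n e f he hf => ?_
  have h1 : ∑ i, ‖⟪e i, x⟫_ℂ‖ * ‖⟪f i, y⟫_ℂ‖ ≤ ‖x‖ * ‖y‖ := by
    refine (Real.sum_mul_le_sqrt_mul_sqrt _ _ _).trans ?_
    refine mul_le_mul ?_ ?_ (Real.sqrt_nonneg _) (norm_nonneg _)
    · exact Real.sqrt_le_iff.2 ⟨norm_nonneg _, he.sum_inner_products_le x⟩
    · exact Real.sqrt_le_iff.2 ⟨norm_nonneg _, hf.sum_inner_products_le y⟩
  calc ∑ i, ‖⟪e i, InnerProductSpace.rankOne ℂ x y (f i)⟫_ℂ‖ₑ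
      = ENNReal.ofReal (∑ i, ‖⟪e i, x⟫_ℂ‖ * ‖⟪f i, y⟫_ℂ‖) := by
        rw [ENNReal.ofReal_sum_of_nonneg (fun i _ => by positivity)]
        refine Finset.sum_congr rfl fun i _ => ?_
        rw [InnerProductSpace.rankOne_apply, inner_smul_right, ← ofReal_norm, norm_mul,
          norm_inner_symm (f i) y, mul_comm]
    _ ≤ ENNReal.ofReal (‖x‖ * ‖y‖) := ENNReal.ofReal_le_ofReal h1
    _ = _ := by rw [ENNReal.ofReal_mul (norm_nonneg _), ofReal_norm, ofReal_norm]

variable (K) in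
/-- The trace-class operators, as a subspace of the bounded operators. -/
def traceClassSubmodule : Submodule ℂ (K →L[ℂ] K) where
  carrier := {T | traceNorm T < ∞}
  add_mem' hS hT := (traceNorm_add_le _ _).trans_lt (ENNReal.add_lt_top.2 ⟨hS, hT⟩)
  zero_mem' := by simp [traceNorm_zero]
  smul_mem' c T hT := by
    simp only [Set.mem_ofPred_eq, traceNorm_smul]
    exact ENNReal.mul_lt_top (by simp) hT

variable (K) in
/-- The space `𝓛¹(K)` of trace-class operators; its topology and norm are those of the trace norm
(not of the operator norm). -/
def TraceClass : Type _ := traceClassSubmodule K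

namespace TraceClass

instance : AddCommGroup (TraceClass K) := inferInstanceAs (AddCommGroup (traceClassSubmodule K))
instance : Module ℂ (TraceClass K) := inferInstanceAs (Module ℂ (traceClassSubmodule K))

/-- The underlying bounded operator. -/
def op (T : TraceClass K) : K →L[ℂ] K := Subtype.val T

/-- A bounded operator of finite trace norm, as an element of `𝓛¹(K)`. -/
def mk (T : K →L[ℂ] K) (hT : traceNorm T < ∞) : TraceClass K :=
  (⟨T, hT⟩ : traceClassSubmodule K)

@[simp] lemma op_mk (T : K →L[ℂ] K) (hT : traceNorm T < ∞) : (mk T hT).op = T := rfl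

lemma traceNorm_op_lt_top (T : TraceClass K) : traceNorm T.op < ∞ := Subtype.property T

@[ext] lemma ext {S T : TraceClass K} (h : S.op = T.op) : S = T := Subtype.ext h

@[simp] lemma op_zero : (0 : TraceClass K).op = 0 := rfl
@[simp] lemma op_add (S T : TraceClass K) : (S + T).op = S.op + T.op := rfl
@[simp] lemma op_sub (S T : TraceClass K) : (S - T).op = S.op - T.op := rfl
@[simp] lemma op_smul (c : ℂ) (T : TraceClass K) : (c • T).op = c • T.op := rfl

noncomputable instance : Norm (TraceClass K) := ⟨fun T => (traceNorm T.op).toReal⟩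

lemma norm_def (T : TraceClass K) : ‖T‖ = (traceNorm T.op).toReal := rfl

lemma opNorm_le (T : TraceClass K) : ‖T.op‖ ≤ ‖T‖ := by
  have h := ENNReal.toReal_mono T.traceNorm_op_lt_top.ne (enorm_le_traceNorm T.op)
  rwa [toReal_enorm] at h

variable (K) in
lemma normCore : NormedSpace.Core ℂ (TraceClass K) where
  norm_nonneg T := ENNReal.toReal_nonneg
  norm_smul c T := by
    rw [norm_def, norm_def, op_smul, traceNorm_smul, ENNReal.toReal_mul, toReal_enorm]
  norm_triangle S T := by
    rw [norm_def, norm_def, norm_def, op_add,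
      ← ENNReal.toReal_add S.traceNorm_op_lt_top.ne T.traceNorm_op_lt_top.ne]
    exact ENNReal.toReal_mono
      (ENNReal.add_lt_top.2 ⟨S.traceNorm_op_lt_top, T.traceNorm_op_lt_top⟩).ne
      (traceNorm_add_le _ _)
  norm_eq_zero_iff T := by
    constructor
    · intro h
      have h1 := opNorm_le T
      rw [h] at h1
      exact ext (norm_le_zero_iff.1 h1)
    · rintro rfl
      rw [norm_def, op_zero, traceNorm_zero, ENNReal.toReal_zero]

noncomputable instance : NormedAddCommGroup (TraceClass K) := NormedAddCommGroup.ofCore (normCore K)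
noncomputable instance : NormedSpace ℂ (TraceClass K) := NormedSpace.ofCore (normCore K)

lemma enorm_eq (T : TraceClass K) : ‖T‖ₑ = traceNorm T.op := by
  rw [← ofReal_norm, norm_def, ENNReal.ofReal_toReal T.traceNorm_op_lt_top.ne]

/-- `𝓛¹(K)` is a Banach space, so that Bochner integrals in it make sense. -/
instance [CompleteSpace K] : CompleteSpace (TraceClass K) := by
  refine Metric.complete_of_cauchySeq_tendsto fun u hu => ?_
  have hcau : CauchySeq fun n => (u n).op := by
    rw [Metric.cauchySeq_iff'] at hu ⊢
    intro ε hε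
    obtain ⟨N, hN⟩ := hu ε hε
    refine ⟨N, fun n hn => lt_of_le_of_lt ?_ (hN n hn)⟩
    rw [dist_eq_norm, dist_eq_norm, ← op_sub]
    exact opNorm_le _
  obtain ⟨T, hT⟩ := cauchySeq_tendsto_of_complete hcau
  have key : ∀ ε : ℝ, 0 < ε → ∃ N, ∀ n ≥ N, traceNorm ((u n).op - T) ≤ ENNReal.ofReal ε := by
    intro ε hε
    obtain ⟨N, hN⟩ := Metric.cauchySeq_iff.1 hu ε hε
    refine ⟨N, fun n hn => traceNorm_le fun m e f he hf => ?_⟩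
    have hlim : Tendsto (fun p => ∑ i, ‖⟪e i, ((u n).op - (u p).op) (f i)⟫_ℂ‖ₑ) atTop
        (𝓝 (∑ i, ‖⟪e i, ((u n).op - T) (f i)⟫_ℂ‖ₑ)) := by
      refine tendsto_finsetSum _ fun i _ => ?_
      refine Tendsto.enorm ?_
      refine Tendsto.inner tendsto_const_nhds ?_
      have h1 : Tendsto (fun p => (u n).op - (u p).op) atTop (𝓝 ((u n).op - T)) :=
        tendsto_const_nhds.sub hT
      exact ((ContinuousLinearMap.apply ℂ K (f i)).continuous.tendsto _).comp h1
    refine le_of_tendsto hlim (eventually_atTop.2 ⟨N, fun p hp => ?_⟩)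
    refine (le_traceNorm _ he hf).trans ?_
    rw [← op_sub, ← enorm_eq, ← ofReal_norm, ← dist_eq_norm]
    exact ENNReal.ofReal_le_ofReal (hN n hn p hp).le
  have hTmem : traceNorm T < ∞ := by
    obtain ⟨N, hN⟩ := key 1 one_pos
    have h2 : T = (u N).op + (-1 : ℂ) • ((u N).op - T) := by simp
    rw [h2]
    refine (traceNorm_add_le _ _).trans_lt (ENNReal.add_lt_top.2
      ⟨(u N).traceNorm_op_lt_top, ?_⟩)
    rw [traceNorm_smul]
    exact ENNReal.mul_lt_top (by simp) ((hN N le_rfl).trans_lt ENNReal.ofReal_lt_top)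
  refine ⟨mk T hTmem, Metric.tendsto_atTop.2 fun ε hε => ?_⟩
  obtain ⟨N, hN⟩ := key (ε / 2) (half_pos hε)
  refine ⟨N, fun n hn => ?_⟩
  rw [dist_eq_norm, norm_def, op_sub, op_mk]
  have h3 := ENNReal.toReal_mono ENNReal.ofReal_ne_top (hN n hn)
  rw [ENNReal.toReal_ofReal (half_pos hε).le] at h3
  exact lt_of_le_of_lt h3 (half_lt_self hε)

/-- The rank-one operator `|x⟩⟨x|` as a trace-class operator. -/
noncomputable def dyad (x : K) : TraceClass K :=
  mk (InnerProductSpace.rankOne ℂ x x) <|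
    (traceNorm_rankOne_le x x).trans_lt (ENNReal.mul_lt_top (by simp) (by simp))

@[simp] lemma dyad_op_apply (x y : K) : (dyad x).op y = ⟪x, y⟫_ℂ • x := rfl

end TraceClass

lemma summable_trace {T : K →L[ℂ] K} (hT : traceNorm T < ∞) {ι : Type*} {b : ι → K}
    (hb : Orthonormal ℂ b) : Summable fun i => ‖⟪b i, T (b i)⟫_ℂ‖ := by
  refine summable_of_sum_le (c := (traceNorm T).toReal) (fun i => norm_nonneg _) fun s => ?_
  let v : Fin s.card → K := fun i => b (s.equivFin.symm i)
  have hv : Orthonormal ℂ v :=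
    hb.comp (fun i => (s.equivFin.symm i : ι))
      (Subtype.val_injective.comp s.equivFin.symm.injective)
  have h := ENNReal.toReal_mono hT.ne (le_traceNorm T hv hv)
  rw [ENNReal.toReal_sum (fun i _ => by simp)] at h
  simp only [toReal_enorm] at h
  refine le_trans (le_of_eq ?_) h
  rw [← Finset.sum_coe_sort s]
  exact (s.equivFin.symm.sum_comp fun i : s => ‖⟪b i, T (b i)⟫_ℂ‖).symm

variable [CompleteSpace K]

variable (K) in
/-- The index set of a fixed orthonormal basis of the Hilbert space `K`. -/
noncomputable def basisIndex : Set K := (exists_hilbertBasis ℂ K).choose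

variable (K) in
/-- A fixed orthonormal basis of the Hilbert space `K`. -/
noncomputable def basis : HilbertBasis (basisIndex K) ℂ K :=
  (exists_hilbertBasis ℂ K).choose_spec.choose

/-- The trace `Tr T = ∑ i, ⟨e i, T (e i)⟩` over an orthonormal basis; for trace-class `T` the series
converges absolutely and its sum does not depend on the basis. -/
noncomputable def trace (T : K →L[ℂ] K) : ℂ := ∑' i, ⟪basis K i, T (basis K i)⟫_ℂ

variable (K) in
/-- The weak-∗ topology on `𝓛¹(K)`, as the dual of the compact operators under `⟨T, A⟩ = Tr (T A)`. -/
@[reducible] noncomputable def weakStarTopology : TopologicalSpace (TraceClass K) :=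
  ⨅ A : {A : K →L[ℂ] K // IsCompactOperator A},
    TopologicalSpace.induced (fun T : TraceClass K => trace (T.op ∘L A.1)) inferInstance

/-- A normal state (density operator): a non-negative trace-class operator of trace one. -/
def IsNormalState (ϱ : TraceClass K) : Prop := ϱ.op.IsPositive ∧ trace ϱ.op = 1

end TraceClass


section TensorPower

variable {H : Type*} [NormedAddCommGroup H] [InnerProductSpace ℂ H] [CompleteSpace H]

variable (H) in
/-- The Hilbert tensor power `H^{⊗n}`, realised as `ℓ²` over the multi-indices `I`: the coordinates
of a tensor are those with respect to the orthonormal basis `e (I 0) ⊗ ⋯ ⊗ e (I (n-1))`, where `e` is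
a fixed orthonormal basis of `H`. By `inner_tensor` and `dense_span_tensor` below, this is the
completion of the algebraic tensor power for the usual inner product. -/
abbrev TensorPower (n : ℕ) : Type _ := lp (fun _ : Fin n → basisIndex H => ℂ) 2

lemma summable_prod_pi {ι : Type*} (n : ℕ) (g : Fin n → ι → ℂ)
    (hg : ∀ j, Summable fun i => ‖g j i‖) :
    (Summable fun I : Fin n → ι => ‖∏ j, g j (I j)‖) ∧
      HasSum (fun I : Fin n → ι => ∏ j, g j (I j)) (∏ j, ∑' i, g j i) := by
  induction n with
  | zero =>
    refine ⟨(hasSum_fintype _).summable, ?_⟩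
    convert hasSum_fintype (fun I : Fin 0 → ι => ∏ j, g j (I j)) using 1
    simp
  | succ n ih =>
    obtain ⟨h1, h2⟩ := ih (fun j => g j.succ) (fun j => hg j.succ)
    let e := Fin.consEquiv (fun _ : Fin (n + 1) => ι)
    have hfun : ∀ p : ι × (Fin n → ι),
        ∏ j, g j (e p j) = g 0 p.1 * ∏ j : Fin n, g j.succ (p.2 j) := by
      intro p
      rw [Fin.prod_univ_succ]
      simp [e, Fin.consEquiv]
    have hs : Summable fun p : ι × (Fin n → ι) => ‖g 0 p.1 * ∏ j : Fin n, g j.succ (p.2 j)‖ :=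
      Summable.mul_norm (f := g 0) (g := fun I : Fin n → ι => ∏ j : Fin n, g j.succ (I j)) (hg 0) h1
    have h3 : HasSum (fun p : ι × (Fin n → ι) => g 0 p.1 * ∏ j : Fin n, g j.succ (p.2 j))
        ((∑' i, g 0 i) * ∏ j : Fin n, ∑' i, g j.succ i) :=
      HasSum.mul (f := g 0) (g := fun I : Fin n → ι => ∏ j : Fin n, g j.succ (I j))
        (Summable.hasSum (Summable.of_norm (hg 0))) h2 (Summable.of_norm hs)
    rw [Fin.prod_univ_succ]
    constructor
    · rw [← e.summable_iff]
      refine hs.congr fun p => ?_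
      rw [Function.comp_apply, hfun]
    · rw [← e.hasSum_iff]
      have h4 : (fun I : Fin (n + 1) → ι => ∏ j, g j (I j)) ∘ e =
          fun p => g 0 p.1 * ∏ j : Fin n, g j.succ (p.2 j) := funext hfun
      rw [h4]
      exact h3

lemma summable_coord (f g : H) :
    Summable fun i => ‖⟪f, basis H i⟫_ℂ * ⟪basis H i, g⟫_ℂ‖ :=
  ((basis H).summable_inner_mul_inner f g).norm

lemma memℓp_tensor {n : ℕ} (f : Fin n → H) :
    Memℓp (fun I : Fin n → basisIndex H => ∏ j, ⟪basis H (I j), f j⟫_ℂ) 2 := by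
  refine memℓp_gen ?_
  refine (summable_prod_pi n _ fun j => summable_coord (f j) (f j)).1.congr fun I => ?_
  simp only [ENNReal.toReal_ofNat, Real.rpow_ofNat]
  rw [norm_prod, norm_prod, ← Finset.prod_pow]
  refine Finset.prod_congr rfl fun j _ => ?_
  rw [norm_mul, norm_inner_symm, sq]

/-- The elementary tensor `f 0 ⊗ ⋯ ⊗ f (n-1)`. -/
noncomputable def tensor {n : ℕ} (f : Fin n → H) : TensorPower H n :=
  ⟨fun I => ∏ j, ⟪basis H (I j), f j⟫_ℂ, memℓp_tensor f⟩

lemma tensor_apply {n : ℕ} (f : Fin n → H) (I : Fin n → basisIndex H) :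
    tensor f I = ∏ j, ⟪basis H (I j), f j⟫_ℂ := rfl

/-- The inner product of elementary tensors. -/
lemma inner_tensor {n : ℕ} (f g : Fin n → H) :
    ⟪tensor f, tensor g⟫_ℂ = ∏ j, ⟪f j, g j⟫_ℂ := by
  rw [lp.inner_eq_tsum]
  have h := (summable_prod_pi n _ fun j => summable_coord (f j) (g j)).2
  simp only [(basis H).tsum_inner_mul_inner] at h
  rw [← h.tsum_eq]
  refine tsum_congr fun I => ?_
  rw [tensor_apply, tensor_apply, Finset.prod_mul_distrib, RCLike.inner_apply, map_prod, mul_comm]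
  simp only [inner_conj_symm]

/-- Elementary tensors are total in the tensor power. -/
lemma dense_span_tensor (n : ℕ) :
    (Submodule.span ℂ (Set.range (tensor : (Fin n → H) → TensorPower H n))).topologicalClosure
      = ⊤ := by
  classical
  rw [Submodule.topologicalClosure_eq_top_iff, Submodule.eq_bot_iff]
  intro ψ hψ
  rw [Submodule.mem_orthogonal] at hψ
  ext I
  have h := hψ (tensor fun j => basis H (I j)) (Submodule.subset_span ⟨_, rfl⟩)
  have h2 : tensor (fun j => basis H (I j)) = lp.single 2 I (1 : ℂ) := by
    ext J
    rw [tensor_apply, lp.single_apply]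
    have hb : ∀ i j, ⟪basis H i, basis H j⟫_ℂ = if i = j then 1 else 0 :=
      orthonormal_iff_ite.1 (basis H).orthonormal
    simp only [hb]
    by_cases hJ : J = I
    · subst hJ; simp
    · obtain ⟨j, hj⟩ := Function.ne_iff.1 hJ
      rw [Finset.prod_eq_zero (Finset.mem_univ j) (by simp [hj])]
      simp [hJ]
  rw [h2, lp.inner_single_left] at h
  simpa using h

/-- The unitary `U_π` on the tensor power, given by `f 0 ⊗ ⋯ ⊗ f (n-1) ↦ f (π 0) ⊗ ⋯ ⊗ f (π (n-1))`
(see `permOp_tensor`). -/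
noncomputable def permOp {n : ℕ} (π : Equiv.Perm (Fin n)) : TensorPower H n →ₗᵢ[ℂ] TensorPower H n where
  toFun ψ := ⟨fun I => ψ (I ∘ π.symm), memℓp_gen <|
    ((Equiv.arrowCongr π (Equiv.refl _)).summable_iff (f := fun I => ‖ψ I‖ ^ _)).2
      ((lp.memℓp ψ).summable (by simp))⟩
  map_add' ψ χ := rfl
  map_smul' c ψ := rfl
  norm_map' ψ := by
    rw [lp.norm_eq_tsum_rpow (by simp), lp.norm_eq_tsum_rpow (by simp)]
    congr 1
    exact (Equiv.arrowCongr π (Equiv.refl _)).tsum_eq (fun I => ‖ψ I‖ ^ _)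

lemma permOp_apply {n : ℕ} (π : Equiv.Perm (Fin n)) (ψ : TensorPower H n)
    (I : Fin n → basisIndex H) : permOp π ψ I = ψ (I ∘ π.symm) := rfl

lemma permOp_tensor {n : ℕ} (π : Equiv.Perm (Fin n)) (f : Fin n → H) :
    permOp π (tensor f) = tensor fun j => f (π j) := by
  ext I
  rw [permOp_apply, tensor_apply, tensor_apply]
  exact (Equiv.prod_comp π fun j => ⟪basis H ((I ∘ π.symm) j), f j⟫_ℂ).symm.trans (by simp)

lemma permOp_permOp {n : ℕ} (π σ : Equiv.Perm (Fin n)) (ψ : TensorPower H n) :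
    permOp π (permOp σ ψ) = permOp (σ * π) ψ := by
  ext I
  rfl

variable (H) in
/-- The symmetrisation `S_n = (1/n!) ∑_π U_π`. -/
noncomputable def symOp (n : ℕ) : TensorPower H n →L[ℂ] TensorPower H n :=
  ((n.factorial : ℂ)⁻¹) • ∑ π : Equiv.Perm (Fin n), (permOp π).toContinuousLinearMap

lemma symOp_apply {n : ℕ} (ψ : TensorPower H n) :
    symOp H n ψ = ((n.factorial : ℂ)⁻¹) • ∑ π : Equiv.Perm (Fin n), permOp π ψ := by
  simp [symOp]

variable (H) in
/-- The symmetric tensor power `∨ⁿ H = S_n H^{⊗n}`. -/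
noncomputable def symPower (n : ℕ) : Submodule ℂ (TensorPower H n) := (symOp H n).range

/-- `∨ⁿ H` consists of the tensors fixed by all the `U_π`. -/
lemma mem_symPower_iff {n : ℕ} {ψ : TensorPower H n} :
    ψ ∈ symPower H n ↔ ∀ π : Equiv.Perm (Fin n), permOp π ψ = ψ := by
  constructor
  · rintro ⟨χ, rfl⟩ π
    change permOp π (symOp H n χ) = symOp H n χ
    rw [symOp_apply, map_smul, map_sum]
    simp only [permOp_permOp]
    congr 1
    exact Equiv.sum_comp (Equiv.mulRight π) fun σ => permOp σ χ
  · intro h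
    refine ⟨ψ, ?_⟩
    change symOp H n ψ = ψ
    rw [symOp_apply]
    simp only [h, Finset.sum_const, Finset.card_univ, Fintype.card_perm, Fintype.card_fin]
    rw [← Nat.cast_smul_eq_nsmul ℂ, smul_smul, inv_mul_cancel₀, one_smul]
    exact_mod_cast n.factorial_ne_zero

lemma isClosed_symPower (n : ℕ) : IsClosed (symPower H n : Set (TensorPower H n)) := by
  have h : (symPower H n : Set (TensorPower H n)) =
      ⋂ π : Equiv.Perm (Fin n), {ψ | permOp π ψ = ψ} := by
    ext ψ
    simp [mem_symPower_iff]
  rw [h]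
  exact isClosed_iInter fun π => isClosed_eq (permOp π).continuous continuous_id

instance (n : ℕ) : CompleteSpace (symPower H n) := (isClosed_symPower n).completeSpace_coe

/-- The vector `φ^{⊗n}` of `∨ⁿ H`. -/
noncomputable def tensorPow (n : ℕ) (φ : H) : symPower H n :=
  ⟨tensor fun _ => φ, mem_symPower_iff.2 fun π => permOp_tensor π _⟩

/-- An operator on `∨ⁿ H`, extended to `H^{⊗n}` by zero on the orthogonal complement. -/
noncomputable def extendOp {n : ℕ} (A : symPower H n →L[ℂ] symPower H n) :
    TensorPower H n →L[ℂ] TensorPower H n :=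
  (symPower H n).subtypeL ∘L A ∘L (symPower H n).orthogonalProjectionOnto

lemma enorm_sq_eq_tsum {ι : Type*} (ψ : lp (fun _ : ι => ℂ) 2) :
    ‖ψ‖ₑ ^ 2 = ∑' i, ‖ψ i‖ₑ ^ 2 := by
  have h := lp.norm_rpow_eq_tsum (p := 2) (by simp) ψ
  have hs := (lp.memℓp ψ).summable (by simp)
  simp only [ENNReal.toReal_ofNat, Real.rpow_ofNat] at h hs
  rw [← ofReal_norm, ← ENNReal.ofReal_pow (norm_nonneg _), h,
    ENNReal.ofReal_tsum_of_nonneg (fun i => by positivity) hs]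
  refine tsum_congr fun i => ?_
  rw [ENNReal.ofReal_pow (norm_nonneg _), ofReal_norm]

lemma memℓp_two_of_tsum {ι : Type*} {ψ : ι → ℂ} (h : ∑' i, ‖ψ i‖ₑ ^ 2 ≠ ∞) : Memℓp ψ 2 := by
  refine memℓp_gen ?_
  refine (ENNReal.summable_toReal h).congr fun i => ?_
  simp

lemma enorm_le_of_tsum_le {ι : Type*} (ψ : lp (fun _ : ι => ℂ) 2) (C : ℝ≥0∞)
    (h : ∑' i, ‖ψ i‖ₑ ^ 2 ≤ C ^ 2) : ‖ψ‖ₑ ≤ C := by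
  rw [← enorm_sq_eq_tsum] at h
  exact (ENNReal.pow_le_pow_left_iff two_ne_zero).1 h

/-- For fixed last `m` indices `J`, the tensor `ψ(·, J)` in `H^{⊗k}`. -/
noncomputable def slice {k m : ℕ} (J : Fin m → basisIndex H) (ψ : TensorPower H (k + m)) :
    TensorPower H k :=
  ⟨fun I => ψ (Fin.append I J), memℓp_gen <|
    ((lp.memℓp ψ).summable (by simp)).comp_injective (i := fun I => Fin.append I J)
      fun I I' h => funext fun i => by simpa using congrFun h (Fin.castAdd m i)⟩

lemma tsum_append {k m : ℕ} {ι : Type*} (F : (Fin (k + m) → ι) → ℝ≥0∞) :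
    ∑' I, F I = ∑' (J : Fin m → ι) (I : Fin k → ι), F (Fin.append I J) := by
  rw [← (Fin.appendEquiv k m).tsum_eq, ENNReal.tsum_prod', ENNReal.tsum_comm]
  rfl

lemma tsum_ampl {k m : ℕ} (A : TensorPower H k →L[ℂ] TensorPower H k) (ψ : TensorPower H (k + m)) :
    ∑' I : Fin (k + m) → basisIndex H,
      ‖A (slice (fun j => I (Fin.natAdd k j)) ψ) (fun i => I (Fin.castAdd m i))‖ₑ ^ 2
      ≤ (‖A‖ₑ * ‖ψ‖ₑ) ^ 2 := by
  rw [tsum_append, mul_pow, enorm_sq_eq_tsum ψ, tsum_append (fun I => ‖ψ I‖ₑ ^ 2),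
    ← ENNReal.tsum_mul_left]
  refine ENNReal.tsum_le_tsum fun J => ?_
  simp only [Fin.append_left, Fin.append_right]
  calc ∑' I : Fin k → basisIndex H, ‖A (slice J ψ) I‖ₑ ^ 2 = ‖A (slice J ψ)‖ₑ ^ 2 :=
        (enorm_sq_eq_tsum _).symm
    _ ≤ (‖A‖ₑ * ‖slice J ψ‖ₑ) ^ 2 := by gcongr; exact A.le_opENorm _
    _ = ‖A‖ₑ ^ 2 * ∑' I : Fin k → basisIndex H, ‖ψ (Fin.append I J)‖ₑ ^ 2 := by
        rw [mul_pow, enorm_sq_eq_tsum]; rfl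

/-- The coordinates of `(A ⊗ 1^{(m)}) ψ`. -/
noncomputable def ampliationFun {k : ℕ} (m : ℕ) (A : TensorPower H k →L[ℂ] TensorPower H k)
    (ψ : TensorPower H (k + m)) : TensorPower H (k + m) :=
  ⟨fun I => A (slice (fun j => I (Fin.natAdd k j)) ψ) (fun i => I (Fin.castAdd m i)),
    memℓp_two_of_tsum <| ne_top_of_le_ne_top
      (ENNReal.pow_ne_top (ENNReal.mul_ne_top (by simp) (by simp))) (tsum_ampl A ψ)⟩

lemma norm_ampliationFun_le {k m : ℕ} (A : TensorPower H k →L[ℂ] TensorPower H k)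
    (ψ : TensorPower H (k + m)) : ‖ampliationFun m A ψ‖ ≤ ‖A‖ * ‖ψ‖ := by
  have h := enorm_le_of_tsum_le (ampliationFun m A ψ) _ (tsum_ampl A ψ)
  have h2 := ENNReal.toReal_mono (ENNReal.mul_ne_top (by simp) (by simp)) h
  rwa [ENNReal.toReal_mul, toReal_enorm, toReal_enorm, toReal_enorm] at h2

/-- The operator `A ⊗ 1^{(m)}` on `H^{⊗(k+m)}`: it applies `A` in the first `k` tensor factors
(see `ampliation_tensor`). -/
noncomputable def ampliation {k : ℕ} (m : ℕ) (A : TensorPower H k →L[ℂ] TensorPower H k) :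
    TensorPower H (k + m) →L[ℂ] TensorPower H (k + m) :=
  LinearMap.mkContinuous
    { toFun := ampliationFun m A
      map_add' := fun ψ χ => by
        ext I
        have h : slice (fun j => I (Fin.natAdd k j)) (ψ + χ) =
          slice (fun j => I (Fin.natAdd k j)) ψ + slice (fun j => I (Fin.natAdd k j)) χ := rfl
        change A _ _ = A _ _ + A _ _
        rw [h, map_add]; rfl
      map_smul' := fun c ψ => by
        ext I
        have h : slice (fun j => I (Fin.natAdd k j)) (c • ψ) =
          c • slice (fun j => I (Fin.natAdd k j)) ψ := rfl
        change A _ _ = c • A _ _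
        rw [h, map_smul]; rfl } ‖A‖ (norm_ampliationFun_le A)

lemma ampliation_apply {k m : ℕ} (A : TensorPower H k →L[ℂ] TensorPower H k)
    (ψ : TensorPower H (k + m)) (I : Fin (k + m) → basisIndex H) :
    ampliation m A ψ I =
      A (slice (fun j => I (Fin.natAdd k j)) ψ) (fun i => I (Fin.castAdd m i)) := rfl

/-- `(A ⊗ 1) (f ⊗ g) = (A f) ⊗ g`, read off in coordinates. -/
lemma ampliation_tensor {k m : ℕ} (A : TensorPower H k →L[ℂ] TensorPower H k)
    (f : Fin k → H) (g : Fin m → H) (I : Fin k → basisIndex H) (J : Fin m → basisIndex H) :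
    ampliation m A (tensor (Fin.append f g)) (Fin.append I J) = A (tensor f) I * tensor g J := by
  rw [ampliation_apply A]
  simp only [Fin.append_left, Fin.append_right]
  have h : slice J (tensor (Fin.append f g)) = tensor g J • tensor f := by
    ext I
    change tensor (Fin.append f g) (Fin.append I J) = tensor g J * tensor f I
    simp only [tensor_apply]
    rw [Fin.prod_univ_add, mul_comm]
    simp
  rw [h, map_smul]
  exact mul_comm _ _

end TensorPower

section Hierarchy

variable {H : Type*} [NormedAddCommGroup H] [InnerProductSpace ℂ H] [CompleteSpace H]

/-- `r` is the `k`-particle reduced density matrix of the normal state `ϱ` on `∨^{k+m} H`: a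
non-negative trace-class operator on `∨ᵏ H` with `Tr[ϱ (A ⊗ 1^{(m)})] = Tr[r A]` for all bounded `A`. -/
def IsReducedDensity {k m : ℕ} (ϱ : TraceClass (symPower H (k + m)))
    (r : TraceClass (symPower H k)) : Prop :=
  r.op.IsPositive ∧ ∀ A : symPower H k →L[ℂ] symPower H k,
    trace (extendOp ϱ.op ∘L ampliation m (extendOp A)) = trace (r.op ∘L A)

variable (H) in
/-- The set of symmetric hierarchies: sequences `(γ k)` of trace-class operators on `∨ᵏ H` such that,
for some sequence `ϱ n` of normal states on `∨ⁿ H` with reduced density matrices `r n k` (`k ≤ n`) and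
some subsequence `s`, `r (s i) k` converges weak-∗ to `γ k` for every `k`. -/
def symHierarchies : Set (∀ k : ℕ, TraceClass (symPower H k)) :=
  {γ | ∃ (ϱ : ∀ n : ℕ, TraceClass (symPower H n)) (r : ℕ → ∀ k : ℕ, TraceClass (symPower H k))
      (s : ℕ → ℕ),
    (∀ n, IsNormalState (ϱ n)) ∧
    (∀ k m : ℕ, IsReducedDensity (ϱ (k + m)) (r (k + m) k)) ∧
    StrictMono s ∧
    ∀ (k : ℕ) (A : symPower H k →L[ℂ] symPower H k), IsCompactOperator A →
      Tendsto (fun i => trace ((r (s i) k).op ∘L A)) atTop (𝓝 (trace ((γ k).op ∘L A)))}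

variable (H) in
/-- The product over `k` of the weak-∗ topologies of `𝓛¹(∨ᵏ H)`, on the symmetric hierarchies. -/
@[reducible] noncomputable def hierarchyWeakStar : TopologicalSpace (symHierarchies H) :=
  TopologicalSpace.induced Subtype.val
    (@Pi.topologicalSpace ℕ (fun k => TraceClass (symPower H k))
      fun k => weakStarTopology (symPower H k))

variable (H) in
/-- The product over `k` of the trace-norm topologies of `𝓛¹(∨ᵏ H)`, on the symmetric hierarchies. -/
@[reducible] noncomputable def hierarchyNorm : TopologicalSpace (symHierarchies H) :=
  TopologicalSpace.induced Subtype.val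
    (Pi.topologicalSpace : TopologicalSpace (∀ k : ℕ, TraceClass (symPower H k)))

end Hierarchy

section Measures

variable (H : Type*) [NormedAddCommGroup H] [InnerProductSpace ℂ H]

/-- The closed unit ball of `H`. As a type it carries the norm topology and its Borel sets. -/
abbrev UnitBall : Type _ := Metric.closedBall (0 : H) 1

/-- The weak topology of `H`, restricted to the closed unit ball. -/
@[reducible] noncomputable def ballWeak : TopologicalSpace (UnitBall H) :=
  TopologicalSpace.induced (fun x => toWeakSpace ℂ H x.1) inferInstance

variable {H} in
/-- The rotation `x ↦ e^{iθ} x` of the closed unit ball. -/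
noncomputable def rotate (θ : ℝ) (x : UnitBall H) : UnitBall H :=
  ⟨Complex.exp (θ * Complex.I) • x.1, by
    have h := x.2
    rw [mem_closedBall_zero_iff] at h ⊢
    rwa [norm_smul, Complex.norm_exp_ofReal_mul_I, one_mul]⟩

variable [MeasurableSpace H]

/-- The `U(1)`-invariant Borel probability measures on the closed unit ball. -/
def InvMeasure : Type _ :=
  {μ : ProbabilityMeasure (UnitBall H) //
    ∀ θ : ℝ, Measure.map (rotate θ) (μ : Measure (UnitBall H)) = μ}

variable [BorelSpace H]

/-- The strong narrow topology: convergence of `∫ f dμ` for `f` bounded and norm continuous. -/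
@[reducible] noncomputable def strongNarrow : TopologicalSpace (InvMeasure H) :=
  TopologicalSpace.induced Subtype.val
    (inferInstance : TopologicalSpace (ProbabilityMeasure (UnitBall H)))

/-- The weak narrow topology: convergence of `∫ f dμ` for `f` bounded and weakly continuous. -/
@[reducible] noncomputable def weakNarrow : TopologicalSpace (InvMeasure H) :=
  ⨅ f : {f : UnitBall H → ℝ // Continuous[ballWeak H, inferInstance] f ∧ ∃ C, ∀ x, |f x| ≤ C},
    TopologicalSpace.induced (fun μ : InvMeasure H => ∫ x, f.1 x ∂(μ.1 : Measure (UnitBall H)))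
      inferInstance

variable {H} [CompleteSpace H]

/-- The map `Φ`, `μ ↦ (∫ |φ^{⊗k}⟩⟨φ^{⊗k}| dμ(φ))_k`, with Bochner integrals in `𝓛¹(∨ᵏ H)`. -/
noncomputable def momentMap (μ : InvMeasure H) (k : ℕ) : TraceClass (symPower H k) :=
  ∫ φ : UnitBall H, TraceClass.dyad (tensorPow k φ.1) ∂(μ.1 : Measure (UnitBall H))

end Measures

end SymHier

/-! Surjectivity is a Choquet argument. A sequence γ is encoded by its correlations `corr γ`, the
matrix elements of γ⁽ᵏ⁾ between symmetrised elementary tensors, viewed as a function of the multiset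
of pairs (aᵢ, bᵢ). For the point mass at φ this function is ∏⟨aᵢ, φ⟩⟨φ, bᵢ⟩. For an N-particle state
the diagonal part g satisfies ∑ᵢ g(eᵢ ::ₘ s) = g(s) over any orthonormal basis when |s| < N, since
the reduced matrices are partial traces of one state (`hasSum_diag_corr`). Completing a unit vector
b to a basis shows that g(s) - g(b ::ₘ s) is a sum of non-negative terms; iterating, all products of
differences 1 - τ_b with ‖b‖ ≤ 1 are non-negative on g, up to total order N (`iterDiff_nonneg`). The
sum rule may be lost in a weak-∗ limit, but these inequalities are not, so the correlations of a
hierarchy satisfy `IsMomentFunction`.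

The normalised moment functions form a compact convex set. If ℓ is extreme and ‖a‖ ≤ 1, then ℓ is
the sum of the moment functions ℓ((a, a) ::ₘ ·) and ℓ - ℓ((a, a) ::ₘ ·), so both are multiples of ℓ;
hence ℓ is multiplicative (`cons_of_mem_extremePoints`). Bosonic exchange symmetry makes its
one-body form of rank one, so ℓ is a point mass in the unit ball. By Krein–Milman and weak
compactness of the ball, every normalised moment function comes from a probability measure;
averaging over U(1) does not change its moments.

Injectivity is Stone–Weierstrass on the weakly compact ball: monomials with unequal numbers of φ and
its conjugate integrate to zero by invariance, and the others are correlations. That the moments of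
μ form a hierarchy uses infinite dimension: each φ in the ball is a weak limit of unit vectors T n φ
depending continuously on φ, and mixtures of the product states (T n φ)^{⊗n} have the required
reduced matrices and limits.

For the topologies, the invariant measures are compact for the weak narrow topology, and Φ is
continuous into the Hausdorff topology of pointwise convergence of correlations. So Φ⁻¹ is
continuous from that topology to the weak narrow one, and from any finer topology, in particular the
weak-∗ and trace-norm ones. In the strong case Φ is continuous because integrals of bounded
continuous Banach-valued functions depend continuously on the measure
(`continuous_integral_of_bounded`). Conversely, trace-norm convergence also controls Tr γ⁽¹⁾ = ∫‖φ‖²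
dμ, which rules out loss of norm and upgrades weak to strong narrow convergence
(`tendsto_of_tendsto_weakNarrow`). -/

namespace SymHier

/-! ### Traces of mixtures of rank-one operators -/

section Trace

variable {K : Type*} [NormedAddCommGroup K] [InnerProductSpace ℂ K]

/-- An orthonormal family in a separable space is countable. -/
lemma countable_of_orthonormal [TopologicalSpace.SeparableSpace K] {ι : Type*} {b : ι → K}
    (hb : Orthonormal ℂ b) : Countable ι := by
  have hd : Pairwise fun i j => 1 ≤ dist (b i) (b j) := fun i j hij => by
    have h : dist (b i) (b j) ^ 2 = 2 := by
      rw [dist_eq_norm, @norm_sub_sq ℂ, hb.1 i, hb.1 j, hb.2 hij]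
      norm_num
    nlinarith [dist_nonneg (x := b i) (y := b j)]
  have h2 : (Set.univ : Set ι).PairwiseDisjoint fun i => Metric.ball (b i) (1 / 2) := by
    intro i _ j _ hij
    refine Metric.ball_disjoint_ball ?_
    linarith [hd hij]
  have := h2.countable_of_isOpen (fun i _ => Metric.isOpen_ball)
    (fun i _ => ⟨b i, Metric.mem_ball_self (by norm_num)⟩)
  exact Set.countable_univ_iff.1 this

lemma separableSpace_lp {ι : Type*} [Countable ι] :
    TopologicalSpace.SeparableSpace (lp (fun _ : ι => ℂ) 2) := by
  classical
  rw [← TopologicalSpace.isSeparable_univ_iff]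
  have h : TopologicalSpace.IsSeparable
      (Set.range fun i : ι => (lp.single 2 i (1 : ℂ) : lp (fun _ : ι => ℂ) 2)) :=
    (Set.countable_range _).isSeparable
  refine h.span (R := ℂ) |>.closure.mono fun x _ => ?_
  have hx := lp.hasSum_single (p := 2) (by simp) x
  refine mem_closure_of_tendsto hx (Eventually.of_forall fun s => ?_)
  refine Submodule.sum_mem _ fun i _ => ?_
  have h1 : (lp.single 2 i (x i) : lp (fun _ : ι => ℂ) 2) = x i • lp.single 2 i (1 : ℂ) := by
    rw [← lp.single_smul]; simp
  rw [h1]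
  exact Submodule.smul_mem _ _ (Submodule.subset_span ⟨i, rfl⟩)

/-- The matrix element `T ↦ ⟪x, T y⟫` as a continuous functional on trace-class operators. -/
noncomputable def matrixElement (x y : K) : TraceClass K →L[ℂ] ℂ :=
  LinearMap.mkContinuous
    { toFun := fun T => ⟪x, T.op y⟫_ℂ
      map_add' := fun S T => by simp
      map_smul' := fun c T => by simp } (‖x‖ * ‖y‖) fun T => by
    calc ‖⟪x, T.op y⟫_ℂ‖ ≤ ‖x‖ * ‖T.op y‖ := norm_inner_le_norm _ _
      _ ≤ ‖x‖ * (‖T‖ * ‖y‖) := by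
        gcongr
        exact (T.op.le_opNorm y).trans (by gcongr; exact T.opNorm_le)
      _ = ‖x‖ * ‖y‖ * ‖T‖ := by ring

@[simp] lemma matrixElement_apply (x y : K) (T : TraceClass K) :
    matrixElement x y T = ⟪x, T.op y⟫_ℂ := rfl

lemma inner_dyad (x y z : K) : ⟪x, (TraceClass.dyad z).op y⟫_ℂ = ⟪x, z⟫_ℂ * ⟪z, y⟫_ℂ := by
  rw [TraceClass.dyad_op_apply, inner_smul_right, mul_comm]

/-- Telescoping: |x⟩⟨x| - |y⟩⟨y| = |x⟩⟨x - y| + |x - y⟩⟨y|, and each term has rank one. This yields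
trace-norm continuity of `dyad`. -/
lemma norm_dyad_sub_le (x y : K) :
    ‖TraceClass.dyad x - TraceClass.dyad y‖ ≤ (‖x‖ + ‖y‖) * ‖x - y‖ := by
  have h : (TraceClass.dyad x - TraceClass.dyad y).op =
      InnerProductSpace.rankOne ℂ x (x - y) + InnerProductSpace.rankOne ℂ (x - y) y := by
    ext z
    simp
  rw [TraceClass.norm_def, h]
  have h2 : traceNorm (InnerProductSpace.rankOne ℂ x (x - y) +
      InnerProductSpace.rankOne ℂ (x - y) y) ≤ ‖x‖ₑ * ‖x - y‖ₑ + ‖x - y‖ₑ * ‖y‖ₑ :=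
    (traceNorm_add_le _ _).trans (add_le_add (traceNorm_rankOne_le _ _) (traceNorm_rankOne_le _ _))
  refine (ENNReal.toReal_mono (by finiteness) h2).trans (le_of_eq ?_)
  rw [ENNReal.toReal_add (by finiteness) (by finiteness)]
  simp only [ENNReal.toReal_mul, toReal_enorm]
  ring

lemma continuous_dyad : Continuous (TraceClass.dyad : K → TraceClass K) := by
  rw [continuous_iff_continuousAt]
  intro x
  rw [ContinuousAt, tendsto_iff_norm_sub_tendsto_zero]
  refine squeeze_zero (fun _ => norm_nonneg _) (fun y => norm_dyad_sub_le y x) ?_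
  have : Continuous fun y : K => (‖y‖ + ‖x‖) * ‖y - x‖ := by fun_prop
  simpa using this.tendsto x

lemma norm_dyad_le (x : K) : ‖TraceClass.dyad x‖ ≤ ‖x‖ ^ 2 := by
  have h := norm_dyad_sub_le x 0
  have h0 : TraceClass.dyad (0 : K) = 0 := by ext z; simp
  rw [h0] at h
  simpa [sq] using h

lemma comp_rankOne (T : K →L[ℂ] K) (x y : K) :
    T ∘L InnerProductSpace.rankOne ℂ x y = InnerProductSpace.rankOne ℂ (T x) y := by
  ext z; simp

lemma isCompactOperator_rankOne (x y : K) :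
    IsCompactOperator (InnerProductSpace.rankOne ℂ x y) := by
  have h : (InnerProductSpace.rankOne ℂ x y : K → K) =
      (ContinuousLinearMap.toSpanSingleton ℂ x) ∘ (innerSL ℂ y) := by
    ext z; simp
  rw [h]
  exact IsCompactOperator.clm_comp (isCompactOperator_of_locallyCompactSpace_dom
    (innerSL ℂ y)) (ContinuousLinearMap.toSpanSingleton ℂ x)

lemma integrable_dyad {X : Type*} [MeasurableSpace X] {μ : Measure X} {F : X → K}
    (hF : AEStronglyMeasurable F μ)
    (hF2 : Integrable (fun a => ‖F a‖ ^ 2) μ) :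
    Integrable (fun a => TraceClass.dyad (F a)) μ :=
  hF2.mono' (continuous_dyad.comp_aestronglyMeasurable hF)
    (Eventually.of_forall fun _ => norm_dyad_le _)

lemma hasSum_norm_inner_sq {ι : Type*} (b : HilbertBasis ι ℂ K) (x : K) :
    HasSum (fun i => ‖⟪b i, x⟫_ℂ‖ ^ 2) (‖x‖ ^ 2) := by
  have h := b.hasSum_inner_mul_inner x x
  have h2 := Complex.hasSum_re h
  convert h2 using 1
  · ext i
    rw [← inner_conj_symm x (b i), ← Complex.normSq_eq_conj_mul_self, Complex.ofReal_re,
      Complex.normSq_eq_norm_sq]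
  · rw [inner_self_eq_norm_sq_to_K]; norm_cast

variable [CompleteSpace K]

instance countable_basisIndex [TopologicalSpace.SeparableSpace K] : Countable (basisIndex K) :=
  countable_of_orthonormal (basis K).orthonormal

lemma trace_rankOne (x y : K) : trace (InnerProductSpace.rankOne ℂ x y) = ⟪y, x⟫_ℂ := by
  rw [trace, ← (basis K).tsum_inner_mul_inner y x]
  refine tsum_congr fun i => ?_
  rw [InnerProductSpace.rankOne_apply, inner_smul_right]

lemma trace_comp_rankOne (T : K →L[ℂ] K) (x y : K) :
    trace (T ∘L InnerProductSpace.rankOne ℂ x y) = ⟪y, T x⟫_ℂ := by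
  rw [comp_rankOne, trace_rankOne]

lemma norm_trace_le (T : TraceClass K) : ‖trace T.op‖ ≤ ‖T‖ := by
  have hT := T.traceNorm_op_lt_top
  have hs := summable_trace hT (basis K).orthonormal
  refine (norm_tsum_le_tsum_norm hs).trans ?_
  refine Real.tsum_le_of_sum_le (fun i => norm_nonneg _) fun s => ?_
  let v : Fin s.card → K := fun i => basis K (s.equivFin.symm i)
  have hv : Orthonormal ℂ v :=
    (basis K).orthonormal.comp (fun i => (s.equivFin.symm i : basisIndex K))
      (Subtype.val_injective.comp s.equivFin.symm.injective)
  have h := ENNReal.toReal_mono hT.ne (le_traceNorm T.op hv hv)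
  rw [ENNReal.toReal_sum (fun i _ => by simp)] at h
  simp only [toReal_enorm] at h
  refine le_trans (le_of_eq ?_) h
  rw [← Finset.sum_coe_sort s]
  exact (s.equivFin.symm.sum_comp fun i : s => ‖⟪basis K i, T.op (basis K i)⟫_ℂ‖).symm

lemma continuous_trace : Continuous fun T : TraceClass K => trace T.op := by
  have hsum : ∀ T : TraceClass K, Summable fun i => ⟪basis K i, T.op (basis K i)⟫_ℂ :=
    fun T => (summable_trace T.traceNorm_op_lt_top (basis K).orthonormal).of_norm
  let f : TraceClass K →L[ℂ] ℂ := LinearMap.mkContinuous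
    { toFun := fun T => trace T.op
      map_add' := fun S T => by
        simp only [trace, TraceClass.op_add, _root_.add_apply, inner_add_right]
        exact (hsum S).tsum_add (hsum T)
      map_smul' := fun c T => by
        simp only [trace, TraceClass.op_smul, _root_.smul_apply, inner_smul_right, RingHom.id_apply,
          smul_eq_mul]
        exact tsum_mul_left } 1 fun T => by simpa using norm_trace_le T
  exact f.continuous

/-- If `T = ∫ |F⟩⟨F| dμ` in the weak sense, then `Tr (T B) = ∫ ⟨F, B F⟩ dμ` for all bounded `B`. -/
lemma trace_comp_eq_integral [TopologicalSpace.SeparableSpace K] {X : Type*} [MeasurableSpace X]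
    {μ : Measure X} {F : X → K} (hF : AEStronglyMeasurable F μ)
    (hF2 : Integrable (fun a => ‖F a‖ ^ 2) μ) {T : K →L[ℂ] K}
    (hT : ∀ x y, ⟪x, T y⟫_ℂ = ∫ a, ⟪x, F a⟫_ℂ * ⟪F a, y⟫_ℂ ∂μ) (B : K →L[ℂ] K) :
    trace (T ∘L B) = ∫ a, ⟪F a, B (F a)⟫_ℂ ∂μ := by
  let B' := ContinuousLinearMap.adjoint B
  have hb := fun a => hasSum_norm_inner_sq (basis K) (F a)
  have hb' := fun a => hasSum_norm_inner_sq (basis K) (B' (F a))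
  have hB'F : Integrable (fun a => ‖B' (F a)‖ ^ 2) μ := by
    refine (hF2.const_mul (‖B'‖ ^ 2)).mono' ((B'.continuous.comp_aestronglyMeasurable hF).norm.pow 2)
      (Eventually.of_forall fun a => ?_)
    rw [Real.norm_of_nonneg (by positivity), ← mul_pow]
    gcongr
    exact B'.le_opNorm _
  -- Dominating series for expanding ⟨F, B F⟩ in the basis: each term is bounded by the inequality
  -- of arithmetic and geometric means, and Parseval sums the bounds to an integrable function.
  have key : ∀ a, HasSum
      (fun i => (1 / 2 : ℝ) * (‖⟪basis K i, B' (F a)⟫_ℂ‖ ^ 2 + ‖⟪basis K i, F a⟫_ℂ‖ ^ 2))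
      ((1 / 2 : ℝ) * (‖B' (F a)‖ ^ 2 + ‖F a‖ ^ 2)) := fun a => ((hb' a).add (hb a)).mul_left _
  have h := hasSum_integral_of_dominated_convergence (μ := μ)
    (F := fun (i : basisIndex K) a => ⟪basis K i, F a⟫_ℂ * ⟪F a, B (basis K i)⟫_ℂ)
    (f := fun a => ⟪F a, B (F a)⟫_ℂ)
    (fun i a => (1 / 2 : ℝ) * (‖⟪basis K i, B' (F a)⟫_ℂ‖ ^ 2 + ‖⟪basis K i, F a⟫_ℂ‖ ^ 2))
    (fun i => (aestronglyMeasurable_const.inner hF).mul (hF.inner aestronglyMeasurable_const))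
    (fun i => Eventually.of_forall fun a => by
      rw [norm_mul, ← ContinuousLinearMap.adjoint_inner_left B, norm_inner_symm (_ : K) (basis K i)]
      nlinarith [sq_nonneg (‖⟪basis K i, B' (F a)⟫_ℂ‖ - ‖⟪basis K i, F a⟫_ℂ‖)])
    (Eventually.of_forall fun a => (key a).summable)
    (by
      simp only [fun a => (key a).tsum_eq]
      exact (hB'F.add hF2).const_mul _)
    (Eventually.of_forall fun a => by
      have h2 := (basis K).hasSum_inner_mul_inner (B' (F a)) (F a)
      simp only [B', ContinuousLinearMap.adjoint_inner_left] at h2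
      simpa only [mul_comm] using h2)
  rw [← h.tsum_eq, trace]
  refine tsum_congr fun i => ?_
  rw [ContinuousLinearMap.comp_apply, hT]

/-- The ensemble `∫ |F⟩⟨F| dμ`. -/
noncomputable def ensemble {X : Type*} [MeasurableSpace X] (μ : Measure X) (F : X → K) :
    TraceClass K := ∫ a, TraceClass.dyad (F a) ∂μ

section Ensemble

variable {X : Type*} [MeasurableSpace X] {μ : Measure X} {F : X → K}

lemma inner_ensemble (hF : AEStronglyMeasurable F μ) (hF2 : Integrable (fun a => ‖F a‖ ^ 2) μ)
    (x y : K) : ⟪x, (ensemble μ F).op y⟫_ℂ = ∫ a, ⟪x, F a⟫_ℂ * ⟪F a, y⟫_ℂ ∂μ := by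
  rw [← matrixElement_apply, ensemble,
    ← ContinuousLinearMap.integral_comp_comm _ (integrable_dyad hF hF2)]
  simp only [matrixElement_apply, inner_dyad]

lemma trace_ensemble_comp [TopologicalSpace.SeparableSpace K] (hF : AEStronglyMeasurable F μ)
    (hF2 : Integrable (fun a => ‖F a‖ ^ 2) μ) (B : K →L[ℂ] K) :
    trace ((ensemble μ F).op ∘L B) = ∫ a, ⟪F a, B (F a)⟫_ℂ ∂μ :=
  trace_comp_eq_integral hF hF2 (inner_ensemble hF hF2) B

lemma trace_ensemble [TopologicalSpace.SeparableSpace K] (hF : AEStronglyMeasurable F μ)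
    (hF2 : Integrable (fun a => ‖F a‖ ^ 2) μ) :
    trace (ensemble μ F).op = ((∫ a, ‖F a‖ ^ 2 ∂μ : ℝ) : ℂ) := by
  have h := trace_ensemble_comp hF hF2 (ContinuousLinearMap.id ℂ K)
  rw [ContinuousLinearMap.comp_id] at h
  rw [h, ← integral_complex_ofReal]
  refine integral_congr_ae (Eventually.of_forall fun a => ?_)
  simp only [ContinuousLinearMap.id_apply]
  rw [inner_self_eq_norm_sq_to_K]; norm_cast

lemma isPositive_ensemble (hF : AEStronglyMeasurable F μ)
    (hF2 : Integrable (fun a => ‖F a‖ ^ 2) μ) : (ensemble μ F).op.IsPositive := by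
  have h : ∀ x, ⟪x, (ensemble μ F).op x⟫_ℂ = ((∫ a, ‖⟪x, F a⟫_ℂ‖ ^ 2 ∂μ : ℝ) : ℂ) := fun x => by
    rw [inner_ensemble hF hF2, ← integral_complex_ofReal]
    refine integral_congr_ae (Eventually.of_forall fun a => ?_)
    simp only
    rw [← inner_conj_symm (F a) x, Complex.mul_conj, Complex.normSq_eq_norm_sq]
  rw [ContinuousLinearMap.isPositive_iff_complex]
  intro x
  rw [← inner_conj_symm, h x]
  simp only [Complex.conj_ofReal, RCLike.re_to_complex, Complex.ofReal_re, true_and]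
  exact integral_nonneg fun a => by positivity

end Ensemble

section Discrete

/-- The case of counting measure on the discrete index set in `trace_comp_eq_integral`. -/
lemma trace_comp_eq_tsum [TopologicalSpace.SeparableSpace K] {ι : Type*} [Countable ι] {v : ι → K}
    (hv : Summable fun j => ‖v j‖ ^ 2) {T : K →L[ℂ] K}
    (hT : ∀ x y, ⟪x, T y⟫_ℂ = ∑' j, ⟪x, v j⟫_ℂ * ⟪v j, y⟫_ℂ) (B : K →L[ℂ] K) :
    trace (T ∘L B) = ∑' j, ⟪v j, B (v j)⟫_ℂ := by
  let _ : MeasurableSpace ι := ⊤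
  have hbd : ∀ x y j, ‖⟪x, v j⟫_ℂ * ⟪v j, y⟫_ℂ‖ ≤ ‖x‖ * ‖y‖ * ‖v j‖ ^ 2 := fun x y j => by
    rw [norm_mul]
    calc _ ≤ (‖x‖ * ‖v j‖) * (‖v j‖ * ‖y‖) := by
          gcongr <;> exact norm_inner_le_norm _ _
      _ = _ := by ring
  have hB : ∀ j, ‖⟪v j, B (v j)⟫_ℂ‖ ≤ ‖B‖ * ‖v j‖ ^ 2 := fun j => by
    calc _ ≤ ‖v j‖ * ‖B (v j)‖ := norm_inner_le_norm _ _
      _ ≤ ‖v j‖ * (‖B‖ * ‖v j‖) := by gcongr; exact B.le_opNorm _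
      _ = _ := by ring
  have hint : ∀ f : ι → ℂ, Summable f → ∫ j, f j ∂(Measure.count : Measure ι) = ∑' j, f j := by
    intro f hf
    rw [integral_countable (integrable_count_iff.2 hf.norm)]
    simp [Measure.real]
  have hmeas : AEStronglyMeasurable v Measure.count := by
    borelize K
    have := UniformSpace.secondCountable_of_separable K
    exact measurable_from_top.aestronglyMeasurable
  have hT' : ∀ x y, ⟪x, T y⟫_ℂ = ∫ j, ⟪x, v j⟫_ℂ * ⟪v j, y⟫_ℂ ∂(Measure.count : Measure ι) := by
    intro x y
    rw [hT, hint]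
    exact Summable.of_norm_bounded (hv.mul_left _) (hbd x y)
  rw [trace_comp_eq_integral hmeas (integrable_count_iff.2 hv.norm) hT' B, hint]
  exact Summable.of_norm_bounded (hv.mul_left _) hB

/-- A positive trace-class operator is a countable sum of rank-one operators `|v j⟩⟨v j|`. -/
lemma exists_decomposition {ϱ : TraceClass K} (h : ϱ.op.IsPositive) :
    ∃ v : basisIndex K → K, (Summable fun j => ‖v j‖ ^ 2) ∧
      ∀ x y, ⟪x, ϱ.op y⟫_ℂ = ∑' j, ⟪x, v j⟫_ℂ * ⟪v j, y⟫_ℂ := by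
  have h0 : 0 ≤ ϱ.op := (ContinuousLinearMap.nonneg_iff_isPositive _).2 h
  -- The vectors are v j = √ϱ e j: Parseval expands ⟨√ϱ x, √ϱ y⟩, and ∑ ‖√ϱ e j‖² is the trace of ϱ.
  -- No diagonalisation is needed.
  let S := CFC.sqrt ϱ.op
  have hS : S * S = ϱ.op := CFC.sqrt_mul_sqrt_self _ h0
  have hSpos : S.IsPositive := (ContinuousLinearMap.nonneg_iff_isPositive _).1 (CFC.sqrt_nonneg _)
  have hsym : ∀ x y, ⟪S x, y⟫_ℂ = ⟪x, S y⟫_ℂ := fun x y => hSpos.isSymmetric x y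
  have hval : ∀ x y, ⟪x, ϱ.op y⟫_ℂ = ⟪S x, S y⟫_ℂ := fun x y => by
    rw [hsym, ← hS]; rfl
  refine ⟨fun j => S (basis K j), ?_, fun x y => ?_⟩
  · refine (summable_trace ϱ.traceNorm_op_lt_top (basis K).orthonormal).congr fun j => ?_
    rw [hval, inner_self_eq_norm_sq_to_K]
    simp
  · rw [hval, ← (basis K).tsum_inner_mul_inner]
    simp only [hsym]

end Discrete

end Trace

/-- List permutations are generated by adjacent swaps and by permuting tails, and both are given by
a permutation of the indices. This is how a function of tuples descends to multisets. -/
lemma perm_invariant {X Y : Type*} {F : List X → Y}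
    (hF : ∀ (n : ℕ) (x : Fin n → X) (σ : Equiv.Perm (Fin n)),
      F (List.ofFn (x ∘ σ)) = F (List.ofFn x)) {l l' : List X} (h : l.Perm l') : F l = F l' := by
  induction h generalizing F with
  | nil => rfl
  | @cons a l l' h ih =>
    refine ih (F := fun l => F (a :: l)) fun n x σ => ?_
    -- This permutation fixes 0 and acts as σ on successors.
    have h2 := hF (n + 1) (Fin.cons a x) (Equiv.Perm.decomposeFin.symm (0, σ))
    have h3 : (Fin.cons a x : Fin (n + 1) → X) ∘ (Equiv.Perm.decomposeFin.symm (0, σ)) =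
        Fin.cons a (x ∘ σ) := by
      funext i
      refine Fin.cases ?_ (fun i => ?_) i
      · simp
      · simp
    rw [h3, List.ofFn_cons, List.ofFn_cons] at h2
    exact h2
  | swap a b l =>
    obtain ⟨n, x, rfl⟩ : ∃ n, ∃ x : Fin n → X, l = List.ofFn x := ⟨l.length, l.get, by simp⟩
    have h2 := hF (n + 2) (Fin.cons a (Fin.cons b x)) (Equiv.swap 0 1)
    have h3 : (Fin.cons a (Fin.cons b x : Fin (n + 1) → X) : Fin (n + 2) → X) ∘ (Equiv.swap 0 1) =
        Fin.cons b (Fin.cons a x : Fin (n + 1) → X) := by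
      funext i
      refine Fin.cases ?_ (fun i => Fin.cases ?_ (fun i => ?_) i) i
      · rw [Function.comp_apply, Equiv.swap_apply_left]; rfl
      · rw [Function.comp_apply, Fin.succ_zero_eq_one, Equiv.swap_apply_right]; rfl
      · have : (Equiv.swap (0 : Fin (n + 2)) 1) i.succ.succ = i.succ.succ :=
          Equiv.swap_apply_of_ne_of_ne (Fin.succ_ne_zero _)
            (fun h => Fin.succ_ne_zero i (Fin.succ_injective _ (by simpa using h)))
        simp [this]
    rw [h3] at h2
    simpa [List.ofFn_cons] using h2
  | trans _ _ ih1 ih2 => exact (ih1 hF).trans (ih2 hF)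

/-! ### Symmetrised elementary tensors -/

section Tensors

variable {H : Type*} [NormedAddCommGroup H] [InnerProductSpace ℂ H] [CompleteSpace H]

instance [TopologicalSpace.SeparableSpace H] (n : ℕ) :
    TopologicalSpace.SeparableSpace (TensorPower H n) := separableSpace_lp

instance [TopologicalSpace.SeparableSpace H] (n : ℕ) :
    TopologicalSpace.SeparableSpace (symPower H n) := by
  have : SecondCountableTopology (TensorPower H n) := UniformSpace.secondCountable_of_separable _
  exact inferInstanceAs (TopologicalSpace.SeparableSpace (symPower H n : Set (TensorPower H n)))

lemma tensor_cons {n : ℕ} (a b : H) (c : ℂ) (x : Fin n → H) :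
    tensor (Fin.cons (a + c • b) x : Fin (n + 1) → H) =
      tensor (Fin.cons a x : Fin (n + 1) → H) + c • tensor (Fin.cons b x : Fin (n + 1) → H) := by
  ext I
  change tensor _ I = tensor _ I + c * tensor _ I
  simp only [tensor_apply, Fin.prod_univ_succ, Fin.cons_zero, Fin.cons_succ, inner_add_right,
    inner_smul_right]
  ring

lemma tensor_snoc {n : ℕ} (a b : H) (c : ℂ) (x : Fin n → H) :
    tensor (Fin.snoc x (a + c • b) : Fin (n + 1) → H) =
      tensor (Fin.snoc x a : Fin (n + 1) → H) + c • tensor (Fin.snoc x b : Fin (n + 1) → H) := by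
  ext I
  change tensor _ I = tensor _ I + c * tensor _ I
  simp only [tensor_apply, Fin.prod_univ_castSucc, Fin.snoc_last, Fin.snoc_castSucc,
    inner_add_right, inner_smul_right]
  ring

lemma norm_tensor {n : ℕ} (x : Fin n → H) : ‖tensor x‖ = ∏ j, ‖x j‖ := by
  have h := inner_tensor x x
  simp only [inner_self_eq_norm_sq_to_K] at h
  rw [Finset.prod_pow] at h
  have h2 : ‖tensor x‖ ^ 2 = (∏ j, ‖x j‖) ^ 2 := by
    have := congrArg Complex.re h
    norm_cast at this
  exact (pow_left_inj₀ (norm_nonneg _) (Finset.prod_nonneg fun _ _ => norm_nonneg _)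
    two_ne_zero).1 h2

/-- The symmetrised elementary tensor. -/
noncomputable def symTensor {n : ℕ} (x : Fin n → H) : symPower H n :=
  (symPower H n).orthogonalProjectionOnto (tensor x)

lemma inner_symTensor_left {n : ℕ} (x : Fin n → H) (ψ : symPower H n) :
    ⟪symTensor x, ψ⟫_ℂ = ⟪tensor x, (ψ : TensorPower H n)⟫_ℂ :=
  Submodule.inner_orthogonalProjectionOnto_eq_of_mem_right ψ _

lemma inner_symTensor_right {n : ℕ} (x : Fin n → H) (ψ : symPower H n) :
    ⟪ψ, symTensor x⟫_ℂ = ⟪(ψ : TensorPower H n), tensor x⟫_ℂ :=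
  Submodule.inner_orthogonalProjectionOnto_eq_of_mem_left ψ _

/-- Tested against a symmetric ψ, the unitary permuting the factors can be moved onto ψ, which it
fixes. -/
lemma symTensor_comp_perm {n : ℕ} (x : Fin n → H) (π : Equiv.Perm (Fin n)) :
    symTensor (x ∘ π) = symTensor x := by
  refine ext_inner_right ℂ fun ψ => ?_
  rw [inner_symTensor_left, inner_symTensor_left, show tensor (x ∘ π) = permOp π (tensor x) from
    (permOp_tensor π x).symm, ← mem_symPower_iff.1 ψ.2 π, LinearIsometry.inner_map_map,
    mem_symPower_iff.1 ψ.2 π]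

lemma symTensor_cons {n : ℕ} (a b : H) (c : ℂ) (x : Fin n → H) :
    symTensor (Fin.cons (a + c • b) x : Fin (n + 1) → H) =
      symTensor (Fin.cons a x : Fin (n + 1) → H) +
        c • symTensor (Fin.cons b x : Fin (n + 1) → H) := by
  rw [symTensor, tensor_cons, map_add, map_smul]; rfl

lemma eq_zero_of_inner_symTensor {n : ℕ} {ψ : symPower H n}
    (h : ∀ x : Fin n → H, ⟪symTensor x, ψ⟫_ℂ = 0) : ψ = 0 := by
  have h1 : (ψ : TensorPower H n) ∈
      (Submodule.span ℂ (Set.range (tensor : (Fin n → H) → TensorPower H n)))ᗮ := by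
    rw [Submodule.mem_orthogonal]
    intro u hu
    induction hu using Submodule.span_induction with
    | mem u hu => obtain ⟨x, rfl⟩ := hu; rw [← inner_symTensor_left, h]
    | zero => simp
    | add u v _ _ hu hv => rw [inner_add_left, hu, hv, add_zero]
    | smul c u _ hu => rw [inner_smul_left, hu, mul_zero]
  rw [(Submodule.topologicalClosure_eq_top_iff).1 (dense_span_tensor n)] at h1
  exact Subtype.ext ((Submodule.mem_bot ℂ).1 h1)

/-- Totality of symmetrised tensors is used twice: in the output variable, then, after passing to
adjoints, in the input variable. -/
lemma eq_of_inner_symTensor {n : ℕ} {S T : symPower H n →L[ℂ] symPower H n}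
    (h : ∀ x y : Fin n → H, ⟪symTensor x, S (symTensor y)⟫_ℂ = ⟪symTensor x, T (symTensor y)⟫_ℂ) :
    S = T := by
  have h1 : ∀ y : Fin n → H, S (symTensor y) = T (symTensor y) := fun y => by
    rw [← sub_eq_zero]
    refine eq_zero_of_inner_symTensor fun x => ?_
    rw [inner_sub_right, h, sub_self]
  have h2 : ∀ w, ContinuousLinearMap.adjoint S w = ContinuousLinearMap.adjoint T w := fun w => by
    rw [← sub_eq_zero]
    refine eq_zero_of_inner_symTensor fun x => ?_
    rw [inner_sub_right, ContinuousLinearMap.adjoint_inner_right,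
      ContinuousLinearMap.adjoint_inner_right, h1, sub_self]
  exact ContinuousLinearMap.adjoint.injective (ContinuousLinearMap.ext h2)

lemma inner_tensorPow {n : ℕ} (φ ψ : H) :
    ⟪tensorPow n φ, tensorPow n ψ⟫_ℂ = ⟪φ, ψ⟫_ℂ ^ n := by
  change ⟪tensor (fun _ : Fin n => φ), tensor fun _ : Fin n => ψ⟫_ℂ = _
  rw [inner_tensor]; simp

lemma norm_tensorPow (n : ℕ) (φ : H) : ‖tensorPow n φ‖ = ‖φ‖ ^ n := by
  change ‖tensor fun _ : Fin n => φ‖ = _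
  rw [norm_tensor]; simp

lemma inner_symTensor_tensorPow {n : ℕ} (x : Fin n → H) (φ : H) :
    ⟪symTensor x, tensorPow n φ⟫_ℂ = ∏ j, ⟪x j, φ⟫_ℂ := by
  rw [inner_symTensor_left]
  exact inner_tensor _ _

/-- The norm of a difference of powers is an explicit continuous function of ‖ψ‖, ⟨ψ, φ⟩ and ‖φ‖, so
no telescoping of tensor factors is required. -/
lemma continuous_tensorPow (n : ℕ) : Continuous (tensorPow n : H → symPower H n) := by
  rw [continuous_iff_continuousAt]
  intro φ
  rw [ContinuousAt, tendsto_iff_norm_sub_tendsto_zero]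
  have h : ∀ ψ : H, ‖tensorPow n ψ - tensorPow n φ‖ =
      Real.sqrt (‖ψ‖ ^ (2 * n) - 2 * (⟪ψ, φ⟫_ℂ ^ n).re + ‖φ‖ ^ (2 * n)) := fun ψ => by
    rw [← Real.sqrt_sq (norm_nonneg (tensorPow n ψ - tensorPow n φ)), @norm_sub_sq ℂ,
      inner_tensorPow, norm_tensorPow, norm_tensorPow, ← pow_mul', ← pow_mul']
    rfl
  simp only [h]
  have hc : Continuous fun ψ : H =>
      Real.sqrt (‖ψ‖ ^ (2 * n) - 2 * (⟪ψ, φ⟫_ℂ ^ n).re + ‖φ‖ ^ (2 * n)) := by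
    fun_prop
  have h0 := hc.tendsto φ
  rwa [← h, sub_self, norm_zero] at h0

end Tensors

/-! ### Correlation functions on multisets of pairs -/

section Correlations

variable {H : Type*} [NormedAddCommGroup H] [InnerProductSpace ℂ H] [CompleteSpace H]

/-- The matrix elements of a sequence of operators between symmetrised elementary tensors, as a
function of a list of pairs of vectors. -/
noncomputable def listCorr (γ : ∀ k, TraceClass (symPower H k)) (l : List (H × H)) : ℂ :=
  ⟪symTensor fun i : Fin l.length => (l.get i).1, (γ l.length).op
    (symTensor fun i : Fin l.length => (l.get i).2)⟫_ℂ

lemma listCorr_ofFn (γ : ∀ k, TraceClass (symPower H k)) {n : ℕ} (x : Fin n → H × H) :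
    listCorr γ (List.ofFn x) =
      ⟪symTensor fun i => (x i).1, (γ n).op (symTensor fun i => (x i).2)⟫_ℂ := by
  have key : ∀ (m : ℕ) (h : m = n), ⟪symTensor fun i : Fin m => (x (Fin.cast h i)).1, (γ m).op
      (symTensor fun i : Fin m => (x (Fin.cast h i)).2)⟫_ℂ =
      ⟪symTensor fun i => (x i).1, (γ n).op (symTensor fun i => (x i).2)⟫_ℂ := by
    rintro m rfl; rfl
  rw [← key _ (List.length_ofFn (f := x)), listCorr]
  simp only [List.get_ofFn]

/-- The correlation function of a sequence of operators, as a function of a multiset of pairs of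
vectors. -/
noncomputable def corr (γ : ∀ k, TraceClass (symPower H k)) (m : Multiset (H × H)) : ℂ :=
  Quotient.lift (listCorr γ) (fun _ _ h => perm_invariant (fun n x σ => by
    rw [listCorr_ofFn, listCorr_ofFn]
    exact congrArg₂ (fun u v => ⟪u, (γ n).op v⟫_ℂ)
      (symTensor_comp_perm (fun i => (x i).1) σ) (symTensor_comp_perm (fun i => (x i).2) σ)) h) m

lemma corr_ofFn (γ : ∀ k, TraceClass (symPower H k)) {n : ℕ} (x : Fin n → H × H) :
    corr γ (List.ofFn x : Multiset (H × H)) =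
      ⟪symTensor fun i => (x i).1, (γ n).op (symTensor fun i => (x i).2)⟫_ℂ :=
  listCorr_ofFn γ x

lemma exists_ofFn {X : Type*} (m : Multiset X) :
    ∃ (n : ℕ) (x : Fin n → X), m = (List.ofFn x : Multiset X) := by
  induction m using Quotient.inductionOn with
  | h l => exact ⟨l.length, l.get, by simp⟩

lemma coe_ofFn_cons {X : Type*} {n : ℕ} (a : X) (x : Fin n → X) :
    (List.ofFn (Fin.cons a x : Fin (n + 1) → X) : Multiset X) =
      a ::ₘ (List.ofFn x : Multiset X) := by
  rw [List.ofFn_cons]; rfl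

end Correlations

/-! ### Iterated differences and their positivity -/

section Differences

variable {H : Type*}

/-- The iterated differences `(∏_{b ∈ t} (1 - τ_b)) g`, where `(τ_b g) s = g (b ::ₘ s)`. -/
def iterDiff (g : Multiset H → ℝ) : List H → Multiset H → ℝ
  | [], s => g s
  | b :: t, s => iterDiff g t s - iterDiff g t (b ::ₘ s)

/-- Each difference may enlarge the multiset by one element, so the sum rule is needed on multisets
of size up to t.length + s.card; hence the bound by N. -/
lemma hasSum_iterDiff {g : Multiset H → ℝ} {N : ℕ} {ι : Type*} {e : ι → H}
    (hg : ∀ s : Multiset H, s.card < N → HasSum (fun i => g (e i ::ₘ s)) (g s))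
    (t : List H) (s : Multiset H) (h : t.length + s.card < N) :
    HasSum (fun i => iterDiff g t (e i ::ₘ s)) (iterDiff g t s) := by
  induction t generalizing s with
  | nil => exact hg s (by simpa using h)
  | cons a t ih =>
    simp only [iterDiff]
    refine (ih s (by simp at h; omega)).sub ?_
    have := ih (a ::ₘ s) (by simp at h ⊢; omega)
    simpa only [Multiset.cons_swap a] using this

variable [NormedAddCommGroup H] [InnerProductSpace ℂ H]

lemma iterDiff_smul {g : Multiset H → ℝ}
    (hg : ∀ (c : ℂ) (b : H) (s : Multiset H), g ((c • b) ::ₘ s) = ‖c‖ ^ 2 * g (b ::ₘ s))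
    (t : List H) (c : ℂ) (b : H) (s : Multiset H) :
    iterDiff g t ((c • b) ::ₘ s) = ‖c‖ ^ 2 * iterDiff g t (b ::ₘ s) := by
  induction t generalizing s with
  | nil => exact hg c b s
  | cons a t ih =>
    simp only [iterDiff]
    rw [ih, Multiset.cons_swap, ih, Multiset.cons_swap a b]
    ring

/-- If b is a unit vector in an orthonormal basis, the sum rule turns 1 - τ_b into the sum of the
shifts by the other basis vectors, and each of these terms is non-negative by induction. Homogeneity
handles ‖b‖ < 1. -/
lemma iterDiff_nonneg [CompleteSpace H] {g : Multiset H → ℝ} {N : ℕ}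
    (h0 : ∀ s : Multiset H, s.card ≤ N → 0 ≤ g s)
    (hsmul : ∀ (c : ℂ) (b : H) (s : Multiset H), g ((c • b) ::ₘ s) = ‖c‖ ^ 2 * g (b ::ₘ s))
    (hsum : ∀ (w : Set H) (e : HilbertBasis w ℂ H) (s : Multiset H), s.card < N →
      HasSum (fun i => g (e i ::ₘ s)) (g s))
    (t : List H) (s : Multiset H) (h : t.length + s.card ≤ N) (ht : ∀ b ∈ t, ‖b‖ ≤ 1) :
    0 ≤ iterDiff g t s := by
  induction t generalizing s with
  | nil => exact h0 s (by simpa using h)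
  | cons b t ih =>
    simp only [iterDiff, List.length_cons] at h ⊢
    have ht' : ∀ b ∈ t, ‖b‖ ≤ 1 := fun a ha => ht a (List.mem_cons_of_mem _ ha)
    have hs := ih s (by omega) ht'
    have hb : ‖b‖ ≤ 1 := ht b List.mem_cons_self
    rcases eq_or_ne b 0 with rfl | hb0
    · have := iterDiff_smul hsmul t 0 0 s
      simp at this
      simpa [this] using hs
    let c : ℂ := ((‖b‖ : ℝ) : ℂ)
    have hc : c ≠ 0 := by simpa [c] using hb0
    have hu : ‖c⁻¹ • b‖ = 1 := by simp [c, norm_smul, hb0]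
    have hon : Orthonormal ℂ ((↑) : ({c⁻¹ • b} : Set H) → H) :=
      ⟨fun i => by rw [i.2]; exact hu, fun i j hij => (hij (Subsingleton.elim _ _)).elim⟩
    -- The normalised vector b/‖b‖ is completed to a basis; its single term is then at most the
    -- whole sum.
    obtain ⟨w, e, hw, he⟩ := hon.exists_hilbertBasis_extension
    have h1 := hasSum_iterDiff (hsum w e) t s (by omega)
    have h2 := le_hasSum h1 ⟨c⁻¹ • b, hw rfl⟩ fun i _ => ih (e i ::ₘ s) (by simp; omega) ht'
    rw [he] at h2
    have h3 := iterDiff_smul hsmul t c (c⁻¹ • b) s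
    rw [smul_inv_smul₀ hc] at h3
    have h4 := ih ((c⁻¹ • b) ::ₘ s) (by simp; omega) ht'
    have h5 : ‖c‖ ^ 2 ≤ 1 := by
      have : ‖c‖ = ‖b‖ := by simp [c]
      rw [this]; exact pow_le_one₀ (norm_nonneg _) hb
    simp only at h2
    nlinarith

end Differences

lemma tsum_enorm_inner {H : Type*} [NormedAddCommGroup H] [InnerProductSpace ℂ H] {ι : Type*}
    (e : HilbertBasis ι ℂ H) (u : H) :
    ∑' i, ‖⟪e i, u⟫_ℂ‖ₑ ^ 2 = ‖u‖ₑ ^ 2 := by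
  have h := hasSum_norm_inner_sq e u
  rw [← ofReal_norm, ← ENNReal.ofReal_pow (norm_nonneg _), ← h.tsum_eq,
    ENNReal.ofReal_tsum_of_nonneg (fun i => by positivity) h.summable]
  refine tsum_congr fun i => ?_
  rw [← ofReal_norm, ENNReal.ofReal_pow (norm_nonneg _)]

/-! ### Partial traces in coordinates -/

section Slices

variable {H : Type*} [NormedAddCommGroup H] [InnerProductSpace ℂ H] [CompleteSpace H]

/-- A permutation of the first k indices, extended by the identity, is a permutation of all k + m
indices, under which ψ is invariant. -/
lemma slice_mem_symPower {k m : ℕ} (J : Fin m → basisIndex H) {ψ : TensorPower H (k + m)}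
    (hψ : ψ ∈ symPower H (k + m)) : slice J ψ ∈ symPower H k := by
  rw [mem_symPower_iff] at hψ ⊢
  intro π
  ext I
  let π' : Equiv.Perm (Fin (k + m)) := finSumFinEquiv.permCongr (Equiv.Perm.sumCongr π 1)
  have h := congrArg (fun χ : TensorPower H (k + m) => χ (Fin.append I J)) (hψ π')
  simp only [permOp_apply] at h
  rw [permOp_apply]
  change ψ (Fin.append (I ∘ π.symm) J) = ψ (Fin.append I J)
  rw [← h]
  have h2 : Fin.append (I ∘ π.symm) J = Fin.append I J ∘ π'.symm := by
    funext i
    refine Fin.addCases (fun i => ?_) (fun i => ?_) i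
    · have : π'.symm (Fin.castAdd m i) = Fin.castAdd m (π.symm i) := by
        rw [Equiv.symm_apply_eq]; simp [π', Equiv.permCongr_apply]
      simp [this]
    · have : π'.symm (Fin.natAdd k i) = Fin.natAdd k i := by
        rw [Equiv.symm_apply_eq]; simp [π', Equiv.permCongr_apply]
      simp [this]
  rw [h2]

lemma tsum_append_of_summable {k m : ℕ} {ι : Type*} {F : (Fin (k + m) → ι) → ℂ} (hF : Summable F) :
    ∑' I, F I = ∑' (J : Fin m → ι) (I : Fin k → ι), F (Fin.append I J) := by
  rw [← ((Equiv.prodComm _ _).trans (Fin.appendEquiv (α := ι) k m)).tsum_eq]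
  rw [Summable.tsum_prod]
  · rfl
  · exact (((Equiv.prodComm _ _).trans (Fin.appendEquiv (α := ι) k m)).summable_iff).2 hF

lemma inner_eq_tsum_slice {k m : ℕ} (ψ χ : TensorPower H (k + m)) :
    ⟪ψ, χ⟫_ℂ = ∑' J : Fin m → basisIndex H, ⟪slice J ψ, slice J χ⟫_ℂ := by
  rw [lp.inner_eq_tsum, tsum_append_of_summable (lp.summable_inner ψ χ)]
  refine tsum_congr fun J => ?_
  rw [lp.inner_eq_tsum]
  rfl

lemma slice_ampliation {k m : ℕ} (A : TensorPower H k →L[ℂ] TensorPower H k)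
    (ψ : TensorPower H (k + m)) (J : Fin m → basisIndex H) :
    slice J (ampliation m A ψ) = A (slice J ψ) := by
  ext I
  change ampliation m A ψ (Fin.append I J) = _
  rw [ampliation_apply]
  simp

lemma tsum_enorm_slice {k m : ℕ} (ψ : TensorPower H (k + m)) :
    ∑' J : Fin m → basisIndex H, ‖slice J ψ‖ₑ ^ 2 = ‖ψ‖ₑ ^ 2 := by
  rw [enorm_sq_eq_tsum ψ, tsum_append fun I => ‖ψ I‖ₑ ^ 2]
  refine tsum_congr fun J => ?_
  rw [enorm_sq_eq_tsum]; rfl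

lemma inner_tensor_snoc_basis {k : ℕ} (x : Fin k → H) (i : basisIndex H)
    (w : TensorPower H (k + 1)) (χ : TensorPower H k)
    (h : ∀ I : Fin k → basisIndex H, χ I = w (Fin.snoc I i : Fin (k + 1) → basisIndex H)) :
    ⟪tensor (Fin.snoc x (basis H i) : Fin (k + 1) → H), w⟫_ℂ = ⟪tensor x, χ⟫_ℂ := by
  classical
  have hb : ∀ i j, ⟪basis H i, basis H j⟫_ℂ = if i = j then 1 else 0 :=
    orthonormal_iff_ite.1 (basis H).orthonormal
  rw [lp.inner_eq_tsum, lp.inner_eq_tsum]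
  have hinj : Function.Injective
      fun I : Fin k → basisIndex H => (Fin.snoc I i : Fin (k + 1) → basisIndex H) := fun I I' hI => by
    simpa using congrArg Fin.init hI
  rw [← hinj.tsum_eq]
  · refine tsum_congr fun I => ?_
    rw [h, tensor_apply, tensor_apply, Fin.prod_univ_castSucc]
    simp
    rw [(basis H).orthonormal.1]; simp
  · intro I hI
    refine ⟨Fin.init I, ?_⟩
    by_contra hne
    refine hI ?_
    have hne' : I (Fin.last k) ≠ i := fun h' => hne (by rw [← h']; exact Fin.snoc_init_self I)
    simp only [tensor_apply, Fin.prod_univ_castSucc, Fin.snoc_last, hb, if_neg hne', mul_zero,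
      inner_zero_left]

/-- The contraction of w with x in the first k slots is the Riesz vector of a bounded functional of
the last slot; only absolute values are recorded. -/
lemma exists_inner_tensor_snoc {k : ℕ} (x : Fin k → H) (w : TensorPower H (k + 1)) :
    ∃ u : H, ∀ f, ‖⟪tensor (Fin.snoc x f : Fin (k + 1) → H), w⟫_ℂ‖ₑ = ‖⟪f, u⟫_ℂ‖ₑ := by
  let L : H →L[ℂ] ℂ := LinearMap.mkContinuous
    { toFun := fun f => ⟪w, tensor (Fin.snoc x f : Fin (k + 1) → H)⟫_ℂ
      map_add' := fun a b => by
        have := tensor_snoc a b 1 x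
        rw [one_smul, one_smul] at this
        rw [this, inner_add_right]
      map_smul' := fun c a => by
        have := tensor_snoc 0 a c x
        -- With coefficient -1 the two zero tensors cancel, so a tensor with last factor 0 vanishes.
        have h0 := tensor_snoc 0 0 (-1) x
        simp only [smul_zero, add_zero, neg_smul, one_smul, add_neg_cancel, zero_add] at this h0
        rw [this, h0, zero_add, inner_smul_right]; rfl } (‖w‖ * ∏ j, ‖x j‖) fun f => by
    refine (norm_inner_le_norm (𝕜 := ℂ) w (tensor (Fin.snoc x f : Fin (k + 1) → H))).trans
      (le_of_eq ?_)
    rw [norm_tensor, Fin.prod_univ_castSucc]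
    simp [mul_assoc]
  refine ⟨(InnerProductSpace.toDual ℂ H).symm L, fun f => ?_⟩
  rw [← ofReal_norm, ← ofReal_norm, ← norm_inner_symm w,
    ← norm_inner_symm ((InnerProductSpace.toDual ℂ H).symm L),
    InnerProductSpace.toDual_symm_apply]
  rfl

/-- By Parseval both sides are the squared norm of the same contracted vector: the partial trace
does not depend on the basis. -/
lemma tsum_inner_tensor_snoc {k : ℕ} (x : Fin k → H) (w : TensorPower H (k + 1))
    {ι ι' : Type*} (e : HilbertBasis ι ℂ H) (e' : HilbertBasis ι' ℂ H) :
    ∑' i, ‖⟪tensor (Fin.snoc x (e i) : Fin (k + 1) → H), w⟫_ℂ‖ₑ ^ 2 =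
      ∑' i, ‖⟪tensor (Fin.snoc x (e' i) : Fin (k + 1) → H), w⟫_ℂ‖ₑ ^ 2 := by
  obtain ⟨u, hu⟩ := exists_inner_tensor_snoc x w
  simp only [hu]
  rw [tsum_enorm_inner, tsum_enorm_inner]

/-- Contracting `k` tensor factors of `ψ` with `x`, the squared norm of the result. -/
noncomputable def contractionSq {k m N : ℕ} (h : N = k + m) (x : Fin k → H)
    (ψ : TensorPower H N) : ℝ≥0∞ :=
  ∑' J : Fin m → basisIndex H, ‖⟪tensor x, slice J (h ▸ ψ : TensorPower H (k + m))⟫_ℂ‖ₑ ^ 2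

/-- Consistency of partial traces for one vector: by basis independence the fixed basis can replace
`e`, and contracting slot k with the i-th basis vector then amounts to fixing i as the first
spectator index. The two equations for N keep both splittings available without a definitional
equality. -/
lemma tsum_contractionSq {k m N : ℕ} (h : N = k + (m + 1)) (h' : N = k + 1 + m) (x : Fin k → H)
    (ψ : TensorPower H N) {ι : Type*} (e : HilbertBasis ι ℂ H) :
    ∑' i, contractionSq h' (Fin.snoc x (e i) : Fin (k + 1) → H) ψ = contractionSq h x ψ := by
  subst h
  simp only [contractionSq]
  rw [ENNReal.tsum_comm,
    ← (Fin.consEquiv fun _ : Fin (m + 1) => (basisIndex H : Type _)).tsum_eq fun J =>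
      ‖⟪tensor x, slice J ψ⟫_ℂ‖ₑ ^ 2, ENNReal.tsum_prod',
    ENNReal.tsum_comm (f := fun (i : basisIndex H) (J : Fin m → basisIndex H) => _)]
  refine tsum_congr fun J => ?_
  rw [tsum_inner_tensor_snoc x _ e (basis H)]
  refine tsum_congr fun i => ?_
  rw [inner_tensor_snoc_basis x i]
  intro I
  -- Transport along an equality of lengths is reindexing by `Fin.cast`, which absorbs the mismatch
  -- between k + (m + 1) and k + 1 + m.
  have key : ∀ {M : ℕ} (h : k + (m + 1) = M) (I : Fin M → basisIndex H),
      (h ▸ ψ : TensorPower H M) I = ψ (I ∘ Fin.cast h) := by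
    rintro M rfl I; rfl
  change ψ (Fin.append I (Fin.cons i J)) =
    (h' ▸ ψ : TensorPower H (k + 1 + m)) (Fin.append (Fin.snoc I i) J)
  rw [key, Fin.append_right_cons]

/-- Slicing along the spectator indices diagonalises |u⟩⟨u| ⊗ 1. The value is given as a real a ≥ 0
so that complex traces can be compared with sums in [0, ∞], where summations commute freely. -/
lemma inner_ampliation_rankOne {k m : ℕ} (u : TensorPower H k) (ψ : TensorPower H (k + m)) :
    ∃ a : ℝ, 0 ≤ a ∧ ⟪ψ, ampliation m (InnerProductSpace.rankOne ℂ u u) ψ⟫_ℂ = a ∧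
      ENNReal.ofReal a = ∑' J : Fin m → basisIndex H, ‖⟪u, slice J ψ⟫_ℂ‖ₑ ^ 2 := by
  have hfin : ∑' J : Fin m → basisIndex H, ‖⟪u, slice J ψ⟫_ℂ‖ₑ ^ 2 ≠ ∞ := by
    refine ne_top_of_le_ne_top (b := ‖u‖ₑ ^ 2 * ‖ψ‖ₑ ^ 2) (by finiteness) ?_
    rw [← tsum_enorm_slice, ← ENNReal.tsum_mul_left]
    refine ENNReal.tsum_le_tsum fun J => ?_
    rw [← mul_pow]
    gcongr
    rw [← ofReal_norm, ← ofReal_norm, ← ofReal_norm, ← ENNReal.ofReal_mul (norm_nonneg _)]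
    exact ENNReal.ofReal_le_ofReal (norm_inner_le_norm _ _)
  refine ⟨_, ENNReal.toReal_nonneg, ?_, ENNReal.ofReal_toReal hfin⟩
  rw [inner_eq_tsum_slice, ENNReal.tsum_toReal_eq fun J => by finiteness, Complex.ofReal_tsum]
  refine tsum_congr fun J => ?_
  rw [slice_ampliation, InnerProductSpace.rankOne_apply, inner_smul_right, ENNReal.toReal_pow,
    toReal_enorm, ← inner_conj_symm (slice J ψ) u, Complex.mul_conj, Complex.normSq_eq_norm_sq]

lemma extendOp_rankOne {k : ℕ} (u : symPower H k) :
    extendOp (InnerProductSpace.rankOne ℂ u u) =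
      InnerProductSpace.rankOne ℂ (u : TensorPower H k) (u : TensorPower H k) := by
  ext1 ψ
  change (((InnerProductSpace.rankOne ℂ u u) ((symPower H k).orthogonalProjectionOnto ψ) :
    symPower H k) : TensorPower H k) = _
  rw [InnerProductSpace.rankOne_apply, InnerProductSpace.rankOne_apply,
    Submodule.inner_orthogonalProjectionOnto_eq_of_mem_left]
  rfl

lemma inner_extendOp {k : ℕ} (A : symPower H k →L[ℂ] symPower H k) (x y : TensorPower H k) :
    ⟪x, extendOp A y⟫_ℂ = ⟪(symPower H k).orthogonalProjectionOnto x,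
      A ((symPower H k).orthogonalProjectionOnto y)⟫_ℂ := by
  change ⟪x, ((A ((symPower H k).orthogonalProjectionOnto y) : symPower H k) :
    TensorPower H k)⟫_ℂ = _
  rw [Submodule.inner_orthogonalProjectionOnto_eq_of_mem_right]

/-- Extension by zero keeps the same decomposition vectors, because the projection is invisible
against symmetric vectors. -/
lemma trace_extendOp_comp_eq_tsum [TopologicalSpace.SeparableSpace H] {N : ℕ} {ι : Type*}
    [Countable ι] {v : ι → symPower H N} (hv : Summable fun j => ‖v j‖ ^ 2)
    {T : symPower H N →L[ℂ] symPower H N}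
    (hT : ∀ x y, ⟪x, T y⟫_ℂ = ∑' j, ⟪x, v j⟫_ℂ * ⟪v j, y⟫_ℂ)
    (B : TensorPower H N →L[ℂ] TensorPower H N) :
    trace (extendOp T ∘L B) = ∑' j, ⟪(v j : TensorPower H N), B (v j)⟫_ℂ := by
  refine trace_comp_eq_tsum (v := fun j => (v j : TensorPower H N)) hv (fun x y => ?_) B
  rw [inner_extendOp, hT]
  refine tsum_congr fun j => ?_
  rw [Submodule.inner_orthogonalProjectionOnto_eq_of_mem_right,
    Submodule.inner_orthogonalProjectionOnto_eq_of_mem_left]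

/-- The diagonal matrix elements of a reduced density matrix, in terms of a decomposition of the
state. -/
lemma ofReal_inner_reducedDensity [TopologicalSpace.SeparableSpace H] {k m : ℕ}
    {ϱ : TraceClass (symPower H (k + m))} {r : TraceClass (symPower H k)}
    (h : IsReducedDensity ϱ r) {ι : Type*} [Countable ι] {v : ι → symPower H (k + m)}
    (hv : Summable fun j => ‖v j‖ ^ 2)
    (hϱ : ∀ x y, ⟪x, ϱ.op y⟫_ℂ = ∑' j, ⟪x, v j⟫_ℂ * ⟪v j, y⟫_ℂ) (x : Fin k → H) :
    ENNReal.ofReal (⟪symTensor x, r.op (symTensor x)⟫_ℂ).re =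
      ∑' j, contractionSq rfl x (v j : TensorPower H (k + m)) := by
  have h1 := h.2 (InnerProductSpace.rankOne ℂ (symTensor x) (symTensor x))
  rw [trace_comp_rankOne, trace_extendOp_comp_eq_tsum hv hϱ, extendOp_rankOne] at h1
  choose a ha0 ha1 ha2 using fun j => inner_ampliation_rankOne
    (symTensor x : TensorPower H k) (v j : TensorPower H (k + m))
  simp only [ha1] at h1
  have hsum : Summable a := by
    set B := ampliation m (InnerProductSpace.rankOne ℂ (symTensor x : TensorPower H k)
      (symTensor x : TensorPower H k)) with hB
    refine Summable.of_nonneg_of_le ha0 (fun j => ?_) (hv.mul_left ‖B‖)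
    have h2 : ‖⟪(v j : TensorPower H (k + m)), B (v j)⟫_ℂ‖ ≤ ‖B‖ * ‖v j‖ ^ 2 := by
      refine (norm_inner_le_norm _ _).trans ?_
      have := B.le_opNorm (v j)
      calc _ ≤ ‖(v j : TensorPower H (k + m))‖ * (‖B‖ * ‖(v j : TensorPower H (k + m))‖) := by gcongr
        _ = ‖B‖ * ‖v j‖ ^ 2 := by rw [Submodule.coe_norm]; ring
    rw [ha1, Complex.norm_real, Real.norm_of_nonneg (ha0 j)] at h2
    exact h2
  rw [← h1, ← Complex.ofReal_tsum, Complex.ofReal_re, ENNReal.ofReal_tsum_of_nonneg ha0 hsum]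
  refine tsum_congr fun j => ?_
  rw [ha2, contractionSq]
  refine tsum_congr fun J => ?_
  have := inner_symTensor_left x ⟨_, slice_mem_symPower J (v j).2⟩
  rw [← this]; rfl

end Slices

/-! ### Axioms of moment functions -/

section MomentFunctions

lemma tendsto_iterDiff {H ι : Type*} {l : Filter ι} {g : ι → Multiset H → ℝ} {g' : Multiset H → ℝ}
    (h : ∀ s, Tendsto (fun i => g i s) l (𝓝 (g' s))) (t : List H) (s : Multiset H) :
    Tendsto (fun i => iterDiff (g i) t s) l (𝓝 (iterDiff g' t s)) := by
  induction t generalizing s with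
  | nil => exact h s
  | cons b t ih => exact (ih s).sub (ih _)

variable {H : Type*} [NormedAddCommGroup H] [InnerProductSpace ℂ H]

/-- The restriction of a function of pairs to the diagonal. -/
def diag (ℓ : Multiset (H × H) → ℂ) (s : Multiset H) : ℝ := (ℓ (s.map fun a => (a, a))).re

/-- The properties of `m ↦ ∫ ∏_{(a, b) ∈ m} ⟪a, φ⟫ ⟪φ, b⟫ dμ(φ)`, for a finite measure `μ` on the
unit ball, that characterise such functions (see `exists_measure_of_isMomentFunction`). -/
structure IsMomentFunction (ℓ : Multiset (H × H) → ℂ) : Prop where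
  left : ∀ (a a' b : H) (c : ℂ) (m : Multiset (H × H)),
    ℓ ((a + c • a', b) ::ₘ m) = ℓ ((a, b) ::ₘ m) + starRingEnd ℂ c * ℓ ((a', b) ::ₘ m)
  right : ∀ (a b b' : H) (c : ℂ) (m : Multiset (H × H)),
    ℓ ((a, b + c • b') ::ₘ m) = ℓ ((a, b) ::ₘ m) + c * ℓ ((a, b') ::ₘ m)
  herm : ∀ m : Multiset (H × H), ℓ (m.map Prod.swap) = starRingEnd ℂ (ℓ m)
  exch : ∀ (a b c d : H) (m : Multiset (H × H)),
    ℓ ((a, b) ::ₘ (c, d) ::ₘ m) = ℓ ((a, d) ::ₘ (c, b) ::ₘ m)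
  pos : ∀ (t : List H) (s : Multiset H), (∀ b ∈ t, ‖b‖ ≤ 1) → 0 ≤ iterDiff (diag ℓ) t s

/-- Assumes only the two linearity rules, because it is also needed for correlations whose
positivity is still to be shown. -/
lemma diag_smul {ℓ : Multiset (H × H) → ℂ}
    (left : ∀ (a a' b : H) (c : ℂ) (m : Multiset (H × H)),
      ℓ ((a + c • a', b) ::ₘ m) = ℓ ((a, b) ::ₘ m) + starRingEnd ℂ c * ℓ ((a', b) ::ₘ m))
    (right : ∀ (a b b' : H) (c : ℂ) (m : Multiset (H × H)),
      ℓ ((a, b + c • b') ::ₘ m) = ℓ ((a, b) ::ₘ m) + c * ℓ ((a, b') ::ₘ m))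
    (c : ℂ) (b : H) (s : Multiset H) :
    diag ℓ ((c • b) ::ₘ s) = ‖c‖ ^ 2 * diag ℓ (b ::ₘ s) := by
  simp only [diag, Multiset.map_cons]
  set m := s.map fun a => (a, a)
  -- Linearity at zero vectors with c = 1 says that this value equals twice itself.
  have h0 : ∀ b, ℓ ((0, b) ::ₘ m) = 0 := fun b => by simpa using left 0 0 b 1 m
  have h0' : ∀ a, ℓ ((a, 0) ::ₘ m) = 0 := fun a => by simpa using right a 0 0 1 m
  have h1 := left 0 b (c • b) c m
  have h2 := right b 0 b c m
  rw [zero_add, h0, zero_add] at h1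
  rw [zero_add, h0', zero_add] at h2
  rw [h1, h2, ← mul_assoc, ← Complex.normSq_eq_conj_mul_self, Complex.re_ofReal_mul,
    Complex.normSq_eq_norm_sq]

end MomentFunctions

/-! ### The correlations of a hierarchy form a moment function -/

section Hierarchies

variable {H : Type*} [NormedAddCommGroup H] [InnerProductSpace ℂ H] [CompleteSpace H]

lemma corr_left (γ : ∀ k, TraceClass (symPower H k)) (a a' b : H) (c : ℂ) (m : Multiset (H × H)) :
    corr γ ((a + c • a', b) ::ₘ m) =
      corr γ ((a, b) ::ₘ m) + starRingEnd ℂ c * corr γ ((a', b) ::ₘ m) := by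
  obtain ⟨n, x, rfl⟩ := exists_ofFn m
  have h1 : ∀ p : H × H, (fun i => ((Fin.cons p x : Fin (n + 1) → H × H) i).1) =
      Fin.cons p.1 (fun i => (x i).1) := fun p => by
    funext i; exact Fin.cases rfl (fun _ => rfl) i
  have h2 : ∀ p : H × H, (fun i => ((Fin.cons p x : Fin (n + 1) → H × H) i).2) =
      Fin.cons p.2 (fun i => (x i).2) := fun p => by
    funext i; exact Fin.cases rfl (fun _ => rfl) i
  simp only [← coe_ofFn_cons, corr_ofFn, h1, h2]
  rw [symTensor_cons, inner_add_left]
  exact congrArg _ (inner_smul_left (𝕜 := ℂ) (E := symPower H (n + 1)) _ _ _)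

lemma corr_right (γ : ∀ k, TraceClass (symPower H k)) (a b b' : H) (c : ℂ)
    (m : Multiset (H × H)) :
    corr γ ((a, b + c • b') ::ₘ m) = corr γ ((a, b) ::ₘ m) + c * corr γ ((a, b') ::ₘ m) := by
  obtain ⟨n, x, rfl⟩ := exists_ofFn m
  have h1 : ∀ p : H × H, (fun i => ((Fin.cons p x : Fin (n + 1) → H × H) i).1) =
      Fin.cons p.1 (fun i => (x i).1) := fun p => by
    funext i; exact Fin.cases rfl (fun _ => rfl) i
  have h2 : ∀ p : H × H, (fun i => ((Fin.cons p x : Fin (n + 1) → H × H) i).2) =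
      Fin.cons p.2 (fun i => (x i).2) := fun p => by
    funext i; exact Fin.cases rfl (fun _ => rfl) i
  simp only [← coe_ofFn_cons, corr_ofFn, h1, h2]
  rw [symTensor_cons, map_add, map_smul, inner_add_right]
  exact congrArg _ (inner_smul_right (𝕜 := ℂ) (E := symPower H (n + 1)) _ _ _)

/-- The right-hand symmetrised tensor may be permuted independently of the left one. This trace of
bosonic symmetry is what later forces extreme points to have rank one. -/
lemma corr_exch (γ : ∀ k, TraceClass (symPower H k)) (a b c d : H) (m : Multiset (H × H)) :
    corr γ ((a, b) ::ₘ (c, d) ::ₘ m) = corr γ ((a, d) ::ₘ (c, b) ::ₘ m) := by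
  obtain ⟨n, x, rfl⟩ := exists_ofFn m
  simp only [← coe_ofFn_cons, corr_ofFn]
  congr 1
  · congr 1
    funext i
    exact Fin.cases rfl (fun i => Fin.cases rfl (fun _ => rfl) i) i
  · congr 1
    rw [← symTensor_comp_perm _ (Equiv.swap 0 1)]
    congr 1
    funext i
    refine Fin.cases ?_ (fun i => Fin.cases ?_ (fun i => ?_) i) i
    · rw [Function.comp_apply, Equiv.swap_apply_left]; rfl
    · rw [Function.comp_apply, Fin.succ_zero_eq_one, Equiv.swap_apply_right]; rfl
    · have : (Equiv.swap (0 : Fin (n + 2)) 1) i.succ.succ = i.succ.succ :=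
        Equiv.swap_apply_of_ne_of_ne (Fin.succ_ne_zero _)
          (fun h => Fin.succ_ne_zero i (Fin.succ_injective _ (by simpa using h)))
      simp [this]

lemma corr_swap {γ : ∀ k, TraceClass (symPower H k)} {m : Multiset (H × H)}
    (h : (γ m.card).op.IsPositive) : corr γ (m.map Prod.swap) = starRingEnd ℂ (corr γ m) := by
  obtain ⟨n, x, rfl⟩ := exists_ofFn m
  have hn : (List.ofFn x : Multiset (H × H)).card = n := by simp
  rw [hn] at h
  rw [Multiset.map_coe, List.map_ofFn, corr_ofFn, corr_ofFn]
  exact (h.isSymmetric _ _).symm.trans (inner_conj_symm _ _).symm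

lemma diag_corr_smul (γ : ∀ k, TraceClass (symPower H k)) (c : ℂ) (b : H) (s : Multiset H) :
    diag (corr γ) ((c • b) ::ₘ s) = ‖c‖ ^ 2 * diag (corr γ) (b ::ₘ s) :=
  diag_smul (corr_left γ) (corr_right γ) c b s

lemma diag_corr_ofFn (γ : ∀ k, TraceClass (symPower H k)) {n : ℕ} (x : Fin n → H) :
    diag (corr γ) (List.ofFn x) = (⟪symTensor x, (γ n).op (symTensor x)⟫_ℂ).re := by
  rw [diag, Multiset.map_coe, List.map_ofFn, corr_ofFn]; rfl

variable [TopologicalSpace.SeparableSpace H]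

lemma ofReal_diag_corr {N k m : ℕ} (h : N = k + m) {ϱ : TraceClass (symPower H N)}
    {r : ∀ k, TraceClass (symPower H k)}
    (hr : IsReducedDensity (h ▸ ϱ : TraceClass (symPower H (k + m))) (r k)) {ι : Type*}
    [Countable ι] {v : ι → symPower H N} (hv : Summable fun j => ‖v j‖ ^ 2)
    (hϱ : ∀ x y, ⟪x, ϱ.op y⟫_ℂ = ∑' j, ⟪x, v j⟫_ℂ * ⟪v j, y⟫_ℂ) (x : Fin k → H) :
    ENNReal.ofReal (diag (corr r) (List.ofFn x)) =
      ∑' j, contractionSq h x (v j : TensorPower H N) := by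
  subst h
  rw [diag_corr_ofFn]
  exact ofReal_inner_reducedDensity hr hv hϱ x

/-- The state is decomposed into rank-one pieces, and `tsum_contractionSq` applies to each of them;
the two summations are exchanged in [0, ∞] before returning to real numbers. -/
lemma hasSum_diag_corr {N : ℕ} {ϱ : TraceClass (symPower H N)} (hϱ : ϱ.op.IsPositive)
    {r : ∀ k, TraceClass (symPower H k)}
    (hr : ∀ (k m : ℕ) (h : N = k + m), IsReducedDensity (h ▸ ϱ : TraceClass (symPower H (k + m)))
      (r k)) {ι : Type*} (e : HilbertBasis ι ℂ H) (s : Multiset H) (hs : s.card < N) :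
    HasSum (fun i => diag (corr r) (e i ::ₘ s)) (diag (corr r) s) := by
  obtain ⟨k, x, rfl⟩ := exists_ofFn s
  have hk : k < N := by simpa using hs
  obtain ⟨m, rfl⟩ : ∃ m, N = k + (m + 1) := ⟨N - k - 1, by omega⟩
  obtain ⟨v, hv, hv'⟩ := exists_decomposition hϱ
  have h' : k + (m + 1) = k + 1 + m := by omega
  have hsnoc : ∀ a : H, a ::ₘ (List.ofFn x : Multiset H) =
      (List.ofFn (Fin.snoc x a : Fin (k + 1) → H) : Multiset H) := fun a => by
    rw [List.ofFn_succ_last, Multiset.cons_coe, Multiset.coe_eq_coe]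
    simpa using (List.perm_append_singleton a (List.ofFn x)).symm
  simp only [hsnoc]
  have h1 := ofReal_diag_corr rfl (hr k (m + 1) rfl) hv hv' x
  have h2 := fun a => ofReal_diag_corr h' (hr (k + 1) m h') hv hv' (Fin.snoc x a : Fin (k + 1) → H)
  have pos1 : 0 ≤ diag (corr r) (List.ofFn x) := by
    rw [diag_corr_ofFn]
    have := (hr k (m + 1) rfl).1.re_inner_nonneg_right (symTensor x)
    exact this
  have pos2 : ∀ a, 0 ≤ diag (corr r) (List.ofFn (Fin.snoc x a : Fin (k + 1) → H)) := fun a => by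
    rw [diag_corr_ofFn]
    exact (hr (k + 1) m h').1.re_inner_nonneg_right _
  have h3 : ∑' i, ENNReal.ofReal (diag (corr r)
      (List.ofFn (Fin.snoc x (e i) : Fin (k + 1) → H))) =
      ENNReal.ofReal (diag (corr r) (List.ofFn x)) := by
    simp only [h1, h2]
    rw [ENNReal.tsum_comm]
    exact tsum_congr fun j => tsum_contractionSq _ _ x _ e
  have h4 := ENNReal.hasSum_toReal (h3.trans_ne ENNReal.ofReal_ne_top)
  rw [← ENNReal.tsum_toReal_eq fun _ => ENNReal.ofReal_ne_top, h3, ENNReal.toReal_ofReal pos1] at h4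
  simpa only [ENNReal.toReal_ofReal, pos2] using h4

/-- For k = 0 the contraction of a vector is its squared norm, so the zero-body correlation is ∑ ‖v
j‖² = Tr ϱ. -/
lemma diag_corr_zero {N : ℕ} {ϱ : TraceClass (symPower H N)} (hϱ : IsNormalState ϱ)
    {r : ∀ k, TraceClass (symPower H k)}
    (hr : ∀ (k m : ℕ) (h : N = k + m), IsReducedDensity (h ▸ ϱ : TraceClass (symPower H (k + m)))
      (r k)) : diag (corr r) 0 = 1 := by
  obtain ⟨v, hv, hv'⟩ := exists_decomposition hϱ.1
  have h1 := ofReal_diag_corr (Nat.zero_add N).symm (hr 0 N (Nat.zero_add N).symm) hv hv'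
    (Fin.elim0 : Fin 0 → H)
  have h2 : ∀ ψ : TensorPower H N, contractionSq (Nat.zero_add N).symm (Fin.elim0 : Fin 0 → H) ψ =
      ‖ψ‖ₑ ^ 2 := by
    have key : ∀ (M : ℕ) (h : N = M) (ψ : TensorPower H N), ‖(h ▸ ψ : TensorPower H M)‖ₑ = ‖ψ‖ₑ := by
      rintro M rfl ψ; rfl
    intro ψ
    rw [contractionSq, ← key _ (Nat.zero_add N).symm, ← tsum_enorm_slice]
    refine tsum_congr fun J => ?_
    rw [lp.inner_eq_tsum, enorm_sq_eq_tsum]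
    simp [tensor_apply]
  have h3 := trace_comp_eq_tsum hv hv' (ContinuousLinearMap.id ℂ _)
  rw [ContinuousLinearMap.comp_id, hϱ.2] at h3
  have h4 : ∑' j, ‖v j‖ ^ 2 = 1 := by
    have : ((∑' j, ‖v j‖ ^ 2 : ℝ) : ℂ) = 1 := by
      rw [h3, Complex.ofReal_tsum]
      refine tsum_congr fun j => ?_
      simp only [ContinuousLinearMap.id_apply]
      exact (by norm_cast : ((‖v j‖ ^ 2 : ℝ) : ℂ) = (‖v j‖ : ℂ) ^ 2).trans
        (inner_self_eq_norm_sq_to_K (𝕜 := ℂ) (v j)).symm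
    exact_mod_cast this
  have h5 : ENNReal.ofReal (diag (corr r) (List.ofFn (Fin.elim0 : Fin 0 → H))) = 1 := by
    rw [h1, ← ENNReal.ofReal_one, ← h4, ENNReal.ofReal_tsum_of_nonneg (fun _ => by positivity) hv]
    refine tsum_congr fun j => ?_
    rw [h2, ENNReal.ofReal_pow (norm_nonneg _), ofReal_norm]; rfl
  have h6 := congrArg ENNReal.toReal h5
  rw [ENNReal.toReal_ofReal_eq_iff.2] at h6
  · simpa using h6
  · by_contra hneg
    rw [ENNReal.ofReal_of_nonpos (not_le.1 hneg).le] at h5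
    exact zero_ne_one h5

/-- The correlations of a symmetric hierarchy form a moment function. -/
lemma isMomentFunction_corr {γ : ∀ k, TraceClass (symPower H k)} (hγ : γ ∈ symHierarchies H) :
    IsMomentFunction (corr γ) ∧ corr γ 0 = 1 := by
  obtain ⟨ϱ, r, σ, hϱ, hr, hσ, hlim⟩ := hγ
  have hr' : ∀ (N k m : ℕ) (h : N = k + m),
      IsReducedDensity (h ▸ ϱ N : TraceClass (symPower H (k + m))) (r N k) := by
    rintro N k m rfl
    exact hr k m
  have hσN : ∀ n, ∀ᶠ i in atTop, n ≤ σ i := fun n =>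
    (hσ.tendsto_atTop).eventually_ge_atTop n
  have hpos : ∀ k N, k ≤ N → (r N k).op.IsPositive := fun k N h => (hr' N k (N - k) (by omega)).1
  have htend : ∀ m, Tendsto (fun i => corr (r (σ i)) m) atTop (𝓝 (corr γ m)) := by
    intro m
    obtain ⟨n, x, rfl⟩ := exists_ofFn m
    simp only [corr_ofFn]
    -- Matrix elements are traces against rank-one operators, which are compact, so weak-∗
    -- convergence gives pointwise convergence of all correlations.
    have := hlim n _ (isCompactOperator_rankOne (symTensor fun i => (x i).2)
      (symTensor fun i => (x i).1))
    simpa only [trace_comp_rankOne] using this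
  have hdiag : ∀ s, Tendsto (fun i => diag (corr (r (σ i))) s) atTop (𝓝 (diag (corr γ) s)) :=
    fun s => (Complex.continuous_re.tendsto _).comp (htend _)
  -- Positivity of γ is not part of the hypothesis; hermiticity is inherited from the approximants,
  -- positive as soon as there are at least m.card particles.
  have hherm : ∀ m : Multiset (H × H), corr γ (m.map Prod.swap) = starRingEnd ℂ (corr γ m) := by
    intro m
    refine tendsto_nhds_unique_of_eventuallyEq (htend _)
      ((Complex.continuous_conj.tendsto _).comp (htend m)) ?_
    filter_upwards [hσN m.card] with i hi
    exact corr_swap (hpos _ _ hi)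
  refine ⟨⟨corr_left γ, corr_right γ, hherm, corr_exch γ, fun t s ht => ?_⟩, ?_⟩
  -- The sum rule is used only at finite particle number, once σ i ≥ t.length + s.card; only the
  -- resulting inequality is passed to the limit.
  · refine ge_of_tendsto (tendsto_iterDiff hdiag t s) ?_
    filter_upwards [hσN (t.length + s.card)] with i hi
    refine iterDiff_nonneg (fun s hs => ?_) (diag_corr_smul _)
      (fun w e s hs => hasSum_diag_corr (hϱ (σ i)).1 (hr' (σ i)) e s hs) t s hi ht
    obtain ⟨n, x, rfl⟩ := exists_ofFn s
    rw [diag_corr_ofFn]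
    exact (hpos n _ (by simpa using hs)).re_inner_nonneg_right _
  · have h1 : diag (corr γ) 0 = 1 :=
      tendsto_nhds_unique (hdiag 0) (tendsto_const_nhds.congr fun i =>
        (diag_corr_zero (hϱ (σ i)) (hr' (σ i))).symm)
    have h2 := hherm 0
    rw [Multiset.map_zero, eq_comm, Complex.conj_eq_iff_re] at h2
    rw [← h2]
    have h3 : (corr γ 0).re = 1 := by simpa [diag] using h1
    rw [h3]; simp

end Hierarchies

/-! ### Linearity of iterated differences -/

section Differences

variable {H : Type*}

lemma iterDiff_add (g g' : Multiset H → ℝ) (t : List H) (s : Multiset H) :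
    iterDiff (g + g') t s = iterDiff g t s + iterDiff g' t s := by
  induction t generalizing s with
  | nil => rfl
  | cons b t ih => simp only [iterDiff, ih]; ring

lemma iterDiff_const_smul (c : ℝ) (g : Multiset H → ℝ) (t : List H) (s : Multiset H) :
    iterDiff (c • g) t s = c * iterDiff g t s := by
  induction t generalizing s with
  | nil => rfl
  | cons b t ih => simp only [iterDiff, ih]; ring

lemma iterDiff_shift (g : Multiset H → ℝ) (a : H) (t : List H) (s : Multiset H) :
    iterDiff (fun s => g (a ::ₘ s)) t s = iterDiff g t (a ::ₘ s) := by
  induction t generalizing s with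
  | nil => rfl
  | cons b t ih => simp only [iterDiff, ih, Multiset.cons_swap a b]

end Differences

/-! ### Operations on moment functions and uniform bounds -/

namespace IsMomentFunction

variable {H : Type*} [NormedAddCommGroup H] [InnerProductSpace ℂ H]
  {ℓ ℓ' : Multiset (H × H) → ℂ}

lemma add (h : IsMomentFunction ℓ) (h' : IsMomentFunction ℓ') : IsMomentFunction (ℓ + ℓ') where
  left a a' b c m := by simp only [Pi.add_apply, h.left, h'.left]; ring
  right a b b' c m := by simp only [Pi.add_apply, h.right, h'.right]; ring
  herm m := by simp only [Pi.add_apply, h.herm, h'.herm, map_add]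
  exch a b c d m := by simp only [Pi.add_apply, h.exch a b, h'.exch a b]
  pos t s ht := by
    have : diag (ℓ + ℓ') = diag ℓ + diag ℓ' := by funext s; simp [diag]
    rw [this, iterDiff_add]
    exact add_nonneg (h.pos t s ht) (h'.pos t s ht)

lemma smul {c : ℝ} (hc : 0 ≤ c) (h : IsMomentFunction ℓ) : IsMomentFunction (c • ℓ) where
  left a a' b d m := by simp only [Pi.smul_apply, h.left, Complex.real_smul]; ring
  right a b b' d m := by simp only [Pi.smul_apply, h.right, Complex.real_smul]; ring
  herm m := by simp [Pi.smul_apply, h.herm, Complex.real_smul]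
  exch a b d e m := by simp only [Pi.smul_apply, h.exch a b]
  pos t s ht := by
    have : diag (c • ℓ) = c • diag ℓ := by funext s; simp [diag]
    rw [this, iterDiff_const_smul]
    exact mul_nonneg hc (h.pos t s ht)

lemma shift (h : IsMomentFunction ℓ) (a : H) : IsMomentFunction fun m => ℓ ((a, a) ::ₘ m) where
  left b b' d c m := by simp only [Multiset.cons_swap (a, a), h.left]
  right b d d' c m := by simp only [Multiset.cons_swap (a, a), h.right]
  herm m := by rw [← h.herm, Multiset.map_cons]; rfl
  exch b c d e m := by
    simp only [Multiset.cons_swap (a, a)]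
    exact h.exch _ _ _ _ _
  pos t s ht := by
    have : diag (fun m => ℓ ((a, a) ::ₘ m)) = fun s => diag ℓ (a ::ₘ s) := by
      funext s; simp [diag]
    rw [this, iterDiff_shift]
    exact h.pos t _ ht

/-- Positivity here is the axiom `pos` of ℓ for the list a :: t. Together with `shift` it splits ℓ
into two moment functions. -/
lemma sub_shift (h : IsMomentFunction ℓ) {a : H} (ha : ‖a‖ ≤ 1) :
    IsMomentFunction fun m => ℓ m - ℓ ((a, a) ::ₘ m) where
  left b b' d c m := by simp only [(h.shift a).left, h.left]; ring
  right b d d' c m := by simp only [(h.shift a).right, h.right]; ring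
  herm m := by rw [map_sub, (h.shift a).herm, h.herm]
  exch b c d e m := by rw [(h.shift a).exch, h.exch]
  pos t s ht := by
    have : diag (fun m => ℓ m - ℓ ((a, a) ::ₘ m)) =
        diag ℓ + (-1 : ℝ) • fun s => diag ℓ (a ::ₘ s) := by
      funext s; simp [diag, sub_eq_add_neg]
    rw [this, iterDiff_add, iterDiff_const_smul, iterDiff_shift]
    have := h.pos (a :: t) s (by simpa [ha] using ht)
    simp only [iterDiff] at this
    linarith

lemma polarization (h : IsMomentFunction ℓ) (a b : H) (m : Multiset (H × H)) :
    ℓ ((a, b) ::ₘ m) = (1 / 4 : ℂ) * (ℓ ((a + (1 : ℂ) • b, a + (1 : ℂ) • b) ::ₘ m)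
      - ℓ ((a + (-1 : ℂ) • b, a + (-1 : ℂ) • b) ::ₘ m)
      - Complex.I * ℓ ((a + Complex.I • b, a + Complex.I • b) ::ₘ m)
      + Complex.I * ℓ ((a + (-Complex.I) • b, a + (-Complex.I) • b) ::ₘ m)) := by
  simp only [h.left, h.right, map_one, map_neg, Complex.conj_I]
  ring_nf
  simp only [Complex.I_sq]
  ring

lemma diag_eq (h : IsMomentFunction ℓ) (s : Multiset H) :
    ℓ (s.map fun a => (a, a)) = diag ℓ s := by
  have h1 := h.herm (s.map fun a => (a, a))
  rw [Multiset.map_map, eq_comm] at h1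
  exact (Complex.conj_eq_iff_re.1 h1).symm

lemma diag_nonneg (h : IsMomentFunction ℓ) (s : Multiset H) : 0 ≤ diag ℓ s :=
  h.pos [] s (by simp)

/-- A single difference at the unit vector a/‖a‖, then homogeneity of degree two. -/
lemma diag_cons_le (h : IsMomentFunction ℓ) (a : H) (s : Multiset H) :
    diag ℓ (a ::ₘ s) ≤ ‖a‖ ^ 2 * diag ℓ s := by
  rcases eq_or_ne a 0 with rfl | ha
  · have := diag_smul h.left h.right 0 0 s
    simp at this
    simp [this]
  let c : ℂ := ((‖a‖ : ℝ) : ℂ)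
  have hc : c ≠ 0 := by simpa [c] using ha
  have hc' : ‖c‖ = ‖a‖ := by simp [c]
  have h1 := diag_smul h.left h.right c (c⁻¹ • a) s
  rw [smul_inv_smul₀ hc, hc'] at h1
  have h2 := h.pos [c⁻¹ • a] s (by simp [c, norm_smul, ha])
  simp only [iterDiff] at h2
  rw [h1]
  gcongr
  linarith

/-- The bound depends on m alone, as Tychonoff's theorem requires. On the diagonal it is ∏‖a‖²;
polarisation reduces the general case to it. -/
lemma exists_bound (m : Multiset (H × H)) : ∃ C : ℝ, ∀ ℓ : Multiset (H × H) → ℂ,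
    IsMomentFunction ℓ → ℓ 0 = 1 → ‖ℓ m‖ ≤ C := by
  have h1 : ∀ s : Multiset H, ∃ C : ℝ, ∀ ℓ : Multiset (H × H) → ℂ,
      IsMomentFunction ℓ → ℓ 0 = 1 → ‖ℓ (s.map fun a => (a, a))‖ ≤ C := by
    intro s
    refine ⟨(s.map fun a => ‖a‖ ^ 2).prod, fun ℓ h h0 => ?_⟩
    rw [h.diag_eq, Complex.norm_real, Real.norm_of_nonneg (h.diag_nonneg s)]
    induction s using Multiset.induction_on with
    | empty => simp [diag, h0]
    | cons a s ih =>
      rw [Multiset.map_cons, Multiset.prod_cons]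
      exact (h.diag_cons_le a s).trans (by gcongr)
  -- Strengthened for the induction: each polarisation moves one pair of m into the diagonal part s.
  have h2 : ∀ s : Multiset H, ∃ C : ℝ, ∀ ℓ : Multiset (H × H) → ℂ,
      IsMomentFunction ℓ → ℓ 0 = 1 → ‖ℓ (m + s.map fun a => (a, a))‖ ≤ C := by
    induction m using Multiset.induction_on with
    | empty => simpa using h1
    | cons p m ih =>
      obtain ⟨a, b⟩ := p
      intro s
      choose C hC using fun c : ℂ => ih ((a + c • b) ::ₘ s)
      simp only [Multiset.map_cons, Multiset.add_cons] at hC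
      refine ⟨1 / 4 * (C 1 + C (-1) + C Complex.I + C (-Complex.I)), fun ℓ h h0 => ?_⟩
      rw [Multiset.cons_add, h.polarization, norm_mul]
      have hI := fun c : ℂ => hC c ℓ h h0
      have e1 : ‖(1 / 4 : ℂ)‖ = 1 / 4 := by norm_num
      rw [e1]
      gcongr
      refine (norm_add_le _ _).trans (add_le_add ((norm_sub_le _ _).trans (add_le_add
        ((norm_sub_le _ _).trans (add_le_add (hI _) (hI _))) ?_)) ?_)
      · rw [norm_mul, Complex.norm_I, one_mul]; exact hI _
      · rw [norm_mul, Complex.norm_I, one_mul]; exact hI _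
  simpa using h2 0

end IsMomentFunction

/-! ### Compactness and extreme points -/

section Extreme

variable (H : Type*) [NormedAddCommGroup H] [InnerProductSpace ℂ H]

/-- The normalised moment functions. -/
def momentFunctions : Set (Multiset (H × H) → ℂ) := {ℓ | IsMomentFunction ℓ ∧ ℓ 0 = 1}

lemma isClosed_momentFunctions : IsClosed (momentFunctions H) := by
  have h : momentFunctions H =
      (⋂ (a : H) (a' : H) (b : H) (c : ℂ) (m : Multiset (H × H)),
        {ℓ | ℓ ((a + c • a', b) ::ₘ m) = ℓ ((a, b) ::ₘ m) + starRingEnd ℂ c * ℓ ((a', b) ::ₘ m)}) ∩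
      (⋂ (a : H) (b : H) (b' : H) (c : ℂ) (m : Multiset (H × H)),
        {ℓ | ℓ ((a, b + c • b') ::ₘ m) = ℓ ((a, b) ::ₘ m) + c * ℓ ((a, b') ::ₘ m)}) ∩
      (⋂ (m : Multiset (H × H)), {ℓ | ℓ (m.map Prod.swap) = starRingEnd ℂ (ℓ m)}) ∩
      (⋂ (a : H) (b : H) (c : H) (d : H) (m : Multiset (H × H)),
        {ℓ | ℓ ((a, b) ::ₘ (c, d) ::ₘ m) = ℓ ((a, d) ::ₘ (c, b) ::ₘ m)}) ∩
      (⋂ (t : List H) (s : Multiset H) (_ : ∀ b ∈ t, ‖b‖ ≤ 1), {ℓ | 0 ≤ iterDiff (diag ℓ) t s}) ∩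
      {ℓ | ℓ 0 = 1} := by
    ext ℓ
    simp only [Set.mem_inter_iff, Set.mem_iInter]
    constructor
    · rintro ⟨h, h0⟩
      exact ⟨⟨⟨⟨⟨h.left, h.right⟩, h.herm⟩, h.exch⟩, h.pos⟩, h0⟩
    · rintro ⟨⟨⟨⟨⟨h1, h2⟩, h3⟩, h4⟩, h5⟩, h0⟩
      exact ⟨⟨h1, h2, h3, h4, h5⟩, h0⟩
  rw [h]
  refine (((((?_ : IsClosed _).inter ?_).inter ?_).inter ?_).inter ?_).inter ?_
  · refine isClosed_iInter fun a => isClosed_iInter fun a' => isClosed_iInter fun b =>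
      isClosed_iInter fun c => isClosed_iInter fun m => isClosed_eq ?_ ?_ <;> fun_prop
  · refine isClosed_iInter fun a => isClosed_iInter fun a' => isClosed_iInter fun b =>
      isClosed_iInter fun c => isClosed_iInter fun m => isClosed_eq ?_ ?_ <;> fun_prop
  · exact isClosed_iInter fun m => isClosed_eq (continuous_apply _)
      (Complex.continuous_conj.comp (continuous_apply _))
  · refine isClosed_iInter fun a => isClosed_iInter fun a' => isClosed_iInter fun b =>
      isClosed_iInter fun c => isClosed_iInter fun m => isClosed_eq ?_ ?_ <;> fun_prop
  · refine isClosed_iInter fun t => isClosed_iInter fun s => isClosed_iInter fun _ =>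
      isClosed_le continuous_const ?_
    rw [continuous_iff_continuousAt]
    intro ℓ
    refine tendsto_iterDiff (fun s => ?_) t s
    exact (Complex.continuous_re.comp (continuous_apply _)).tendsto ℓ
  · exact isClosed_eq (continuous_apply _) continuous_const

lemma isCompact_momentFunctions : IsCompact (momentFunctions H) := by
  choose C hC using fun m : Multiset (H × H) => IsMomentFunction.exists_bound m
  refine (isCompact_univ_pi fun m => isCompact_closedBall (0 : ℂ) (C m)).of_isClosed_subset
    (isClosed_momentFunctions H) fun ℓ hℓ m _ => ?_
  simpa using hC m ℓ hℓ.1 hℓ.2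

lemma convex_momentFunctions : Convex ℝ (momentFunctions H) := by
  intro ℓ h ℓ' h' a b ha hb hab
  refine ⟨(h.1.smul ha).add (h'.1.smul hb), ?_⟩
  simp only [Pi.add_apply, Pi.smul_apply, h.2, h'.2, Complex.real_smul, mul_one]
  exact_mod_cast hab

variable {H}

/-- An extreme ℓ must be proportional to its summand ℓ((a, a) ::ₘ ·) when ‖a‖ ≤ 1; scaling and
polarisation give the general pair. -/
lemma cons_of_mem_extremePoints {ℓ : Multiset (H × H) → ℂ}
    (h : ℓ ∈ (momentFunctions H).extremePoints ℝ) (a b : H) (m : Multiset (H × H)) :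
    ℓ ((a, b) ::ₘ m) = ℓ {(a, b)} * ℓ m := by
  obtain ⟨⟨hℓ, h0⟩, hext⟩ := h
  have h1 : ∀ a : H, ‖a‖ ≤ 1 → ∀ m, ℓ ((a, a) ::ₘ m) = ℓ {(a, a)} * ℓ m := by
    intro a ha m
    set c := diag ℓ {a} with hc
    have hca : ℓ {(a, a)} = c := by simpa using hℓ.diag_eq {a}
    have hc0 : 0 ≤ c := hℓ.diag_nonneg _
    have hc1 : c ≤ 1 := by
      have := hℓ.diag_cons_le a 0
      have h0' : diag ℓ 0 = 1 := by simp [diag, h0]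
      rw [h0', mul_one] at this
      exact this.trans (pow_le_one₀ (norm_nonneg _) ha)
    -- This function and the next are normalised moment functions with midpoint ℓ. Adding multiples
    -- of ℓ, rather than dividing the two summands by c and 1 - c, avoids the cases c = 0 and c = 1.
    have m1 : (1 - c) • ℓ + (fun m => ℓ ((a, a) ::ₘ m)) ∈ momentFunctions H := by
      refine ⟨(hℓ.smul (by linarith)).add (hℓ.shift a), ?_⟩
      simp [h0, hca]
    have m2 : c • ℓ + (fun m => ℓ m - ℓ ((a, a) ::ₘ m)) ∈ momentFunctions H := by
      refine ⟨(hℓ.smul hc0).add (hℓ.sub_shift ha), ?_⟩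
      simp [h0, hca]
    have h2 := hext m1 m2 ⟨1 / 2, 1 / 2, by norm_num, by norm_num, by norm_num, by
      funext m
      simp only [Pi.add_apply, Pi.smul_apply, Complex.real_smul]
      push_cast; ring⟩
    have h3 := congrFun h2 m
    simp only [Pi.add_apply, Pi.smul_apply, Complex.real_smul] at h3
    push_cast at h3
    rw [hca]
    linear_combination h3
  have h2 : ∀ (a : H) m, ℓ ((a, a) ::ₘ m) = ℓ {(a, a)} * ℓ m := by
    intro a m
    rcases eq_or_ne a 0 with rfl | ha
    · exact h1 0 (by simp) m
    let c : ℂ := ((‖a‖ : ℝ) : ℂ)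
    have hc : c ≠ 0 := by simpa [c] using ha
    have hsm : ∀ b m, ℓ ((c • b, c • b) ::ₘ m) = starRingEnd ℂ c * c * ℓ ((b, b) ::ₘ m) := by
      intro b m
      have e0 : ∀ b, ℓ ((0, b) ::ₘ m) = 0 := fun b => by simpa using hℓ.left 0 0 b 1 m
      have e0' : ∀ b, ℓ ((b, 0) ::ₘ m) = 0 := fun b => by simpa using hℓ.right b 0 0 1 m
      have e1 := hℓ.left 0 b (c • b) c m
      have e2 := hℓ.right b 0 b c m
      rw [zero_add, e0, zero_add] at e1
      rw [zero_add, e0', zero_add] at e2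
      rw [e1, e2, mul_assoc]
    have e := h1 (c⁻¹ • a) (by simp [c, norm_smul, ha])
    have e1 := hsm (c⁻¹ • a) m
    have e2 := hsm (c⁻¹ • a) 0
    rw [smul_inv_smul₀ hc] at e1 e2
    simp only [Multiset.cons_zero] at e2
    rw [e1, e2, e]; ring
  have p1 := hℓ.polarization a b m
  have p2 := hℓ.polarization a b 0
  simp only [h2 _ m, Multiset.cons_zero] at p1 p2
  rw [p1, p2]; ring

/-- The product `∏_{(a, b) ∈ m} ⟪a, φ⟫ ⟪φ, b⟫`. -/
noncomputable def pointMoment (φ : H) (m : Multiset (H × H)) : ℂ :=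
  (m.map fun p => ⟪p.1, φ⟫_ℂ * ⟪φ, p.2⟫_ℂ).prod

/-- Multiplicativity leaves only the form ℓ{(a, b)}. Exchange symmetry gives ℓ{(a, b)} ℓ{(c, d)} =
ℓ{(a, d)} ℓ{(c, b)}, that is, rank at most one; positivity bounds the representing vector by 1. -/
lemma exists_pointMoment_of_mem_extremePoints [CompleteSpace H] {ℓ : Multiset (H × H) → ℂ}
    (h : ℓ ∈ (momentFunctions H).extremePoints ℝ) : ∃ φ : H, ‖φ‖ ≤ 1 ∧ pointMoment φ = ℓ := by
  have hmul := fun a b => cons_of_mem_extremePoints h a b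
  have hℓ := h.1.1
  have h0 := h.1.2
  suffices hΓ : ∃ φ : H, ‖φ‖ ≤ 1 ∧ ∀ a b : H, ⟪a, φ⟫_ℂ * ⟪φ, b⟫_ℂ = ℓ {(a, b)} by
    obtain ⟨φ, hφ, hφ'⟩ := hΓ
    refine ⟨φ, hφ, funext fun m => ?_⟩
    induction m using Multiset.induction_on with
    | empty => simp [pointMoment, h0]
    | cons p m ih =>
      rw [hmul p.1 p.2, ← ih, ← hφ']
      simp [pointMoment]
  have hex : ∀ a b c d : H, ℓ {(a, b)} * ℓ {(c, d)} = ℓ {(a, d)} * ℓ {(c, b)} := fun a b c d => by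
    have := hℓ.exch a b c d 0
    rwa [hmul, hmul a d, Multiset.cons_zero, Multiset.cons_zero] at this
  have hherm : ∀ a b : H, ℓ {(b, a)} = starRingEnd ℂ (ℓ {(a, b)}) := fun a b => by
    simpa using hℓ.herm {(a, b)}
  have hdiag : ∀ a, ℓ {(a, a)} = diag ℓ {a} := fun a => by simpa using hℓ.diag_eq {a}
  have hle : ∀ a : H, diag ℓ {a} ≤ ‖a‖ ^ 2 := fun a => by
    have := hℓ.diag_cons_le a 0
    have h0' : diag ℓ 0 = 1 := by simp [diag, h0]
    rwa [h0', mul_one] at this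
  -- If the diagonal vanishes, exchange gives |ℓ{(a, b)}|² = 0 and φ = 0 works.
  by_cases hz : ∀ c : H, diag ℓ {c} = 0
  · refine ⟨0, by simp, fun a b => ?_⟩
    have h1 := hex a b b a
    rw [hherm a b, hdiag a, hdiag b, hz, hz, Complex.mul_conj] at h1
    have h2 : ℓ {(a, b)} = 0 := by
      rw [← Complex.normSq_eq_zero]; simpa using h1
    simp [h2]
  · push Not at hz
    obtain ⟨c, hc⟩ := hz
    have hcpos : 0 < diag ℓ {c} := lt_of_le_of_ne (hℓ.diag_nonneg _) hc.symm
    set g := Real.sqrt (diag ℓ {c}) with hg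
    have hgpos : 0 < g := Real.sqrt_pos.2 hcpos
    have hgg : (g : ℂ) * g = diag ℓ {c} := by exact_mod_cast Real.mul_self_sqrt hcpos.le
    have hg0 : (g : ℂ) ≠ 0 := by exact_mod_cast hgpos.ne'
    have hprod : ∀ a b, starRingEnd ℂ (ℓ {(c, a)} / g) * (ℓ {(c, b)} / g) = ℓ {(a, b)} := by
      intro a b
      have h1 := hex a b c c
      rw [hdiag c, hherm c a] at h1
      rw [map_div₀, Complex.conj_ofReal, div_mul_div_comm, hgg, ← h1,
        mul_div_cancel_right₀ _ (by exact_mod_cast hc)]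
    -- Any c with ℓ{(c, c)} ≠ 0 determines φ up to a phase through ⟨φ, b⟩ = ℓ{(c, b)} / √ℓ{(c, c)}.
    let L : H →L[ℂ] ℂ := LinearMap.mkContinuous
      { toFun := fun b => ℓ {(c, b)} / g
        map_add' := fun a b => by
          have := hℓ.right c a b 1 0
          simp only [one_smul, Multiset.cons_zero, one_mul] at this
          rw [this, add_div]
        map_smul' := fun d b => by
          have h1 := hℓ.right c 0 b d 0
          have h2 := hℓ.right c 0 0 1 0
          simp only [Multiset.cons_zero, zero_add, smul_zero, one_mul, left_eq_add] at h1 h2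
          rw [h1, h2, zero_add, RingHom.id_apply, smul_eq_mul, mul_div_assoc] } 1 fun b => by
      have h1 := hprod b b
      rw [← Complex.normSq_eq_conj_mul_self, hdiag, Complex.normSq_eq_norm_sq] at h1
      have h2 : ‖ℓ {(c, b)} / g‖ ^ 2 = diag ℓ {b} := by exact_mod_cast h1
      have h3 := hle b
      rw [← h2] at h3
      exact ((pow_le_pow_iff_left₀ (norm_nonneg _) (norm_nonneg _) two_ne_zero).1 h3).trans_eq
        (one_mul _).symm
    refine ⟨(InnerProductSpace.toDual ℂ H).symm L, ?_, fun a b => ?_⟩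
    · rw [LinearIsometryEquiv.norm_map]
      exact LinearMap.mkContinuous_norm_le _ zero_le_one _
    · rw [← inner_conj_symm a, InnerProductSpace.toDual_symm_apply,
        InnerProductSpace.toDual_symm_apply]
      exact hprod a b

end Extreme

/-! ### The unit ball with its weak topology, and representing measures -/

section WeakBall

/-- The closed unit ball with the weak topology. -/
def WeakBall (H : Type*) [NormedAddCommGroup H] : Type _ := UnitBall H

/-- The identity map from the closed unit ball with its norm to the one with the weak topology. -/
def toWeakBall {H : Type*} [NormedAddCommGroup H] (x : UnitBall H) : WeakBall H := x

lemma weakBall_norm_le {H : Type*} [NormedAddCommGroup H] (x : WeakBall H) : ‖x.1‖ ≤ 1 :=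
  mem_closedBall_zero_iff.1 x.2

variable (H : Type*) [NormedAddCommGroup H] [InnerProductSpace ℂ H]

noncomputable instance : TopologicalSpace (WeakBall H) := ballWeak H

instance [MeasurableSpace H] : MeasurableSpace (WeakBall H) :=
  inferInstanceAs (MeasurableSpace (UnitBall H))

variable {H}

lemma continuous_inner_weakBall (y : H) : Continuous fun x : WeakBall H => ⟪y, x.1⟫_ℂ := by
  have h : Continuous fun x : WeakSpace ℂ H => (topDualPairing ℂ H).flip x (innerSL ℂ y) :=
    WeakBilin.eval_continuous _ _
  exact h.comp continuous_induced_dom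

lemma continuous_inner_weakBall' (y : H) : Continuous fun x : WeakBall H => ⟪x.1, y⟫_ℂ := by
  have := Complex.continuous_conj.comp (continuous_inner_weakBall y)
  simpa only [Function.comp_def, inner_conj_symm] using this

lemma continuous_pointMoment (m : Multiset (H × H)) :
    Continuous fun φ : WeakBall H => pointMoment φ.1 m := by
  induction m using Multiset.induction_on with
  | empty => simpa [pointMoment] using continuous_const
  | cons p m ih =>
    simp only [pointMoment, Multiset.map_cons, Multiset.prod_cons] at ih ⊢
    exact ((continuous_inner_weakBall _).mul (continuous_inner_weakBall' _)).mul ih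

variable [CompleteSpace H]

lemma continuous_to_weakBall {X : Type*} [TopologicalSpace X] {f : X → WeakBall H}
    (h : ∀ y, Continuous fun x => ⟪y, (f x).1⟫_ℂ) : Continuous f := by
  refine continuous_induced_rng.2 (WeakBilin.continuous_of_continuous_eval _ fun l => ?_)
  have := h ((InnerProductSpace.toDual ℂ H).symm l)
  simp only [InnerProductSpace.toDual_symm_apply] at this
  exact this

lemma continuous_toWeakBall : Continuous (toWeakBall : UnitBall H → WeakBall H) :=
  continuous_to_weakBall fun _ => continuous_const.inner continuous_subtype_val

/-- Banach–Alaoglu transported by the Riesz map. That map is conjugate-linear, but ⟨y, f l⟩ is the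
conjugate of l y, hence still continuous. -/
instance : CompactSpace (WeakBall H) := by
  have hc := WeakDual.isCompact_closedBall (𝕜 := ℂ) (E := H) 0 1
  let S := (WeakDual.toStrongDual ⁻¹' Metric.closedBall (0 : StrongDual ℂ H) 1)
  have : CompactSpace S := isCompact_iff_compactSpace.1 hc
  let f : S → WeakBall H := fun l => ⟨(InnerProductSpace.toDual ℂ H).symm
    (WeakDual.toStrongDual l.1), by
      have := l.2
      simp only [S, Set.mem_preimage, mem_closedBall_zero_iff] at this
      rw [mem_closedBall_zero_iff, LinearIsometryEquiv.norm_map]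
      exact this⟩
  have hf : Continuous f := by
    refine continuous_to_weakBall fun y => ?_
    have h1 : ∀ l : S, ⟪y, (f l).1⟫_ℂ = starRingEnd ℂ (l.1 y) := fun l => by
      rw [← inner_conj_symm]
      simp only [f, InnerProductSpace.toDual_symm_apply]
      rfl
    simp only [h1]
    exact Complex.continuous_conj.comp ((WeakDual.eval_continuous y).comp continuous_subtype_val)
  have hs : Function.Surjective f := by
    intro x
    refine ⟨⟨WeakDual.toStrongDual.symm (InnerProductSpace.toDual ℂ H x.1), ?_⟩, ?_⟩
    · simpa [S] using weakBall_norm_le x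
    · exact Subtype.ext (by simp [f])
  exact hs.compactSpace hf

/-- The coordinates of a vector of the unit ball in the fixed orthonormal basis. -/
noncomputable def coords (x : WeakBall H) (i : basisIndex H) : ℂ := ⟪basis H i, x.1⟫_ℂ

lemma continuous_coords : Continuous (coords : WeakBall H → _) :=
  continuous_pi fun _ => continuous_inner_weakBall _

lemma coords_injective : Function.Injective (coords : WeakBall H → _) := fun x y h => by
  refine Subtype.ext ((basis H).repr.injective (lp.ext (funext fun i => ?_)))
  rw [HilbertBasis.repr_apply_apply, HilbertBasis.repr_apply_apply]
  exact congrFun h i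

instance : T2Space (WeakBall H) := T2Space.of_injective_continuous coords_injective continuous_coords

variable [TopologicalSpace.SeparableSpace H]

instance : TopologicalSpace.MetrizableSpace (WeakBall H) :=
  (continuous_coords.isClosedEmbedding coords_injective).isEmbedding.metrizableSpace

variable [MeasurableSpace H] [BorelSpace H]

/-- A vector is the limit of its finite coordinate sums, which are weakly continuous maps into the
normed space, so norm-Borel sets are weakly Borel. One measure thus serves both topologies. -/
instance : BorelSpace (WeakBall H) := by
  refine ⟨le_antisymm ?_ ?_⟩
  · have h : Measurable[borel (WeakBall H)] fun x : WeakBall H => x.1 := by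
      let _ : MeasurableSpace (WeakBall H) := borel (WeakBall H)
      have : BorelSpace (WeakBall H) := ⟨rfl⟩
      have hlim : ∀ x : WeakBall H, HasSum (fun i => ⟪basis H i, x.1⟫_ℂ • basis H i) x.1 :=
        fun x => by simpa only [HilbertBasis.repr_apply_apply] using (basis H).hasSum_repr x.1
      refine measurable_of_tendsto_metrizable' (u := (atTop : Filter (Finset (basisIndex H))))
        (f := fun s (x : WeakBall H) => ∑ i ∈ s, ⟪basis H i, x.1⟫_ℂ • basis H i) (fun s => ?_) ?_
      · refine Continuous.measurable (continuous_finsetSum _ fun i _ => ?_)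
        exact (continuous_inner_weakBall _).smul continuous_const
      · rw [tendsto_pi_nhds]
        exact fun x => hlim x
    have h2 : @Measurable _ _ (borel (WeakBall H)) (inferInstanceAs (MeasurableSpace (UnitBall H)))
        (id : WeakBall H → UnitBall H) := Measurable.subtype_mk h
    intro s hs
    exact h2 hs
  · refine MeasurableSpace.generateFrom_le fun s hs => ?_
    exact (continuous_toWeakBall.isOpen_preimage s hs).measurableSet

/-! ### Representation of moment functions -/

lemma continuous_integral_weakBall {f : WeakBall H → ℂ} (hf : Continuous f) :
    Continuous fun μ : ProbabilityMeasure (WeakBall H) =>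
      ∫ φ, f φ ∂(μ : Measure (WeakBall H)) := by
  rw [continuous_iff_continuousAt]
  intro μ
  exact (ProbabilityMeasure.tendsto_iff_forall_integral_rclike_tendsto ℂ).1 tendsto_id
    (BoundedContinuousFunction.mkOfCompact ⟨f, hf⟩)

lemma integrable_weakBall {f : WeakBall H → ℂ} (hf : Continuous f) (μ : Measure (WeakBall H))
    [IsFiniteMeasure μ] : Integrable f μ :=
  (BoundedContinuousFunction.mkOfCompact ⟨f, hf⟩).integrable μ

/-- Every normalised moment function is the sequence of moments of a probability measure. -/
theorem exists_measure_of_isMomentFunction {ℓ : Multiset (H × H) → ℂ}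
    (h : IsMomentFunction ℓ) (h0 : ℓ 0 = 1) : ∃ μ : ProbabilityMeasure (WeakBall H),
      ∀ m, ℓ m = ∫ φ, pointMoment φ.1 m ∂(μ : Measure (WeakBall H)) := by
  let Ψ : ProbabilityMeasure (WeakBall H) → Multiset (H × H) → ℂ :=
    fun μ m => ∫ φ, pointMoment φ.1 m ∂(μ : Measure (WeakBall H))
  have hΨ : Continuous Ψ := continuous_pi fun m =>
    continuous_integral_weakBall (continuous_pointMoment m)
  have hcpt : IsCompact (Set.range Ψ) := isCompact_range hΨ
  have hconv : Convex ℝ (Set.range Ψ) := by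
    rintro _ ⟨μ, rfl⟩ _ ⟨ν, rfl⟩ a b ha hb hab
    have hp : IsProbabilityMeasure (ENNReal.ofReal a • (μ : Measure (WeakBall H)) +
        ENNReal.ofReal b • (ν : Measure (WeakBall H))) := ⟨by
      simp only [Measure.add_apply, Measure.smul_apply, measure_univ, smul_eq_mul, mul_one]
      rw [← ENNReal.ofReal_add ha hb, hab, ENNReal.ofReal_one]⟩
    refine ⟨⟨_, hp⟩, funext fun m => ?_⟩
    have hi := fun μ : ProbabilityMeasure (WeakBall H) => integrable_weakBall
      (continuous_pointMoment m) (μ : Measure (WeakBall H))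
    change ∫ φ, pointMoment φ.1 m ∂(ENNReal.ofReal a • (μ : Measure (WeakBall H)) +
        ENNReal.ofReal b • (ν : Measure (WeakBall H))) = _
    rw [integral_add_measure ((hi μ).smul_measure ENNReal.ofReal_ne_top)
      ((hi ν).smul_measure ENNReal.ofReal_ne_top), integral_smul_measure, integral_smul_measure,
      ENNReal.toReal_ofReal ha, ENNReal.toReal_ofReal hb]
    rfl
  have hsub : (momentFunctions H).extremePoints ℝ ⊆ Set.range Ψ := by
    intro ℓ hℓ
    obtain ⟨φ, hφ, rfl⟩ := exists_pointMoment_of_mem_extremePoints hℓ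
    let x : WeakBall H := ⟨φ, mem_closedBall_zero_iff.2 hφ⟩
    refine ⟨⟨Measure.dirac x, inferInstance⟩, funext fun m => ?_⟩
    exact integral_dirac (fun φ : WeakBall H => pointMoment φ.1 m) x
  -- The moments of probability measures form a closed convex set containing the extreme points; by
  -- Krein–Milman it contains every normalised moment function.
  have hKM := closure_convexHull_extremePoints (isCompact_momentFunctions H)
    (convex_momentFunctions H)
  have hmem : ℓ ∈ closure (convexHull ℝ ((momentFunctions H).extremePoints ℝ)) := by
    rw [hKM]; exact ⟨h, h0⟩
  obtain ⟨μ, hμ⟩ := closure_minimal (convexHull_min hsub hconv) hcpt.isClosed hmem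
  exact ⟨μ, fun m => (congrFun hμ m).symm⟩

end WeakBall

/-! ### Invariant measures: moments, surjectivity and uniqueness -/

section Moments

noncomputable instance : MeasurableSpace Circle := borel Circle

instance : BorelSpace Circle := ⟨rfl⟩

/-- The normalised Haar measure of the circle. -/
noncomputable def circleMeasure : Measure Circle :=
  Measure.haarMeasure (⊤ : TopologicalSpace.PositiveCompacts Circle)

instance : IsProbabilityMeasure circleMeasure :=
  ⟨by simpa [circleMeasure] using
    Measure.haarMeasure_self (K₀ := (⊤ : TopologicalSpace.PositiveCompacts Circle))⟩

instance : circleMeasure.IsMulLeftInvariant :=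
  inferInstanceAs (Measure.haarMeasure _).IsMulLeftInvariant

lemma unitBall_norm_le {H : Type*} [NormedAddCommGroup H] (x : UnitBall H) : ‖x.1‖ ≤ 1 :=
  mem_closedBall_zero_iff.1 x.2

variable {H : Type*} [NormedAddCommGroup H] [InnerProductSpace ℂ H]

lemma continuous_rotate (θ : ℝ) : Continuous (rotate θ : UnitBall H → UnitBall H) :=
  Continuous.subtype_mk (continuous_const.smul continuous_subtype_val) _

/-- The action of the circle on the closed unit ball. -/
noncomputable def circleAct (c : Circle) (x : UnitBall H) : UnitBall H :=
  ⟨(c : ℂ) • x.1, by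
    rw [mem_closedBall_zero_iff, norm_smul, Circle.norm_coe, one_mul]
    exact unitBall_norm_le x⟩

lemma continuous_circleAct : Continuous fun p : Circle × UnitBall H => circleAct p.1 p.2 := by
  unfold circleAct
  fun_prop

lemma rotate_circleAct (θ : ℝ) (c : Circle) (x : UnitBall H) :
    rotate θ (circleAct c x) = circleAct (Circle.exp θ * c) x := by
  refine Subtype.ext ?_
  change Complex.exp (θ * Complex.I) • ((c : ℂ) • x.1) = _
  rw [smul_smul]; simp [circleAct]

/-- The phases of ⟨a, φ⟩ and ⟨φ, b⟩ cancel pair by pair; this is why averaging over U(1) preserves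
the moments. -/
lemma pointMoment_circleAct (c : Circle) (x : UnitBall H) (m : Multiset (H × H)) :
    pointMoment (circleAct c x).1 m = pointMoment x.1 m := by
  unfold pointMoment circleAct
  congr 1
  refine Multiset.map_congr rfl fun p _ => ?_
  rw [inner_smul_left, inner_smul_right, ← Circle.coe_inv_eq_conj]
  have : (c : ℂ) * ((c⁻¹ : Circle) : ℂ) = 1 := by rw [← Circle.coe_mul]; simp
  linear_combination ⟪p.1, x.1⟫_ℂ * ⟪x.1, p.2⟫_ℂ * this

lemma eq_of_corr_eq [CompleteSpace H] {γ γ' : ∀ k, TraceClass (symPower H k)}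
    (h : corr γ = corr γ') : γ = γ' := by
  funext k
  refine TraceClass.ext (eq_of_inner_symTensor fun x y => ?_)
  have := congrFun h (List.ofFn fun i => (x i, y i))
  rwa [corr_ofFn, corr_ofFn] at this

/-- The weakly continuous function `φ ↦ ⟪a, φ⟫` on the unit ball. -/
noncomputable def coordFun (a : H) : C(WeakBall H, ℂ) :=
  ⟨fun φ => ⟪a, φ.1⟫_ℂ, continuous_inner_weakBall a⟩

lemma star_coordFun_apply (a : H) (φ : WeakBall H) : star (coordFun a) φ = ⟪φ.1, a⟫_ℂ :=
  inner_conj_symm _ _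

/-- The monomial `∏_{a ∈ s} ⟪a, φ⟫ ∏_{b ∈ t} ⟪φ, b⟫`. -/
noncomputable def monomial (s t : Multiset H) : C(WeakBall H, ℂ) :=
  (s.map coordFun).prod * (t.map fun b => star (coordFun b)).prod

lemma monomial_apply (s t : Multiset H) (φ : WeakBall H) :
    monomial s t φ = (s.map fun a => ⟪a, φ.1⟫_ℂ).prod * (t.map fun b => ⟪φ.1, b⟫_ℂ).prod := by
  have h : ∀ u : Multiset C(WeakBall H, ℂ), u.prod φ = (u.map fun f => f φ).prod := fun u => by
    induction u using Multiset.induction_on with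
    | empty => simp
    | cons f u ih => simp [ih]
  rw [monomial, ContinuousMap.mul_apply, h, h, Multiset.map_map, Multiset.map_map]
  simp only [Function.comp_def, star_coordFun_apply]
  rfl

lemma monomial_rotate (s t : Multiset H) (θ : ℝ) (φ : UnitBall H) :
    monomial s t (toWeakBall (rotate θ φ)) =
      Complex.exp (((s.card : ℝ) - t.card : ℝ) * θ * Complex.I) *
      monomial s t (toWeakBall φ) := by
  rw [monomial_apply, monomial_apply]
  have h1 : ∀ a : H, ⟪a, (toWeakBall (rotate θ φ)).1⟫_ℂ =
      Complex.exp (θ * Complex.I) * ⟪a, (toWeakBall φ).1⟫_ℂ :=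
    fun a => inner_smul_right _ _ _
  have h2 : ∀ b : H, ⟪(toWeakBall (rotate θ φ)).1, b⟫_ℂ =
      Complex.exp (-(θ * Complex.I)) * ⟪(toWeakBall φ).1, b⟫_ℂ :=
    fun b => (inner_smul_left _ _ _).trans (by
      rw [← Complex.exp_conj]; simp [toWeakBall])
  simp only [h1, h2, Multiset.prod_map_mul, Multiset.map_const', Multiset.prod_replicate,
    ← Complex.exp_nat_mul]
  rw [mul_mul_mul_comm, ← Complex.exp_add]
  congr 2
  push_cast
  ring

lemma exists_zip {α β : Type*} (s : Multiset α) (t : Multiset β) (h : s.card = t.card) :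
    ∃ m : Multiset (α × β), m.map Prod.fst = s ∧ m.map Prod.snd = t := by
  induction s using Quotient.inductionOn with | _ l =>
  induction t using Quotient.inductionOn with | _ l' =>
  have h' : l.length = l'.length := h
  refine ⟨(l.zip l' : List _), ?_, ?_⟩
  · simp [List.map_fst_zip, h'.le]
  · simp [List.map_snd_zip, h'.ge]

lemma exists_eq_monomial {f : C(WeakBall H, ℂ)}
    (hf : f ∈ Submonoid.closure (Set.range coordFun ∪ star (Set.range coordFun))) :
    ∃ s t : Multiset H, f = monomial s t := by
  induction hf using Submonoid.closure_induction with
  | mem f hf =>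
    rcases hf with ⟨a, rfl⟩ | hf
    · exact ⟨{a}, 0, by simp [monomial]⟩
    · obtain ⟨a, ha⟩ := Set.mem_star.1 hf
      exact ⟨0, {a}, by simp [monomial, ha]⟩
  | one => exact ⟨0, 0, by simp [monomial]⟩
  | mul f g _ _ hf hg =>
    obtain ⟨s, t, rfl⟩ := hf
    obtain ⟨s', t', rfl⟩ := hg
    exact ⟨s + s', t + t', by simp [monomial, mul_mul_mul_comm]⟩

variable [MeasurableSpace H]

/-- An invariant measure, on the unit ball with the weak topology. -/
noncomputable def InvMeasure.weak (μ : InvMeasure H) : ProbabilityMeasure (WeakBall H) :=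
  ⟨(μ.1 : Measure (UnitBall H)), inferInstanceAs (IsProbabilityMeasure (μ.1 : Measure (UnitBall H)))⟩

lemma InvMeasure.weak_injective : Function.Injective (InvMeasure.weak : InvMeasure H → _) :=
  fun _ _ h => Subtype.ext (Subtype.ext (congrArg (fun ρ : ProbabilityMeasure (WeakBall H) =>
    (ρ : Measure (WeakBall H))) h))

variable [BorelSpace H]

section

variable [SecondCountableTopology H]

/-- The average over `U(1)` of a probability measure, which is invariant. -/
noncomputable def circleAverage (μ : ProbabilityMeasure (UnitBall H)) : InvMeasure H :=
  ⟨⟨Measure.map (fun p : Circle × UnitBall H => circleAct p.1 p.2)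
      (circleMeasure.prod (μ : Measure (UnitBall H))),
      Measure.isProbabilityMeasure_map continuous_circleAct.measurable.aemeasurable⟩, by
    intro θ
    change Measure.map _ (Measure.map _ _) = Measure.map _ _
    rw [Measure.map_map (continuous_rotate θ).measurable continuous_circleAct.measurable]
    have h : rotate θ ∘ (fun p : Circle × UnitBall H => circleAct p.1 p.2) =
        (fun p : Circle × UnitBall H => circleAct p.1 p.2) ∘
          Prod.map (fun c => Circle.exp θ * c) id := by
      funext p; exact rotate_circleAct θ p.1 p.2
    rw [h, ← Measure.map_map continuous_circleAct.measurable (by fun_prop)]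
    congr 1
    exact ((measurePreserving_mul_left _ _).prod (MeasurePreserving.id _)).map_eq⟩

lemma integral_circleAverage (μ : ProbabilityMeasure (UnitBall H)) {f : UnitBall H → ℂ}
    (hf : Continuous f) (h : ∀ c x, f (circleAct c x) = f x) :
    ∫ φ, f φ ∂((circleAverage μ).1 : Measure (UnitBall H)) =
      ∫ φ, f φ ∂(μ : Measure (UnitBall H)) := by
  change ∫ φ, f φ ∂(Measure.map _ _) = _
  rw [integral_map continuous_circleAct.measurable.aemeasurable
    hf.stronglyMeasurable.aestronglyMeasurable]
  simp only [h]
  rw [integral_fun_snd]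
  simp

end

variable [CompleteSpace H]

lemma integrable_norm_tensorPow_sq (μ : Measure (UnitBall H)) [IsFiniteMeasure μ] (k : ℕ) :
    Integrable (fun φ : UnitBall H => ‖tensorPow k φ.1‖ ^ 2) μ := by
  refine Integrable.of_bound (C := 1) ?_ (Eventually.of_forall fun φ => ?_)
  · exact (((continuous_tensorPow k).comp
      continuous_subtype_val).norm.pow 2).stronglyMeasurable.aestronglyMeasurable
  · rw [norm_tensorPow, Real.norm_of_nonneg (by positivity)]
    exact pow_le_one₀ (by positivity) (pow_le_one₀ (norm_nonneg _) (unitBall_norm_le φ))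

/-- Rotation by π/(s.card - t.card) changes the sign of the monomial, while invariance preserves its
integral. -/
lemma integral_monomial_of_card_ne (μ : InvMeasure H) {s t : Multiset H} (h : s.card ≠ t.card) :
    ∫ φ, monomial s t φ ∂(μ.weak : Measure (WeakBall H)) = 0 := by
  have hd : ((s.card : ℝ) - t.card) ≠ 0 := sub_ne_zero.2 (by exact_mod_cast h)
  let θ : ℝ := Real.pi / ((s.card : ℝ) - t.card)
  have hc : Continuous fun φ : UnitBall H => monomial s t (toWeakBall φ) :=
    (monomial s t).continuous.comp continuous_toWeakBall
  have h1 : ∫ φ : UnitBall H, monomial s t (toWeakBall φ) ∂(μ.1 : Measure (UnitBall H)) =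
      ∫ φ : UnitBall H, monomial s t (toWeakBall (rotate θ φ)) ∂(μ.1 : Measure (UnitBall H)) := by
    conv_lhs => rw [← μ.2 θ]
    exact integral_map (continuous_rotate θ).measurable.aemeasurable
      hc.stronglyMeasurable.aestronglyMeasurable
  have h2 : Complex.exp (((s.card : ℝ) - t.card : ℝ) * θ * Complex.I) = -1 := by
    rw [← Complex.ofReal_mul, mul_div_cancel₀ _ hd, Complex.exp_pi_mul_I]
  simp only [monomial_rotate, h2, neg_one_mul] at h1
  exact self_eq_neg.1 (h1.trans (integral_neg _))

variable [SecondCountableTopology H]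

lemma aestronglyMeasurable_tensorPow (μ : Measure (UnitBall H)) (k : ℕ) :
    AEStronglyMeasurable (fun φ : UnitBall H => tensorPow k φ.1) μ :=
  ((continuous_tensorPow k).comp continuous_subtype_val).stronglyMeasurable.aestronglyMeasurable

lemma integrable_dyad_tensorPow (μ : Measure (UnitBall H)) [IsFiniteMeasure μ] (k : ℕ) :
    Integrable (fun φ : UnitBall H => TraceClass.dyad (tensorPow k φ.1)) μ :=
  integrable_dyad (aestronglyMeasurable_tensorPow μ k) (integrable_norm_tensorPow_sq μ k)

lemma trace_momentMap_comp (μ : InvMeasure H) (k : ℕ) (A : symPower H k →L[ℂ] symPower H k) :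
    trace ((momentMap μ k).op ∘L A) =
      ∫ φ : UnitBall H, ⟪tensorPow k φ.1, A (tensorPow k φ.1)⟫_ℂ ∂(μ.1 : Measure (UnitBall H)) :=
  trace_ensemble_comp (aestronglyMeasurable_tensorPow _ k) (integrable_norm_tensorPow_sq _ k) A

lemma corr_momentMap (μ : InvMeasure H) (m : Multiset (H × H)) :
    corr (momentMap μ) m = ∫ φ : UnitBall H, pointMoment φ.1 m ∂(μ.1 : Measure (UnitBall H)) := by
  obtain ⟨n, x, rfl⟩ := exists_ofFn m
  rw [corr_ofFn]
  refine (inner_ensemble (aestronglyMeasurable_tensorPow _ n)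
    (integrable_norm_tensorPow_sq _ n) _ _).trans
    (integral_congr_ae (Eventually.of_forall fun φ => ?_))
  have h1 := inner_symTensor_tensorPow (fun i => (x i).1) φ.1
  have h2 : ⟪tensorPow n φ.1, symTensor fun i => (x i).2⟫_ℂ = ∏ j, ⟪φ.1, (x j).2⟫_ℂ := by
    rw [inner_symTensor_right]; exact inner_tensor _ _
  simp only [h1, h2, pointMoment, Multiset.map_coe, Multiset.prod_coe, List.map_ofFn,
    List.prod_ofFn, Function.comp_apply, Finset.prod_mul_distrib]

/-- Every symmetric hierarchy is the sequence of moments of an invariant measure. -/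
theorem exists_momentMap_eq {γ : ∀ k, TraceClass (symPower H k)} (hγ : γ ∈ symHierarchies H) :
    ∃ μ : InvMeasure H, momentMap μ = γ := by
  obtain ⟨h1, h2⟩ := isMomentFunction_corr hγ
  obtain ⟨μ, hμ⟩ := exists_measure_of_isMomentFunction h1 h2
  let μ' : ProbabilityMeasure (UnitBall H) := ⟨(μ : Measure (WeakBall H)),
    inferInstanceAs (IsProbabilityMeasure (μ : Measure (WeakBall H)))⟩
  refine ⟨circleAverage μ', eq_of_corr_eq (funext fun m => ?_)⟩
  rw [corr_momentMap, hμ, integral_circleAverage μ' (f := fun φ => pointMoment φ.1 m)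
    ((continuous_pointMoment m).comp continuous_toWeakBall)
    fun c x => pointMoment_circleAct c x m]
  rfl

/-! ### Uniqueness of the measure -/

/-- With equally many factors of each kind, zipping them in any order gives a correlation; otherwise
both integrals vanish. -/
lemma integral_monomial_eq {μ ν : InvMeasure H} (h : momentMap μ = momentMap ν)
    (s t : Multiset H) : ∫ φ, monomial s t φ ∂(μ.weak : Measure (WeakBall H)) =
      ∫ φ, monomial s t φ ∂(ν.weak : Measure (WeakBall H)) := by
  by_cases hst : s.card = t.card
  · obtain ⟨m, rfl, rfl⟩ := exists_zip s t hst
    have h1 : ∀ φ : WeakBall H, monomial (m.map Prod.fst) (m.map Prod.snd) φ =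
        pointMoment φ.1 m := fun φ => by
      simp [monomial_apply, pointMoment, Multiset.map_map, Multiset.prod_map_mul]
    simp only [h1]
    have h2 := (corr_momentMap μ m).symm.trans ((congrArg (corr · m) h).trans (corr_momentMap ν m))
    exact h2
  · rw [integral_monomial_of_card_ne μ hst, integral_monomial_of_card_ne ν hst]

variable [TopologicalSpace.SeparableSpace H]

/-- An invariant measure is determined by its moments. -/
theorem momentMap_injective : Function.Injective (momentMap : InvMeasure H → _) := by
  intro μ ν h
  let Λ : ProbabilityMeasure (WeakBall H) → C(WeakBall H, ℂ) →ₗ[ℂ] ℂ := fun ρ =>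
    { toFun := fun f => ∫ φ, f φ ∂(ρ : Measure (WeakBall H))
      map_add' := fun f g => integral_add (integrable_weakBall f.continuous _)
        (integrable_weakBall g.continuous _)
      map_smul' := fun c f => integral_const_mul c _ }
  have hΛ : ∀ ρ, Continuous (Λ ρ) := fun ρ =>
    AddMonoidHomClass.continuous_of_bound (Λ ρ) 1 fun f => by
    refine (norm_integral_le_of_norm_le_const (C := ‖f‖)
      (Eventually.of_forall fun φ => f.norm_coe_le_norm φ)).trans (by simp)
  -- The functions on which μ and ν agree form a closed subspace. It contains the star algebra
  -- generated by the coordinates, which separates points, so Stone–Weierstrass makes it everything.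
  let V : Submodule ℂ C(WeakBall H, ℂ) := LinearMap.eqLocus (Λ μ.weak) (Λ ν.weak)
  have hV : IsClosed (V : Set C(WeakBall H, ℂ)) := isClosed_eq (hΛ _) (hΛ _)
  let A : StarSubalgebra ℂ C(WeakBall H, ℂ) := StarAlgebra.adjoin ℂ (Set.range coordFun)
  have hA : (A : Set C(WeakBall H, ℂ)) ⊆ V := by
    have h1 : Subalgebra.toSubmodule A.toSubalgebra ≤ V := by
      rw [StarAlgebra.adjoin_eq_span, Submodule.span_le]
      intro f hf
      obtain ⟨s, t, rfl⟩ := exists_eq_monomial hf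
      exact integral_monomial_eq h s t
    exact h1
  have hsep : A.SeparatesPoints := by
    intro x y hxy
    obtain ⟨i, hi⟩ := Function.ne_iff.1 (coords_injective.ne hxy)
    exact ⟨coordFun (basis H i), ⟨_, StarAlgebra.subset_adjoin ℂ _ ⟨_, rfl⟩, rfl⟩, hi⟩
  have htop := ContinuousMap.starSubalgebra_topologicalClosure_eq_top_of_separatesPoints A hsep
  have hall : ∀ f : C(WeakBall H, ℂ), f ∈ V := fun f => by
    have h1 : f ∈ A.topologicalClosure := htop ▸ StarSubalgebra.mem_top
    exact closure_minimal hA hV h1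
  refine InvMeasure.weak_injective (Subtype.ext
    (ext_of_forall_integral_eq_of_IsFiniteMeasure (μ := (μ.weak : Measure (WeakBall H)))
      (ν := (ν.weak : Measure (WeakBall H))) fun f => ?_))
  let g : C(WeakBall H, ℂ) := ⟨fun φ => (f φ : ℂ), Complex.continuous_ofReal.comp f.continuous⟩
  have h2 : ∫ φ, ((f φ : ℝ) : ℂ) ∂(μ.weak : Measure (WeakBall H)) =
    ∫ φ, ((f φ : ℝ) : ℂ) ∂(ν.weak : Measure (WeakBall H)) := hall g
  rw [integral_complex_ofReal, integral_complex_ofReal] at h2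
  exact_mod_cast h2

end Moments

/-- A map into a compact set is continuous when its compositions with a separating family of
continuous functions are. -/
lemma continuous_of_separating {X Y Z ι : Type*} [TopologicalSpace X] [TopologicalSpace Y]
    [TopologicalSpace Z] [T2Space Z] {S : Set Y} (hS : IsCompact S) {f : X → Y}
    (hf : ∀ x, f x ∈ S) {g : ι → Y → Z} (hg : ∀ i, Continuous (g i))
    (hsep : ∀ y y', (∀ i, g i y = g i y') → y = y') (h : ∀ i, Continuous fun x => g i (f x)) :
    Continuous f := by
  rw [continuous_iff_continuousAt]
  intro x
  -- Along an ultrafilter converging to a cluster point y, each test function has the limits g i y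
  -- and g i (f x); separation gives y = f x.
  refine hS.tendsto_nhds_of_unique_mapClusterPt (Eventually.of_forall hf) fun y _ hy => ?_
  obtain ⟨U, hU, hUy⟩ := mapClusterPt_iff_ultrafilter.1 hy
  exact hsep _ _ fun i => tendsto_nhds_unique (((hg i).tendsto y).comp hUy)
    (((h i).tendsto x).mono_left hU)

/-! ### Weak continuity of compact observables -/

section Compact

variable {K : Type*} [NormedAddCommGroup K] [InnerProductSpace ℂ K] [CompleteSpace K]

/-- A compact operator maps the ball with its weak topology continuously to the normed space. -/
lemma continuous_compactOperator {A : K →L[ℂ] K} (hA : IsCompactOperator A) :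
    Continuous fun x : WeakBall K => A x.1 := by
  obtain ⟨S, hS, hS'⟩ := IsCompactOperator.image_closedBall_subset_compact 
    (f := (A : K →ₗ[ℂ] K)) hA 1
  refine continuous_of_separating hS (fun x => hS' ⟨x.1, x.2, rfl⟩) (g := fun z y => ⟪z, y⟫_ℂ)
    (fun z => continuous_const.inner continuous_id) (fun y y' h => ext_inner_left ℂ h) fun z => ?_
  simp only [← ContinuousLinearMap.adjoint_inner_left]
  exact continuous_inner_weakBall _

/-- Split ⟨y, A y⟩ = ⟨y, A y - A x⟩ + ⟨y, A x⟩: the first term tends to zero because A turns weak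
into norm convergence on the ball, the second is weakly continuous. -/
lemma continuous_inner_compactOperator {A : K →L[ℂ] K} (hA : IsCompactOperator A) :
    Continuous fun x : WeakBall K => ⟪x.1, A x.1⟫_ℂ := by
  rw [continuous_iff_continuousAt]
  intro x
  have h1 : Tendsto (fun y : WeakBall K => ⟪y.1, A x.1⟫_ℂ) (𝓝 x) (𝓝 ⟪x.1, A x.1⟫_ℂ) :=
    (continuous_inner_weakBall' (A x.1)).tendsto x
  have h2 : Tendsto (fun y : WeakBall K => ⟪y.1, A y.1 - A x.1⟫_ℂ) (𝓝 x) (𝓝 0) := by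
    have h3 : Tendsto (fun y : WeakBall K => ‖A y.1 - A x.1‖) (𝓝 x) (𝓝 0) :=
      tendsto_iff_norm_sub_tendsto_zero.1 ((continuous_compactOperator hA).tendsto x)
    refine squeeze_zero_norm (fun y => (norm_inner_le_norm _ _).trans ?_) h3
    exact mul_le_of_le_one_left (norm_nonneg _) (weakBall_norm_le y)
  have h4 := h2.add h1
  rw [zero_add] at h4
  refine h4.congr fun y => ?_
  rw [← inner_add_right, sub_add_cancel]

variable {H : Type*} [NormedAddCommGroup H] [InnerProductSpace ℂ H] [CompleteSpace H]

lemma norm_tensorPow_le (k : ℕ) (φ : WeakBall H) : ‖tensorPow k φ.1‖ ≤ 1 := by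
  rw [norm_tensorPow]
  exact pow_le_one₀ (norm_nonneg _) (weakBall_norm_le φ)

/-- The map `φ ↦ φ^{⊗k}` between unit balls. -/
noncomputable def ballPow (k : ℕ) (φ : WeakBall H) : WeakBall (symPower H k) :=
  ⟨tensorPow k φ.1, mem_closedBall_zero_iff.2 (norm_tensorPow_le k φ)⟩

/-- The target ball is weakly compact, so symmetrised tensors suffice as test vectors, and on these
the inner product is a product of coordinates. -/
lemma continuous_ballPow (k : ℕ) :
    Continuous (ballPow k : WeakBall H → WeakBall (symPower H k)) := by
  refine continuous_of_separating isCompact_univ (fun _ => Set.mem_univ _)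
    (g := fun (x : Fin k → H) (y : WeakBall (symPower H k)) => ⟪symTensor x, y.1⟫_ℂ)
    (fun x => continuous_inner_weakBall _) (fun y y' h => ?_) fun x => ?_
  · refine Subtype.ext (sub_eq_zero.1 (eq_zero_of_inner_symTensor fun x => ?_))
    exact (inner_sub_right _ _ _).trans (sub_eq_zero.2 (h x))
  · have h : ∀ φ : WeakBall H, ⟪symTensor x, (ballPow k φ).1⟫_ℂ = ∏ j, ⟪x j, φ.1⟫_ℂ :=
      fun φ => inner_symTensor_tensorPow x φ.1
    simp only [h]
    exact continuous_finsetProd _ fun j _ => continuous_inner_weakBall _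

lemma continuous_inner_tensorPow_compactOperator {k : ℕ} {A : symPower H k →L[ℂ] symPower H k}
    (hA : IsCompactOperator A) :
    Continuous fun φ : WeakBall H => ⟪tensorPow k φ.1, A (tensorPow k φ.1)⟫_ℂ :=
  (continuous_inner_compactOperator hA).comp (continuous_ballPow k)

end Compact

/-! ### Moments of an invariant measure form a hierarchy -/

section Existence

variable {H : Type*} [NormedAddCommGroup H] [InnerProductSpace ℂ H] [CompleteSpace H]

lemma tendsto_weakBall {α : Type*} {l : Filter α} {f : α → WeakBall H} {x : WeakBall H}
    (h : ∀ y, Tendsto (fun a => ⟪y, (f a).1⟫_ℂ) l (𝓝 ⟪y, x.1⟫_ℂ)) : Tendsto f l (𝓝 x) := by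
  rw [(continuous_coords.isClosedEmbedding coords_injective).isEmbedding.tendsto_nhds_iff,
    tendsto_pi_nhds]
  exact fun i => h _

/-- In infinite dimension the unit sphere approximates the unit ball weakly. -/
lemma exists_sphere_approximation (hH : ¬ FiniteDimensional ℂ H) :
    ∃ T : ℕ → UnitBall H → UnitBall H, (∀ n, Continuous (T n)) ∧ (∀ n φ, ‖(T n φ).1‖ = 1) ∧
      ∀ φ, Tendsto (fun n => toWeakBall (T n φ)) atTop (𝓝 (toWeakBall φ)) := by
  have hinf : Infinite (basisIndex H) := by
    by_contra hfin
    rw [not_infinite_iff_finite] at hfin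
    have := Fintype.ofFinite (basisIndex H)
    exact hH ((basis H).toOrthonormalBasis.toBasis.finiteDimensional_of_finite)
  let b : ℕ → H := fun n => basis H (Infinite.natEmbedding _ n)
  have hb : Orthonormal ℂ b := (basis H).orthonormal.comp _ (Infinite.natEmbedding _).injective
  -- The larger root of the quadratic equation ‖φ + c b n‖² = 1. It stays bounded in n, while b n
  -- tends weakly to zero.
  let c : ℕ → H → ℝ := fun n φ => -(⟪φ, b n⟫_ℂ).re + Real.sqrt ((⟪φ, b n⟫_ℂ).re ^ 2 + (1 - ‖φ‖ ^ 2))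
  have hre : ∀ n (φ : UnitBall H), |(⟪φ.1, b n⟫_ℂ).re| ≤ 1 := fun n φ => by
    refine (Complex.abs_re_le_norm _).trans ((norm_inner_le_norm _ _).trans ?_)
    rw [hb.1 n, mul_one]
    exact unitBall_norm_le φ
  have hφ : ∀ φ : UnitBall H, ‖φ.1‖ ^ 2 ≤ 1 := fun φ =>
    pow_le_one₀ (norm_nonneg _) (unitBall_norm_le φ)
  have hnorm : ∀ n (φ : UnitBall H), ‖φ.1 + (c n φ.1 : ℂ) • b n‖ = 1 := fun n φ => by
    have h1 : ‖φ.1 + (c n φ.1 : ℂ) • b n‖ ^ 2 = 1 := by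
      rw [@norm_add_sq ℂ, inner_smul_right, norm_smul, hb.1 n, Complex.norm_real]
      have h2 := Real.sq_sqrt (x := (⟪φ.1, b n⟫_ℂ).re ^ 2 + (1 - ‖φ.1‖ ^ 2))
        (by nlinarith [hφ φ, sq_nonneg (⟪φ.1, b n⟫_ℂ).re])
      simp only [Complex.re_ofReal_mul, RCLike.re_to_complex, mul_one, Real.norm_eq_abs, sq_abs, c]
      linear_combination h2
    exact (pow_eq_one_iff_of_nonneg (norm_nonneg _) two_ne_zero).1 h1
  have hc : ∀ n (φ : UnitBall H), |c n φ.1| ≤ 3 := fun n φ => by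
    refine (abs_add_le _ _).trans ?_
    rw [abs_neg, abs_of_nonneg (Real.sqrt_nonneg _)]
    have h2 : Real.sqrt ((⟪φ.1, b n⟫_ℂ).re ^ 2 + (1 - ‖φ.1‖ ^ 2)) ≤ 2 := by
      refine Real.sqrt_le_iff.2 ⟨by norm_num, ?_⟩
      nlinarith [sq_nonneg ‖φ.1‖, (sq_le_one_iff_abs_le_one _).2 (hre n φ)]
    linarith [hre n φ]
  refine ⟨fun n φ => ⟨φ.1 + (c n φ.1 : ℂ) • b n, mem_closedBall_zero_iff.2 (hnorm n φ).le⟩,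
    fun n => ?_, hnorm, fun φ => tendsto_weakBall fun y => ?_⟩
  · simp only [c]
    fun_prop
  · have h1 : Tendsto (fun n => ⟪y, b n⟫_ℂ) atTop (𝓝 0) := by
      have h2 := (hb.inner_products_summable y).tendsto_atTop_zero
      have h3 := h2.sqrt
      simp only [Real.sqrt_sq (norm_nonneg _), Real.sqrt_zero] at h3
      rw [tendsto_zero_iff_norm_tendsto_zero]
      exact h3.congr fun n => norm_inner_symm _ _
    have h4 : Tendsto (fun n => (c n φ.1 : ℂ) * ⟪y, b n⟫_ℂ) atTop (𝓝 0) := by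
      refine squeeze_zero_norm (a := fun n => 3 * ‖⟪y, b n⟫_ℂ‖) (fun n => ?_) ?_
      · rw [norm_mul, Complex.norm_real]
        exact mul_le_mul_of_nonneg_right (hc n φ) (norm_nonneg _)
      · simpa using (h1.norm.const_mul 3)
    have h5 := h4.const_add ⟪y, φ.1⟫_ℂ
    rw [add_zero] at h5
    refine h5.congr fun n => ?_
    rw [← inner_smul_right, ← inner_add_right]
    rfl

lemma slice_tensorPow {k m : ℕ} (φ : H) (J : Fin m → basisIndex H) :
    slice J (tensorPow (k + m) φ : TensorPower H (k + m)) =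
      tensor (fun _ => φ) J • (tensorPow k φ : TensorPower H k) := by
  ext I
  change ∏ j, ⟪basis H (Fin.append I J j), φ⟫_ℂ =
    (∏ j, ⟪basis H (J j), φ⟫_ℂ) * ∏ j, ⟪basis H (I j), φ⟫_ℂ
  rw [Fin.prod_univ_add, mul_comm]
  simp

/-- The m spectator factors contribute ‖φ‖^{2m}, so unit norm is essential. -/
lemma inner_tensorPow_ampliation {k m : ℕ} {φ : H} (hφ : ‖φ‖ = 1)
    (A : symPower H k →L[ℂ] symPower H k) :
    ⟪(tensorPow (k + m) φ : TensorPower H (k + m)), ampliation m (extendOp A)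
      (tensorPow (k + m) φ)⟫_ℂ = ⟪tensorPow k φ, A (tensorPow k φ)⟫_ℂ := by
  have h1 : ⟪(tensorPow k φ : TensorPower H k), extendOp A (tensorPow k φ)⟫_ℂ =
      ⟪tensorPow k φ, A (tensorPow k φ)⟫_ℂ := by
    rw [inner_extendOp]; simp
  have h2 : ∑' J : Fin m → basisIndex H,
      starRingEnd ℂ (tensor (fun _ => φ) J) * tensor (fun _ => φ) J = 1 := by
    have h3 : ⟪tensor fun _ : Fin m => φ, tensor fun _ : Fin m => φ⟫_ℂ = 1 := by
      rw [inner_tensor]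
      simp [inner_self_eq_norm_sq_to_K, hφ]
    rw [← h3, lp.inner_eq_tsum]
    exact tsum_congr fun J => mul_comm _ _
  rw [inner_eq_tsum_slice]
  simp only [slice_ampliation, slice_tensorPow, map_smul]
  have h4 : ∀ J : Fin m → basisIndex H,
      ⟪tensor (fun _ => φ) J • (tensorPow k φ : TensorPower H k),
        tensor (fun _ => φ) J • extendOp A (tensorPow k φ)⟫_ℂ =
      starRingEnd ℂ (tensor (fun _ => φ) J) * tensor (fun _ => φ) J *
        ⟪tensorPow k φ, A (tensorPow k φ)⟫_ℂ := fun J => by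
    rw [inner_smul_left, inner_smul_right, h1, mul_assoc]
  simp only [h4]
  rw [tsum_mul_right, h2, one_mul]

variable [TopologicalSpace.SeparableSpace H]

/-- The reduced density matrices of a mixture of the pure states `φ^{⊗n}`, `‖φ‖ = 1`. -/
lemma isReducedDensity_ensemble {X : Type*} [MeasurableSpace X] {μ : Measure X}
    [IsFiniteMeasure μ] {F : X → H} (hF : AEStronglyMeasurable F μ) (h1 : ∀ a, ‖F a‖ = 1)
    (k m : ℕ) : IsReducedDensity (ensemble μ fun a => tensorPow (k + m) (F a))
      (ensemble μ fun a => tensorPow k (F a)) := by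
  have hm : ∀ n, AEStronglyMeasurable (fun a => tensorPow n (F a)) μ := fun n =>
    (continuous_tensorPow n).comp_aestronglyMeasurable hF
  have hi : ∀ n, Integrable (fun a => ‖tensorPow n (F a)‖ ^ 2) μ := fun n => by
    simpa only [norm_tensorPow, h1, one_pow] using integrable_const (1 : ℝ)
  refine ⟨isPositive_ensemble (hm k) (hi k), fun A => ?_⟩
  rw [trace_ensemble_comp (hm k) (hi k)]
  refine (trace_comp_eq_integral
    (F := fun a => (tensorPow (k + m) (F a) : TensorPower H (k + m)))
    (continuous_subtype_val.comp_aestronglyMeasurable (hm (k + m))) (hi (k + m))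
    (fun x y => ?_) _).trans ?_
  · rw [inner_extendOp, inner_ensemble (hm _) (hi _)]
    refine integral_congr_ae (Eventually.of_forall fun a => ?_)
    exact congrArg₂ (· * ·) (Submodule.inner_orthogonalProjectionOnto_eq_of_mem_right _ _)
      (Submodule.inner_orthogonalProjectionOnto_eq_of_mem_left _ _)
  · exact integral_congr_ae (Eventually.of_forall fun a => inner_tensorPow_ampliation (h1 a) A)

lemma isNormalState_ensemble {X : Type*} [MeasurableSpace X] {μ : Measure X}
    [IsProbabilityMeasure μ] {F : X → H} (hF : AEStronglyMeasurable F μ) (h1 : ∀ a, ‖F a‖ = 1)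
    (n : ℕ) : IsNormalState (ensemble μ fun a => tensorPow n (F a)) := by
  have hm : AEStronglyMeasurable (fun a => tensorPow n (F a)) μ :=
    (continuous_tensorPow n).comp_aestronglyMeasurable hF
  have hi : Integrable (fun a => ‖tensorPow n (F a)‖ ^ 2) μ := by
    simpa only [norm_tensorPow, h1, one_pow] using integrable_const (1 : ℝ)
  refine ⟨isPositive_ensemble hm hi, ?_⟩
  have h2 : ∀ a, ‖tensorPow n (F a)‖ ^ 2 = 1 := fun a => by
    rw [norm_tensorPow, h1, one_pow, one_pow]
  rw [trace_ensemble hm hi]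
  simp only [h2]
  simp

variable [MeasurableSpace H] [BorelSpace H] [SecondCountableTopology H]

/-- The moments of an invariant measure form a symmetric hierarchy. -/
theorem momentMap_mem_symHierarchies (hH : ¬ FiniteDimensional ℂ H) (μ : InvMeasure H) :
    momentMap μ ∈ symHierarchies H := by
  obtain ⟨T, hT, hT1, hTlim⟩ := exists_sphere_approximation hH
  have hm : ∀ n, AEStronglyMeasurable (fun φ => (T n φ).1) (μ.1 : Measure (UnitBall H)) :=
    fun n => (continuous_subtype_val.comp (hT n)).stronglyMeasurable.aestronglyMeasurable
  -- The n-particle state is r n n, and r n k for k ≤ n are its reduced matrices, since the T n φ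
  -- are unit vectors. The whole sequence converges, so the subsequence is the identity.
  let r : ℕ → ∀ k : ℕ, TraceClass (symPower H k) := fun n k =>
    ensemble (μ.1 : Measure (UnitBall H)) fun φ => tensorPow k (T n φ).1
  refine ⟨fun n => r n n, r, id, fun n => isNormalState_ensemble (hm n) (hT1 n) n,
    fun k m => isReducedDensity_ensemble (hm (k + m)) (hT1 (k + m)) k m, strictMono_id,
    fun k A hA => ?_⟩
  have hmk : ∀ n, Continuous fun φ => tensorPow k (T n φ).1 := fun n =>
    (continuous_tensorPow k).comp (continuous_subtype_val.comp (hT n))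
  have h1 : ∀ n, trace ((r n k).op ∘L A) =
      ∫ φ, ⟪tensorPow k (T n φ).1, A (tensorPow k (T n φ).1)⟫_ℂ ∂(μ.1 : Measure (UnitBall H)) :=
    fun n => trace_ensemble_comp (hmk n).stronglyMeasurable.aestronglyMeasurable
      (by simpa only [norm_tensorPow, hT1, one_pow] using integrable_const (1 : ℝ)) A
  simp only [id, h1]
  rw [trace_momentMap_comp]
  refine tendsto_integral_of_dominated_convergence (fun _ => ‖A‖) (fun n => ?_)
    (integrable_const _) (fun n => Eventually.of_forall fun φ => ?_)
    (Eventually.of_forall fun φ => ?_)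
  · exact ((hmk n).inner (A.continuous.comp (hmk n))).stronglyMeasurable.aestronglyMeasurable
  · refine (norm_inner_le_norm (𝕜 := ℂ) (E := symPower H k) _ _).trans ?_
    have h2 := A.le_opNorm (tensorPow k (T n φ).1)
    rw [norm_tensorPow, hT1, one_pow, mul_one] at h2
    rwa [norm_tensorPow, hT1, one_pow, one_mul]
  · exact ((continuous_inner_tensorPow_compactOperator hA).tendsto _).comp (hTlim φ)

end Existence

/-! ### Topological tools for the homeomorphisms -/

section Topology

variable {X Y Z : Type*} [TopologicalSpace X] [TopologicalSpace Y] [TopologicalSpace Z]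

lemma continuous_symm_of_compactSpace [CompactSpace X] [T2Space Y] (e : X ≃ Y)
    (h : Continuous e) : Continuous e.symm :=
  (Continuous.homeoOfEquivCompactToT2 h).symm.continuous

lemma isHomeomorph_of_continuous_symm (e : X ≃ Y) (h : Continuous e) (h' : Continuous e.symm) :
    IsHomeomorph e :=
  (Homeomorph.mk e h h').isHomeomorph

lemma continuous_induced_pi {W ι : Type*} {E : ι → Type*} [∀ i, TopologicalSpace (E i)]
    (f : W → ∀ i, E i) {i : ι} {g : E i → Z} (hg : Continuous g) :
    @Continuous _ _ (TopologicalSpace.induced f Pi.topologicalSpace) _ fun w => g (f w i) := by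
  let _ := TopologicalSpace.induced f Pi.topologicalSpace
  exact hg.comp ((continuous_apply i).comp continuous_induced_dom)

end Topology

/-! ### The homeomorphism for the weak topologies -/

section WeakHomeomorphism

variable {H : Type*} [NormedAddCommGroup H] [InnerProductSpace ℂ H] [CompleteSpace H]

/-- The rotation of the unit ball with its weak topology. -/
noncomputable def rotateWeak (θ : ℝ) (x : WeakBall H) : WeakBall H :=
  toWeakBall (rotate θ x)

lemma continuous_rotateWeak (θ : ℝ) : Continuous (rotateWeak θ : WeakBall H → WeakBall H) := by
  refine continuous_to_weakBall fun y => ?_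
  have h : ∀ x : WeakBall H, ⟪y, (rotateWeak θ x).1⟫_ℂ =
      Complex.exp (θ * Complex.I) * ⟪y, x.1⟫_ℂ := fun x => inner_smul_right _ _ _
  simp only [h]
  exact continuous_const.mul (continuous_inner_weakBall y)

variable (H) in
/-- The topology of pointwise convergence of the correlation functions. -/
@[reducible] noncomputable def corrTopology : TopologicalSpace (symHierarchies H) :=
  TopologicalSpace.induced (fun γ => corr γ.1) inferInstance

lemma t2Space_corrTopology : @T2Space _ (corrTopology H) :=
  @T2Space.of_injective_continuous _ _ (corrTopology H) _ _ (fun γ => corr γ.1)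
    (fun _ _ h => Subtype.ext (eq_of_corr_eq h)) continuous_induced_dom

/-- Continuity of matrix elements is all that is used, which covers both the weak-∗ and the
trace-norm topologies. -/
lemma induced_le_corrTopology (t : ∀ k, TopologicalSpace (TraceClass (symPower H k)))
    (ht : ∀ k x y, Continuous[t k, inferInstance]
      fun T : TraceClass (symPower H k) => ⟪x, T.op y⟫_ℂ) :
    TopologicalSpace.induced Subtype.val (@Pi.topologicalSpace _ _ t) ≤ corrTopology H := by
  refine continuous_iff_le_induced.1 ((@continuous_pi_iff _ _ _ (TopologicalSpace.induced
    Subtype.val (@Pi.topologicalSpace _ _ t)) _ _).2 fun m => ?_)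
  obtain ⟨n, x, rfl⟩ := exists_ofFn m
  simp only [corr_ofFn]
  exact @continuous_induced_pi _ _ _ _ _ t Subtype.val _ _ (ht n _ _)

lemma hierarchyWeakStar_le_corrTopology : hierarchyWeakStar H ≤ corrTopology H := by
  refine induced_le_corrTopology _ fun k x y => ?_
  simp only [← trace_comp_rankOne]
  exact continuous_iInf_dom (i := ⟨_, isCompactOperator_rankOne y x⟩) continuous_induced_dom

lemma hierarchyNorm_le_corrTopology : hierarchyNorm H ≤ corrTopology H :=
  induced_le_corrTopology _ fun _ x y => (matrixElement x y).continuous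

variable [MeasurableSpace H]

lemma continuous_integral_weakNarrow_real [BorelSpace H] {g : WeakBall H → ℝ} (hg : Continuous g) :
    Continuous[weakNarrow H, inferInstance] fun μ : InvMeasure H =>
      ∫ φ : UnitBall H, g (toWeakBall φ) ∂(μ.1 : Measure (UnitBall H)) := by
  have hb : ∃ C, ∀ x, |g x| ≤ C := by
    obtain ⟨C, hC⟩ := (isCompact_range hg).isBounded.exists_norm_le
    exact ⟨C, fun x => hC _ ⟨x, rfl⟩⟩
  exact continuous_iInf_dom (i := ⟨fun φ => g (toWeakBall φ), hg, hb⟩) continuous_induced_dom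

variable [TopologicalSpace.SeparableSpace H] [BorelSpace H]

/-- Rotations are weakly continuous, so invariance is a closed condition in the compact space of
probability measures on the compact metrizable ball. -/
lemma isCompact_range_weak :
    IsCompact (Set.range (InvMeasure.weak : InvMeasure H → ProbabilityMeasure (WeakBall H))) := by
  have h : Set.range (InvMeasure.weak : InvMeasure H → ProbabilityMeasure (WeakBall H)) =
      ⋂ θ : ℝ, {ρ | ρ.map (continuous_rotateWeak θ).measurable.aemeasurable = ρ} := by
    ext ρ
    simp only [Set.mem_range, Set.mem_iInter]
    constructor
    · rintro ⟨μ, rfl⟩ θ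
      exact Subtype.ext (μ.2 θ)
    · intro h
      exact ⟨⟨⟨(ρ : Measure (WeakBall H)),
        inferInstanceAs (IsProbabilityMeasure (ρ : Measure (WeakBall H)))⟩,
        fun θ => congrArg Subtype.val (h θ)⟩, rfl⟩
  rw [h]
  exact (isClosed_iInter fun θ => isClosed_eq
    (ProbabilityMeasure.continuous_map (continuous_rotateWeak θ)) continuous_id).isCompact

lemma compactSpace_weakNarrow : @CompactSpace _ (weakNarrow H) := by
  let τ : TopologicalSpace (InvMeasure H) :=
    TopologicalSpace.induced InvMeasure.weak inferInstance
  have hτ : @CompactSpace _ τ := by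
    refine ⟨?_⟩
    rw [(IsInducing.mk rfl : IsInducing (InvMeasure.weak : InvMeasure H → _)).isCompact_iff,
      Set.image_univ]
    exact isCompact_range_weak
  -- Compactness passes to coarser topologies, so only this inequality is needed.
  have hle : τ ≤ weakNarrow H := by
    refine le_iInf fun f => continuous_iff_le_induced.1 ?_
    let g : BoundedContinuousFunction (WeakBall H) ℝ :=
      BoundedContinuousFunction.mkOfCompact ⟨f.1, f.2.1⟩
    have h1 : Continuous fun ρ : ProbabilityMeasure (WeakBall H) =>
        ∫ φ, g φ ∂(ρ : Measure (WeakBall H)) :=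
      continuous_iff_continuousAt.2 fun ρ =>
        ProbabilityMeasure.tendsto_iff_forall_integral_tendsto.1 tendsto_id g
    exact h1.comp continuous_induced_dom
  exact @Function.Surjective.compactSpace _ _ τ (weakNarrow H) id (continuous_id_iff_le.2 hle) hτ
    Function.surjective_id

lemma continuous_integral_weakNarrow {f : WeakBall H → ℂ} (hf : Continuous f) :
    Continuous[weakNarrow H, inferInstance] fun μ : InvMeasure H =>
      ∫ φ : UnitBall H, f (toWeakBall φ) ∂(μ.1 : Measure (UnitBall H)) := by
  let _ : TopologicalSpace (InvMeasure H) := weakNarrow H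
  have h1 : ∀ μ : InvMeasure H,
      ∫ φ : UnitBall H, f (toWeakBall φ) ∂(μ.1 : Measure (UnitBall H)) =
      ((∫ φ : UnitBall H, (f (toWeakBall φ)).re ∂(μ.1 : Measure (UnitBall H)) : ℝ) : ℂ) +
      ((∫ φ : UnitBall H, (f (toWeakBall φ)).im ∂(μ.1 : Measure (UnitBall H)) : ℝ) : ℂ) *
        Complex.I := fun μ =>
    (integral_re_add_im (𝕜 := ℂ) (integrable_weakBall hf (μ.weak : Measure (WeakBall H)))).symm
  simp only [h1]
  exact (Complex.continuous_ofReal.comp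
    (continuous_integral_weakNarrow_real (Complex.continuous_re.comp hf))).add
    ((Complex.continuous_ofReal.comp
      (continuous_integral_weakNarrow_real (Complex.continuous_im.comp hf))).mul continuous_const)

variable [SecondCountableTopology H] (hH : ¬ FiniteDimensional ℂ H)

/-- The bijection between invariant measures and symmetric hierarchies. -/
noncomputable def momentEquiv : InvMeasure H ≃ symHierarchies H :=
  Equiv.ofBijective (fun μ => ⟨momentMap μ, momentMap_mem_symHierarchies hH μ⟩)
    ⟨fun _ _ h => momentMap_injective (congrArg Subtype.val h), fun γ => by
      obtain ⟨μ, hμ⟩ := exists_momentMap_eq γ.2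
      exact ⟨μ, Subtype.ext hμ⟩⟩

lemma continuous_momentEquiv_corrTopology :
    Continuous[weakNarrow H, corrTopology H] (momentEquiv hH) := by
  let _ : TopologicalSpace (InvMeasure H) := weakNarrow H
  refine continuous_induced_rng.2 (continuous_pi fun m => ?_)
  exact (continuous_integral_weakNarrow (continuous_pointMoment m)).congr
    fun μ => (corr_momentMap μ m).symm

lemma continuous_momentEquiv_symm :
    Continuous[corrTopology H, weakNarrow H] (momentEquiv hH).symm :=
  @continuous_symm_of_compactSpace _ _ (weakNarrow H) (corrTopology H) compactSpace_weakNarrow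
    t2Space_corrTopology _ (continuous_momentEquiv_corrTopology hH)

lemma continuous_momentEquiv_weakStar :
    Continuous[weakNarrow H, hierarchyWeakStar H] (momentEquiv hH) := by
  let _ : TopologicalSpace (InvMeasure H) := weakNarrow H
  refine continuous_induced_rng.2 ((@continuous_pi_iff _ _ _ _
    (fun k => weakStarTopology (symPower H k)) _).2 fun k => ?_)
  refine continuous_iInf_rng.2 fun A => continuous_induced_rng.2 ?_
  exact (continuous_integral_weakNarrow (continuous_inner_tensorPow_compactOperator A.2)).congr
    fun μ => (trace_momentMap_comp μ k A.1).symm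

/-- The inverse is continuous already for the coarser topology of correlations, by compactness;
continuity of Φ itself uses weak continuity of φ ↦ ⟨φ^{⊗k}, A φ^{⊗k}⟩ for compact A. -/
theorem isHomeomorph_momentEquiv_weak :
    @IsHomeomorph _ _ (weakNarrow H) (hierarchyWeakStar H) (momentEquiv hH) :=
  @isHomeomorph_of_continuous_symm _ _ (weakNarrow H) (hierarchyWeakStar H) _
    (continuous_momentEquiv_weakStar hH)
    (continuous_le_dom hierarchyWeakStar_le_corrTopology (continuous_momentEquiv_symm hH))

end WeakHomeomorphism

/-! ### Continuity of Banach-valued integrals in the measure -/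

section BochnerContinuity

variable {X : Type*} [TopologicalSpace X] [MeasurableSpace X] [BorelSpace X]

lemma continuous_integral_real {f : X → ℝ} (hf : Continuous f) {C : ℝ} (hC : ∀ x, ‖f x‖ ≤ C) :
    Continuous fun ν : ProbabilityMeasure X => ∫ x, f x ∂(ν : Measure X) :=
  continuous_iff_continuousAt.2 fun _ =>
    ProbabilityMeasure.tendsto_iff_forall_integral_tendsto.1 tendsto_id
      (BoundedContinuousFunction.ofNormedAddCommGroup f hf C hC)

variable [SecondCountableTopology X] {E : Type*} [NormedAddCommGroup E] [NormedSpace ℝ E]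

/-- A bounded continuous function is approximated by functions of finite rank, uniformly up to a
function of small mean. -/
lemma exists_finiteRank_approximation [Nonempty X] {F : X → E} (hF : Continuous F) {M : ℝ}
    (hM : ∀ x, ‖F x‖ ≤ M) (μ : ProbabilityMeasure X) {ε : ℝ} (hε : 0 < ε) :
    ∃ (n : ℕ) (e : ℕ → E) (c : ℕ → X → ℝ) (s : X → ℝ), (∀ j, Continuous (c j)) ∧
      (∀ j x, ‖c j x‖ ≤ 1) ∧ Continuous s ∧ (∀ x, ‖s x‖ ≤ 1) ∧
      ∫ x, s x ∂(μ : Measure X) < ε ∧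
      ∀ x, ‖F x - ∑ j ∈ Finset.range n, c j x • e j‖ ≤ ε + M * s x := by
  let d : ℕ → X := TopologicalSpace.denseSeq X
  -- Tent functions, positive exactly where F is within ε of its value at the j-th point of a dense
  -- sequence.
  let w : ℕ → X → ℝ := fun j x => max 0 (ε - ‖F x - F (d j)‖)
  have hw : ∀ j, Continuous (w j) := fun j => by fun_prop
  have hw0 : ∀ j x, 0 ≤ w j x := fun j x => le_max_left _ _
  let W : ℕ → X → ℝ := fun n x => ∑ j ∈ Finset.range n, w j x
  have hW0 : ∀ n x, 0 ≤ W n x := fun n x => Finset.sum_nonneg fun j _ => hw0 j x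
  have hW : ∀ n, Continuous (W n) := fun n => continuous_finsetSum _ fun j _ => hw j
  have hpos : ∀ n x, 0 < n * W n x + 1 := fun n x => by have := hW0 n x; positivity
  -- The weights n w j / (n W + 1) sum to 1 - s n, so s n is the defect of a partition of unity. It
  -- tends to zero pointwise by density, hence in mean; no tightness is involved.
  let s : ℕ → X → ℝ := fun n x => (n * W n x + 1)⁻¹
  have hs : ∀ n, Continuous (s n) := fun n =>
    ((continuous_const.mul (hW n)).add continuous_const).inv₀ fun x => (hpos n x).ne'
  have hs0 : ∀ n x, 0 ≤ s n x := fun n x => (inv_pos.2 (hpos n x)).le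
  have hs1 : ∀ n x, s n x ≤ 1 := fun n x => inv_le_one_of_one_le₀ (by
    have := hW0 n x
    have : 0 ≤ n * W n x := by positivity
    linarith)
  have hsn : ∀ n x, ‖s n x‖ ≤ 1 := fun n x => by
    rw [Real.norm_of_nonneg (hs0 n x)]; exact hs1 n x
  have hlim : ∀ x, Tendsto (fun n => s n x) atTop (𝓝 0) := fun x => by
    obtain ⟨j, hj⟩ := (TopologicalSpace.denseRange_denseSeq X).exists_mem_open
      (isOpen_lt ((continuous_const (y := F x)).sub hF).norm (continuous_const (y := ε)))
      ⟨x, by simpa using hε⟩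
    have hwj : 0 < w j x := lt_max_of_lt_right (sub_pos.2 hj)
    have h1 : Tendsto (fun n : ℕ => (n * w j x + 1)⁻¹) atTop (𝓝 0) :=
      tendsto_inv_atTop_zero.comp (tendsto_atTop_add_const_right _ _
        (tendsto_natCast_atTop_atTop.atTop_mul_const hwj))
    refine squeeze_zero' (Eventually.of_forall fun n => hs0 n x) ?_ h1
    filter_upwards [eventually_gt_atTop j] with n hn
    have h2 : w j x ≤ W n x := Finset.single_le_sum (f := fun j => w j x)
      (fun i _ => hw0 i x) (Finset.mem_range.2 hn)
    exact inv_anti₀ (by positivity) (by gcongr)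
  have hint : Tendsto (fun n => ∫ x, s n x ∂(μ : Measure X)) atTop (𝓝 0) := by
    have := tendsto_integral_of_dominated_convergence (μ := (μ : Measure X)) (F := s)
      (f := fun _ => (0 : ℝ)) (fun _ => 1) (fun n => (hs n).aestronglyMeasurable)
      (integrable_const _) (fun n => Eventually.of_forall (hsn n)) (Eventually.of_forall hlim)
    simpa using this
  obtain ⟨n, hn⟩ := (hint.eventually_lt_const hε).exists
  have hsum : ∀ x, ∑ j ∈ Finset.range n, n * w j x * s n x = n * W n x * s n x := fun x => by
    rw [← Finset.sum_mul, ← Finset.mul_sum]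
  have hone : ∀ x, n * W n x * s n x + s n x = 1 := fun x => by
    have := mul_inv_cancel₀ (hpos n x).ne'
    simp only [s]; linear_combination this
  have hc0 : ∀ j x, 0 ≤ n * w j x * s n x := fun j x => by
    have := hw0 j x; have := hs0 n x; positivity
  refine ⟨n, fun j => F (d j), fun j x => if j < n then n * w j x * s n x else 0, s n,
    fun j => ?_, fun j x => ?_, hs n, hsn n, hn, fun x => ?_⟩
  · by_cases hj : j < n
    · simp only [hj, if_true]
      exact (continuous_const.mul (hw j)).mul (hs n)
    · simp only [hj, if_false]
      exact continuous_const
  · dsimp only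
    split_ifs with hj
    · rw [Real.norm_of_nonneg (hc0 j x)]
      have h1 := Finset.single_le_sum (f := fun j => n * w j x * s n x) (fun i _ => hc0 i x)
        (Finset.mem_range.2 hj)
      rw [hsum] at h1
      have := hone x; have := hs0 n x
      linarith
    · simp
  · have h1 : F x - ∑ j ∈ Finset.range n, (if j < n then n * w j x * s n x else 0) • F (d j) =
        ∑ j ∈ Finset.range n, (n * w j x * s n x) • (F x - F (d j)) + s n x • F x := by
      have h2 : ∑ j ∈ Finset.range n, (if j < n then n * w j x * s n x else 0) • F (d j) =
          ∑ j ∈ Finset.range n, (n * w j x * s n x) • F (d j) :=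
        Finset.sum_congr rfl fun j hj => by rw [if_pos (Finset.mem_range.1 hj)]
      simp only [smul_sub, Finset.sum_sub_distrib, ← Finset.sum_smul, hsum]
      rw [h2]
      nth_rewrite 1 [← one_smul ℝ (F x)]
      rw [← hone x, add_smul]
      abel
    have h3 : ∀ j, ‖(n * w j x * s n x) • (F x - F (d j))‖ ≤ n * w j x * s n x * ε := fun j => by
      rw [norm_smul, Real.norm_of_nonneg (hc0 j x)]
      by_cases hj : ‖F x - F (d j)‖ ≤ ε
      · exact mul_le_mul_of_nonneg_left hj (hc0 j x)
      · have : w j x = 0 := max_eq_left (by linarith [not_le.1 hj])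
        simp [this]
    rw [h1]
    refine (norm_add_le _ _).trans (add_le_add ((norm_sum_le _ _).trans
      ((Finset.sum_le_sum fun j _ => h3 j).trans ?_)) ?_)
    · rw [← Finset.sum_mul, hsum]
      have := hone x; have := hs0 n x
      nlinarith
    · rw [norm_smul, Real.norm_of_nonneg (hs0 n x), mul_comm]
      exact mul_le_mul_of_nonneg_right (hM x) (hs0 n x)

/-- The integral of a bounded continuous function with values in a Banach space depends
continuously on the measure. -/
theorem continuous_integral_of_bounded [CompleteSpace E] {F : X → E} (hF : Continuous F) {M : ℝ}
    (hM : ∀ x, ‖F x‖ ≤ M) :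
    Continuous fun ν : ProbabilityMeasure X => ∫ x, F x ∂(ν : Measure X) := by
  rw [continuous_iff_continuousAt]
  intro μ
  have hX : Nonempty X := μ.nonempty
  have hM0 : 0 ≤ M := (norm_nonneg _).trans (hM hX.some)
  refine Metric.tendsto_nhds.2 fun ε' hε' => ?_
  -- Replacing F by its finite-rank approximation costs less than ε + M ε under each of μ and ν, and
  -- the approximations differ by less than ε: in total (2M + 3) ε.
  obtain ⟨ε, hε, hεε⟩ : ∃ ε > 0, (2 * M + 3) * ε < ε' := by
    refine ⟨ε' / (2 * (2 * M + 3)), by positivity, ?_⟩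
    have : 0 < 2 * M + 3 := by positivity
    field_simp
    norm_num
  obtain ⟨n, e, c, s, hc, hc1, hs, hs1, hsμ, hbd⟩ :=
    exists_finiteRank_approximation hF hM μ hε
  let G : X → E := fun x => ∑ j ∈ Finset.range n, c j x • e j
  have hci : ∀ (ν : ProbabilityMeasure X) j, Integrable (c j) (ν : Measure X) := fun ν j =>
    Integrable.of_bound (hc j).aestronglyMeasurable 1 (Eventually.of_forall (hc1 j))
  have hsi : ∀ ν : ProbabilityMeasure X, Integrable s (ν : Measure X) := fun ν =>
    Integrable.of_bound hs.aestronglyMeasurable 1 (Eventually.of_forall hs1)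
  have hFi : ∀ ν : ProbabilityMeasure X, Integrable F (ν : Measure X) := fun ν =>
    Integrable.of_bound hF.aestronglyMeasurable M (Eventually.of_forall hM)
  have hGi : ∀ ν : ProbabilityMeasure X, Integrable G (ν : Measure X) := fun ν =>
    integrable_finsetSum _ fun j _ => (hci ν j).smul_const (e j)
  have hG : Continuous fun ν : ProbabilityMeasure X => ∫ x, G x ∂(ν : Measure X) := by
    have h1 : ∀ ν : ProbabilityMeasure X, ∫ x, G x ∂(ν : Measure X) =
        ∑ j ∈ Finset.range n, (∫ x, c j x ∂(ν : Measure X)) • e j := fun ν => by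
      rw [integral_finsetSum _ fun j _ => (hci ν j).smul_const (e j)]
      exact Finset.sum_congr rfl fun j _ => integral_smul_const _ _
    simp only [h1]
    exact continuous_finsetSum _ fun j _ =>
      (continuous_integral_real (hc j) (hc1 j)).smul continuous_const
  have hFG : ∀ ν : ProbabilityMeasure X,
      ‖∫ x, F x ∂(ν : Measure X) - ∫ x, G x ∂(ν : Measure X)‖ ≤
        ε + M * ∫ x, s x ∂(ν : Measure X) := fun ν => by
    rw [← integral_sub (hFi ν) (hGi ν)]
    refine (norm_integral_le_of_norm_le ((integrable_const ε).add ((hsi ν).const_mul M))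
      (Eventually.of_forall hbd)).trans_eq ?_
    rw [integral_add' (integrable_const ε) ((hsi ν).const_mul M), integral_const_mul]
    simp
  filter_upwards [Metric.tendsto_nhds.1 (hG.tendsto μ) ε hε,
    ((continuous_integral_real hs hs1).tendsto μ).eventually_lt_const hsμ] with ν h1 h2
  rw [dist_eq_norm] at h1 ⊢
  have h3 := hFG ν
  have h4 := hFG μ
  have h5 := mul_le_mul_of_nonneg_left h2.le hM0
  have h6 := mul_le_mul_of_nonneg_left hsμ.le hM0
  rw [norm_sub_rev] at h4
  calc _ = ‖(∫ x, F x ∂(ν : Measure X) - ∫ x, G x ∂(ν : Measure X)) +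
        (∫ x, G x ∂(ν : Measure X) - ∫ x, G x ∂(μ : Measure X)) +
        (∫ x, G x ∂(μ : Measure X) - ∫ x, F x ∂(μ : Measure X))‖ := by congr 1; abel
    _ ≤ _ := norm_add₃_le
    _ < ε' := by linarith

end BochnerContinuity

/-! ### The homeomorphism for the strong topologies -/

section StrongHomeomorphism

lemma integrable_norm_sq {H : Type*} [NormedAddCommGroup H] [MeasurableSpace H] [BorelSpace H]
    (μ : ProbabilityMeasure (UnitBall H)) :
    Integrable (fun φ : UnitBall H => ‖φ.1‖ ^ 2) (μ : Measure (UnitBall H)) :=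
  Integrable.of_bound (continuous_subtype_val.norm.pow 2).aestronglyMeasurable 1
    (Eventually.of_forall fun φ => by
      rw [Real.norm_of_nonneg (by positivity)]
      exact pow_le_one₀ (norm_nonneg _) (unitBall_norm_le φ))

variable {H : Type*} [NormedAddCommGroup H] [InnerProductSpace ℂ H] [CompleteSpace H]

/-- The squared norm of the projection to the span of finitely many basis vectors. -/
noncomputable def truncNormSq (s : Finset (basisIndex H)) (φ : H) : ℝ :=
  ∑ i ∈ s, ‖⟪basis H i, φ⟫_ℂ‖ ^ 2

lemma truncNormSq_le (s : Finset (basisIndex H)) (φ : H) : truncNormSq s φ ≤ ‖φ‖ ^ 2 :=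
  (basis H).orthonormal.sum_inner_products_le φ

lemma truncNormSq_nonneg (s : Finset (basisIndex H)) (φ : H) : 0 ≤ truncNormSq s φ :=
  Finset.sum_nonneg fun _ _ => by positivity

lemma inner_trunc_self (s : Finset (basisIndex H)) (φ : H) :
    ⟪∑ i ∈ s, ⟪basis H i, φ⟫_ℂ • basis H i, ∑ i ∈ s, ⟪basis H i, φ⟫_ℂ • basis H i⟫_ℂ =
      (truncNormSq s φ : ℂ) := by
  rw [(basis H).orthonormal.inner_sum, truncNormSq]
  push_cast
  exact Finset.sum_congr rfl fun i _ => RCLike.conj_mul _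

lemma norm_trunc_sq (s : Finset (basisIndex H)) (φ : H) :
    ‖∑ i ∈ s, ⟪basis H i, φ⟫_ℂ • basis H i‖ ^ 2 = truncNormSq s φ := by
  have h := inner_trunc_self s φ
  rw [inner_self_eq_norm_sq_to_K] at h
  exact Complex.ofReal_injective ((Complex.ofReal_pow _ _).trans h)

lemma norm_sub_trunc_sq (s : Finset (basisIndex H)) (φ : H) :
    ‖φ - ∑ i ∈ s, ⟪basis H i, φ⟫_ℂ • basis H i‖ ^ 2 = ‖φ‖ ^ 2 - truncNormSq s φ := by
  have h : ⟪φ, ∑ i ∈ s, ⟪basis H i, φ⟫_ℂ • basis H i⟫_ℂ = (truncNormSq s φ : ℂ) := by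
    rw [inner_sum, truncNormSq]
    push_cast
    refine Finset.sum_congr rfl fun i _ => ?_
    rw [inner_smul_right, ← inner_conj_symm φ, RCLike.mul_conj]
    rfl
  rw [@norm_sub_sq ℂ, h, norm_trunc_sq]
  simp only [RCLike.re_to_complex, Complex.ofReal_re]
  ring

/-- The projection to the span of finitely many basis vectors, on the unit ball. -/
noncomputable def trunc (s : Finset (basisIndex H)) (φ : WeakBall H) : UnitBall H :=
  ⟨∑ i ∈ s, ⟪basis H i, φ.1⟫_ℂ • basis H i, by
    rw [mem_closedBall_zero_iff, ← sq_le_one_iff₀ (norm_nonneg _), norm_trunc_sq]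
    exact (truncNormSq_le s φ.1).trans (pow_le_one₀ (norm_nonneg _) (weakBall_norm_le φ))⟩

lemma continuous_trunc (s : Finset (basisIndex H)) : Continuous (trunc s : WeakBall H → _) :=
  Continuous.subtype_mk (continuous_finsetSum _ fun i _ =>
    (continuous_inner_weakBall (basis H i)).smul continuous_const) _

lemma continuous_truncNormSq (s : Finset (basisIndex H)) :
    Continuous fun φ : WeakBall H => truncNormSq s φ.1 :=
  continuous_finsetSum _ fun i _ => (continuous_inner_weakBall (basis H i)).norm.pow 2

variable [MeasurableSpace H] [BorelSpace H]

lemma integrable_truncNormSq (s : Finset (basisIndex H)) (μ : ProbabilityMeasure (UnitBall H)) :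
    Integrable (fun φ : UnitBall H => truncNormSq s φ.1) (μ : Measure (UnitBall H)) :=
  (integrable_norm_sq μ).mono'
    ((continuous_truncNormSq s).comp continuous_toWeakBall).aestronglyMeasurable
    (Eventually.of_forall fun φ => by
      rw [Real.norm_of_nonneg (truncNormSq_nonneg _ _)]
      exact truncNormSq_le s φ.1)

/-- A Lipschitz function and its composition with a projection have close integrals. -/
lemma abs_integral_sub_trunc_le {f : UnitBall H → ℝ} {L : NNReal} (hL : LipschitzWith L f)
    {C : ℝ} (hC : ∀ x, ‖f x‖ ≤ C) (μ : ProbabilityMeasure (UnitBall H))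
    (s : Finset (basisIndex H)) {δ : ℝ} (hδ : 0 < δ)
    (h : ∫ φ, ‖φ.1‖ ^ 2 ∂(μ : Measure (UnitBall H)) -
      ∫ φ, truncNormSq s φ.1 ∂(μ : Measure (UnitBall H)) < δ ^ 2) :
    |∫ φ, f φ ∂(μ : Measure (UnitBall H)) -
      ∫ φ, f (trunc s (toWeakBall φ)) ∂(μ : Measure (UnitBall H))| ≤ 2 * L * δ := by
  have hi : ∀ g : UnitBall H → ℝ, Continuous g → (∀ x, ‖g x‖ ≤ C) →
      Integrable g (μ : Measure (UnitBall H)) := fun g hg hgC =>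
    Integrable.of_bound hg.aestronglyMeasurable C (Eventually.of_forall hgC)
  have hq := (integrable_norm_sq μ).sub (integrable_truncNormSq s μ)
  rw [← integral_sub (hi f hL.continuous hC) (hi (fun φ => f (trunc s (toWeakBall φ)))
    (hL.continuous.comp
    ((continuous_trunc s).comp continuous_toWeakBall)) fun x => hC _), ← Real.norm_eq_abs]
  -- For t the distance from φ to its projection, t ≤ δ + t²/δ, and t² is ‖φ‖² minus `truncNormSq`;
  -- this puts the assumed gap of integrals to use.
  have hbd : ∀ φ : UnitBall H, ‖f φ - f (trunc s (toWeakBall φ))‖ ≤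
      L * δ + L * δ⁻¹ * (‖φ.1‖ ^ 2 - truncNormSq s φ.1) := fun φ => by
    have h1 := hL.dist_le_mul φ (trunc s (toWeakBall φ))
    rw [dist_eq_norm, Subtype.dist_eq, dist_eq_norm] at h1
    have h2 := norm_sub_trunc_sq s φ.1
    refine h1.trans ?_
    rw [← h2, mul_assoc, ← mul_add]
    refine mul_le_mul_of_nonneg_left ?_ L.2
    change ‖φ.1 - ∑ i ∈ s, ⟪basis H i, φ.1⟫_ℂ • basis H i‖ ≤ _
    set t := ‖φ.1 - ∑ i ∈ s, ⟪basis H i, φ.1⟫_ℂ • basis H i‖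
    have h3 : δ + δ⁻¹ * t ^ 2 - t = δ⁻¹ * ((t - δ / 2) ^ 2 + 3 / 4 * δ ^ 2) := by
      field_simp; ring
    have h4 : 0 ≤ δ⁻¹ * ((t - δ / 2) ^ 2 + 3 / 4 * δ ^ 2) := by positivity
    linarith
  refine (norm_integral_le_of_norm_le ((integrable_const (L * δ : ℝ)).add
    (hq.const_mul (L * δ⁻¹))) (Eventually.of_forall hbd)).trans ?_
  rw [integral_add' (integrable_const _) (hq.const_mul _), integral_const_mul, integral_const_mul,
    integral_sub' (integrable_norm_sq μ) (integrable_truncNormSq s μ)]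
  have h5 : (L : ℝ) * δ⁻¹ * (∫ φ, ‖φ.1‖ ^ 2 ∂(μ : Measure (UnitBall H)) -
      ∫ φ, truncNormSq s φ.1 ∂(μ : Measure (UnitBall H))) ≤ L * δ⁻¹ * δ ^ 2 :=
    mul_le_mul_of_nonneg_left h.le (by positivity)
  have h6 : (L : ℝ) * δ⁻¹ * δ ^ 2 = L * δ := by field_simp
  simp only [integral_const, probReal_univ, one_smul]
  linarith

variable [TopologicalSpace.SeparableSpace H]

lemma tendsto_integral_truncNormSq (μ : ProbabilityMeasure (UnitBall H)) :
    Tendsto (fun s : Finset (basisIndex H) => ∫ φ, truncNormSq s φ.1 ∂(μ : Measure (UnitBall H)))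
      atTop (𝓝 (∫ φ, ‖φ.1‖ ^ 2 ∂(μ : Measure (UnitBall H)))) := by
  refine tendsto_integral_filter_of_dominated_convergence (fun φ => ‖φ.1‖ ^ 2)
    (Eventually.of_forall fun s => (integrable_truncNormSq s μ).aestronglyMeasurable)
    (Eventually.of_forall fun s => Eventually.of_forall fun φ => ?_) (integrable_norm_sq μ)
    (Eventually.of_forall fun φ => hasSum_norm_inner_sq (basis H) φ.1)
  rw [Real.norm_of_nonneg (truncNormSq_nonneg _ _)]
  exact truncNormSq_le s φ.1

/-- Weak narrow convergence together with convergence of the second moment implies strong narrow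
convergence. -/
theorem tendsto_of_tendsto_weakNarrow {α : Type*} {l : Filter α} [l.IsCountablyGenerated]
    {ν : α → InvMeasure H} {μ : InvMeasure H} (hw : Tendsto ν l (@nhds _ (weakNarrow H) μ))
    (h2 : Tendsto (fun a => ∫ φ, ‖φ.1‖ ^ 2 ∂((ν a).1 : Measure (UnitBall H))) l
      (𝓝 (∫ φ, ‖φ.1‖ ^ 2 ∂(μ.1 : Measure (UnitBall H))))) :
    Tendsto (fun a => (ν a).1) l (𝓝 μ.1) := by
  rw [tendsto_iff_forall_lipschitz_integral_tendsto]
  rintro f ⟨C, hC⟩ ⟨L, hL⟩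
  have hf : ∀ x, ‖f x‖ ≤ ‖f 0‖ + C := fun x => by
    have h1 := hC x 0
    rw [dist_eq_norm] at h1
    linarith [norm_le_norm_add_norm_sub' (f x) (f 0)]
  have hreal : ∀ g : WeakBall H → ℝ, Continuous g →
      Tendsto (fun a => ∫ φ : UnitBall H, g (toWeakBall φ) ∂((ν a).1 : Measure (UnitBall H))) l
        (𝓝 (∫ φ : UnitBall H, g (toWeakBall φ) ∂(μ.1 : Measure (UnitBall H)))) := fun g hg =>
    (@Continuous.tendsto _ _ (weakNarrow H) _ _ (continuous_integral_weakNarrow_real hg) μ).comp hw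
  refine Metric.tendsto_nhds.2 fun ε hε => ?_
  obtain ⟨δ, hδ, hδε⟩ : ∃ δ > 0, 2 * (L : ℝ) * δ < ε / 3 := by
    refine ⟨ε / (6 * (L + 1)), by positivity, ?_⟩
    rw [mul_div_assoc', div_lt_div_iff₀ (by positivity) (by positivity)]
    nlinarith
  -- Finitely many basis vectors leave a tail of μ-mean below δ². The truncated part is weakly
  -- continuous, so convergence of second moments gives the same bound eventually along ν. The
  -- truncated test function is weakly continuous too.
  obtain ⟨s, hs⟩ := (((tendsto_integral_truncNormSq μ.1).const_sub
    (∫ φ, ‖φ.1‖ ^ 2 ∂(μ.1 : Measure (UnitBall H)))).eventually_lt_const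
    (u := δ ^ 2) (by rw [sub_self]; positivity)).exists
  filter_upwards [(h2.sub (hreal _ (continuous_truncNormSq s))).eventually_lt_const hs,
    Metric.tendsto_nhds.1 (hreal _ (hL.continuous.comp (continuous_trunc s))) (ε / 3)
      (by positivity)] with a ha1 ha2
  have h3 := abs_integral_sub_trunc_le hL hf (ν a).1 s hδ ha1
  have h4 := abs_integral_sub_trunc_le hL hf μ.1 s hδ hs
  rw [Real.dist_eq] at ha2 ⊢
  simp only [Function.comp_apply] at ha2
  rw [abs_lt] at ha2 ⊢
  rw [abs_le] at h3 h4
  constructor <;> linarith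

variable [SecondCountableTopology H] (hH : ¬ FiniteDimensional ℂ H)

lemma continuous_momentEquiv_norm :
    Continuous[strongNarrow H, hierarchyNorm H] (momentEquiv hH) := by
  let _ : TopologicalSpace (InvMeasure H) := strongNarrow H
  refine continuous_induced_rng.2 (continuous_pi fun k => ?_)
  exact (continuous_integral_of_bounded
    (continuous_dyad.comp ((continuous_tensorPow k).comp continuous_subtype_val)) (M := 1)
    fun φ : UnitBall H => (norm_dyad_le _).trans
      (pow_le_one₀ (norm_nonneg _) (norm_tensorPow_le k (toWeakBall φ)))).comp
    continuous_induced_dom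

lemma integral_norm_sq_eq_trace (μ : InvMeasure H) :
    ∫ φ, ‖φ.1‖ ^ 2 ∂(μ.1 : Measure (UnitBall H)) = (trace (momentMap μ 1).op).re := by
  have h := trace_ensemble (aestronglyMeasurable_tensorPow (μ.1 : Measure (UnitBall H)) 1)
    (integrable_norm_tensorPow_sq (μ.1 : Measure (UnitBall H)) 1)
  simp only [norm_tensorPow, pow_one] at h
  exact (congrArg Complex.re h).symm

/-- The trace is continuous in trace norm, unlike in the weak-∗ topology, and on the one-body matrix
it is the second moment of the measure; this is the extra input to `tendsto_of_tendsto_weakNarrow`.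
-/
lemma continuous_momentEquiv_symm_norm :
    Continuous[hierarchyNorm H, strongNarrow H] (momentEquiv hH).symm := by
  have hw : Continuous[hierarchyNorm H, weakNarrow H] (momentEquiv hH).symm :=
    continuous_le_dom hierarchyNorm_le_corrTopology (continuous_momentEquiv_symm hH)
  -- A countable product of normed spaces is first countable; the upgrade from weak to strong
  -- convergence needs a countably generated filter.
  have hfc : @FirstCountableTopology _ (hierarchyNorm H) :=
    TopologicalSpace.firstCountableTopology_induced _ _ _
  have htr : Continuous[hierarchyNorm H, inferInstance]
      fun γ : symHierarchies H => (trace (γ.1 1).op).re :=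
    continuous_induced_pi (E := fun k => TraceClass (symPower H k)) Subtype.val
      (g := fun T => (trace T.op).re) (Complex.continuous_re.comp continuous_trace)
  refine continuous_induced_rng.2 ((@continuous_iff_continuousAt _ _ (hierarchyNorm H) _ _).2
    fun γ => ?_)
  have := @FirstCountableTopology.nhds_generated_countable _ (hierarchyNorm H) hfc γ
  refine tendsto_of_tendsto_weakNarrow
    ((@continuous_iff_continuousAt _ _ (hierarchyNorm H) (weakNarrow H) _).1 hw γ) ?_
  simp only [integral_norm_sq_eq_trace]
  have h1 : ∀ γ, momentMap ((momentEquiv hH).symm γ) = γ.1 := fun γ =>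
    congrArg Subtype.val ((momentEquiv hH).apply_symm_apply γ)
  simp only [h1]
  exact (@continuous_iff_continuousAt _ _ (hierarchyNorm H) _ _).1 htr γ

theorem isHomeomorph_momentEquiv_strong :
    @IsHomeomorph _ _ (strongNarrow H) (hierarchyNorm H) (momentEquiv hH) :=
  @isHomeomorph_of_continuous_symm _ _ (strongNarrow H) (hierarchyNorm H) _
    (continuous_momentEquiv_norm hH) (continuous_momentEquiv_symm_norm hH)

end StrongHomeomorphism

end SymHier

theorem mainTheorem5 {H : Type*} [NormedAddCommGroup H] [InnerProductSpace ℂ H] [CompleteSpace H]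
    [TopologicalSpace.SeparableSpace H] [MeasurableSpace H] [BorelSpace H]
    (hH : ¬ FiniteDimensional ℂ H) :
    (∀ (μ : SymHier.InvMeasure H) (k : ℕ),
      Integrable (fun φ : SymHier.UnitBall H => SymHier.TraceClass.dyad (SymHier.tensorPow k φ.1))
        (μ.1 : Measure (SymHier.UnitBall H))) ∧
    ∃ Φ : SymHier.InvMeasure H ≃ SymHier.symHierarchies H,
      (∀ μ : SymHier.InvMeasure H, (Φ μ).1 = SymHier.momentMap μ) ∧
      @IsHomeomorph _ _ (SymHier.weakNarrow H) (SymHier.hierarchyWeakStar H) Φ ∧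
      @IsHomeomorph _ _ (SymHier.strongNarrow H) (SymHier.hierarchyNorm H) Φ := by
  have : SecondCountableTopology H := UniformSpace.secondCountable_of_separable H
  exact ⟨fun μ k => SymHier.integrable_dyad_tensorPow _ k, SymHier.momentEquiv hH, fun _ => rfl,
    SymHier.isHomeomorph_momentEquiv_weak hH, SymHier.isHomeomorph_momentEquiv_strong hH⟩
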